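/- \textbf{Model.} Interferers form a homogeneous Poisson point process of density $\lambda>0$ in the plane; $R_1\le R_2\le\cdots$ are their distances to the origin, where the receiver is. Let $b>1$, $k,T,r_0,N_0>0$ and $\sigma\in\mathbb R$; $\mathcal N_{\mathrm c}(0,v)$ is the law of a complex variable whose real and imaginary parts are independent $\mathcal N(0,v/2)$. Interferer $i\ge1$ contributes $e^{\sigma G_i}\mathbf X_i/R_i^b$ with $$\mathbf X_i=k\alpha_ie^{j\phi_i}\Big[\tfrac{D_i}{T}\,c_i+\big(1-\tfrac{D_i}{T}\big)c_i'\Big],$$ where $G_i\sim\mathcal N(0,1)$, $\phi_i\sim\mathcal U(0,2\pi)$, $D_i\sim\mathcal U(0,T)$, the $\alpha_i\ge0$ have a common law with $\mathbb E\{\alpha_i^2\}=1$ (e.g. Rayleigh), and $c_i,c_i'$ are symbols of a finite constellation in $\mathbb C$ with given symbol probabilities. The probe transmitter, at distance $r_0$, sends a symbol $s_K$ of a constellation $s_1,\dots,s_M$ of distinct points of $\mathbb C$, with $\mathbb P\{K=k\}=p_k$ and average energy $\mathcal E=\sum_kp_k|s_k|^2>0$; its shadowing is $G_0\sim\mathcal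 N(0,1)$ and its fading amplitude $\alpha_0$ is Rayleigh with $\mathbb E\{\alpha_0^2\}=1$. The noise is $\mathbf W\sim\mathcal N_{\mathrm c}(0,N_0)$. All these variables ($\alpha_i,\phi_i,G_i,c_i,c_i',D_i$ for $i\ge 1$, the point process, $\alpha_0,G_0,K,\mathbf W$) are mutually independent. The receiver observes $$\mathbf Z=h\,s_K+\mathbf Y+\mathbf W,\qquad h=\frac{k\alpha_0e^{\sigma G_0}}{r_0^b},\qquad \mathbf Y=\sum_{i=1}^\infty\frac{e^{\sigma G_i}\mathbf X_i}{R_i^b},$$ knows $h$, and decides for a symbol $s_l$ for which $|\mathbf Z-hs_l|$ is minimal (any measurable tie-breaking). $P_{\mathrm e}(G_0)$ is the conditional probability, given $G_0$, that the decision is wrong; it is thus averaged over the interferer positions. \textbf{Notation.} $\mathcal S(\alpha,\beta,\gamma)$ is, for $\alpha\ne1$, the real stable law with characteristic function $\exp[-\gamma|w|^\alpha(1-j\beta\,\mathrm{sign}(w)\tan\frac{\pi\alpha}2)]$. $C_x=\frac{1-x}{\Gamma(2-x)\cos(\pi x/2)}$ for $x\ne1$, $C_1=\frac2\pi$. Let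 $$V_G=2e^{2\sigma^2/b}\big(\lambda\pi C_{2/b}^{-1}\mathbb E\{|\mathrm{Re}\,\mathbf X_i|^{2/b}\}\big)^b,\quad E_0=k^2\mathcal E,\quad \eta_B=\frac{e^{2\sigma G_0}E_0}{r_0^{2b}(2BV_G+N_0)}.$$ With $\zeta_k=|s_k|^2/\mathcal E$ and $\xi_k=\arg s_k$ put $w_{k,l}=\zeta_k+\zeta_l-2\sqrt{\zeta_k\zeta_l}\cos(\xi_k-\xi_l)$. The decision region of $s_k$ is the set of points at least as near to $s_k$ as to every other $s_l$; $\mathcal B_k$ is the set of $l\ne k$ for which the decision regions of $s_k$ and $s_l$ share an edge (more than one point). For $l\in\mathcal B_k$, measure the direction from $s_k$ to a point $z$ of this edge by the angle $\arg\frac{z-s_k}{s_l-s_k}+\frac\pi2\in(0,\pi)$; these angles fill an interval, $\psi_{k,l}$ is its infimum and $\phi_{k,l}$ its length (so $\phi_{k,l}$ is the angle subtended by the edge at $s_k$). \textbf{Claim.} The series $\mathbf Y$ converges almost surely. There is a law $\mathcal S\big(\frac1b,1,\cos\frac{\pi}{2b}\big)$, it is carried by $(0,\infty)$, and, with $B$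 of this law and $\mathbf G\sim\mathcal N_{\mathrm c}(0,2V_G)$ independent, $\mathbf Y$ has the law of $\sqrt B\,\mathbf G$. Almost surely, $$P_{\mathrm e}(G_0)=\sum_{k=1}^Mp_k\sum_{l\in\mathcal B_k}\frac1{2\pi}\int_0^{\phi_{k,l}}\mathbb E_B\Big\{\Big(1+\frac{w_{k,l}}{4\sin^2(\theta+\psi_{k,l})}\eta_B\Big)^{-1}\Big\}d\theta .$$ With $\mathcal I_B(x,g)=\frac1\pi\int_0^x\mathbb E_B\{(1+\frac{g}{\sin^2\theta}\eta_B)^{-1}\}d\theta$, for equiprobable symbols one has, almost surely: for $M$-PSK ($M\ge2$) $$P_{\mathrm e}(G_0)=\mathcal I_B\Big(\tfrac{M-1}M\pi,\ \sin^2\tfrac\pi M\Big),$$ and for square $M$-QAM ($M=m^2$, $m\ge2$) $$P_{\mathrm e}(G_0)=4\Big(1-\tfrac1{\sqrt M}\Big)\mathcal I_B\Big(\tfrac\pi2,\tfrac3{2(M-1)}\Big)-4\Big(1-\tfrac1{\sqrt M}\Big)^2\mathcal I_B\Big(\tfrac\pi4,\tfrac3{2(M-1)}\Big).$$ -/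

import Mathlib

open MeasureTheory ProbabilityTheory Filter Topology

noncomputable section

namespace PoissonInterference

/-! ### Probability laws -/

/-- The stable law `S(α, β, γ)` on the line, through its characteristic function. -/
def IsStableLaw (ν : Measure ℝ) (α β γ : ℝ) : Prop :=
  ∀ w : ℝ, charFun ν w =
    if α ≠ 1 then
      Complex.exp (-(γ * |w| ^ α : ℝ) *
        (1 - Complex.I * (β * Real.sign w * Real.tan (Real.pi * α / 2) : ℝ)))
    else
      Complex.exp (-(γ * |w| : ℝ) *
        (1 + Complex.I * (2 / Real.pi * β * Real.sign w * Real.log |w| : ℝ)))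

/-- The circularly symmetric complex Gaussian law `N_c(0, v)` of total variance `v`: real and
imaginary parts are independent `N(0, v/2)`. -/
def complexGaussian (v : ℝ) : Measure ℂ :=
  ((gaussianReal 0 (v / 2).toNNReal).prod (gaussianReal 0 (v / 2).toNNReal)).map
    (fun q : ℝ × ℝ => (q.1 : ℂ) + q.2 * Complex.I)

/-- The Rayleigh law with unit power (second moment `1`), of density `2 x exp (-x²)` on `x ≥ 0`. -/
def unitRayleigh : Measure ℝ :=
  volume.withDensity
    (fun x => ENNReal.ofReal (if 0 ≤ x then 2 * x * Real.exp (-x ^ 2) else 0))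

/-- The plane in which the nodes live, with the receiver at the origin. -/
abbrev Plane : Type := EuclideanSpace ℝ (Fin 2)

/-- `pt 0, pt 1, …` enumerates, by increasing distance to the origin, the points of a homogeneous
Poisson point process of intensity `lam` in the plane. -/
structure IsPoissonField {Ω : Type*} [MeasurableSpace Ω] (μ : Measure Ω) (lam : ℝ)
    (pt : ℕ → Ω → Plane) : Prop where
  measurable : ∀ i, Measurable (pt i)
  ordered : ∀ᵐ ω ∂μ, Monotone fun i => ‖pt i ω‖
  count : ∀ S : Set Plane, MeasurableSet S → volume S ≠ ⊤ → ∀ n : ℕ,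
    μ {ω | {i | pt i ω ∈ S}.encard = n} =
      ENNReal.ofReal ((lam * (volume S).toReal) ^ n / n.factorial *
        Real.exp (-(lam * (volume S).toReal)))
  indep : ∀ (n : ℕ) (S : Fin n → Set Plane), (∀ j, MeasurableSet (S j)) →
    (∀ j, volume (S j) ≠ ⊤) → Pairwise (fun i j => Disjoint (S i) (S j)) →
    iIndepFun (fun j ω => {i | pt i ω ∈ S j}.encard) μ

/-! ### Geometry of a constellation -/

section Constellation

variable {M : ℕ} (s : Fin M → ℂ) (p : Fin M → ℝ)

/-- Average energy of the constellation `s` with symbol probabilities `p`. -/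
def avgEnergy : ℝ := ∑ k, p k * ‖s k‖ ^ 2

/-- `ζ_k = |s_k|² / E|s|²`. -/
def zeta (k : Fin M) : ℝ := ‖s k‖ ^ 2 / avgEnergy s p

/-- `w_{k,l} = ζ_k + ζ_l - 2 √(ζ_k ζ_l) cos (ξ_k - ξ_l)`, where `ξ_k = arg s_k`. -/
def wPar (k l : Fin M) : ℝ :=
  zeta s p k + zeta s p l -
    2 * Real.sqrt (zeta s p k * zeta s p l) * Real.cos ((s k).arg - (s l).arg)

/-- Closed decision region of the symbol `s k`, for minimum-distance detection. -/
def decisionRegion (k : Fin M) : Set ℂ := {z | ∀ j, ‖z - s k‖ ≤ ‖z - s j‖}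

/-- The part of the boundary that the decision regions of `s k` and `s l` have in common; for
`s k ≠ s l` it is a convex subset (segment, half-line, line) of their perpendicular bisector. -/
def commonEdge (k l : Fin M) : Set ℂ := decisionRegion s k ∩ decisionRegion s l

open Classical in
/-- `B_k`: indices of the points sharing a decision boundary (of more than one point) with `s k`. -/
def neighbors (k : Fin M) : Finset (Fin M) :=
  Finset.univ.filter fun l => l ≠ k ∧ (commonEdge s k l).Nontrivial

/-- Directions, in `(0, π)`, under which the points of the common edge of `s k` and `s l` are seen
from `s k`; they are measured from the direction parallel to the edge, so that `s l` itself is seen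
under the angle `π / 2`. -/
def edgeAngles (k l : Fin M) : Set ℝ :=
  (fun z : ℂ => ((z - s k) / (s l - s k)).arg + Real.pi / 2) '' commonEdge s k l

/-- `ψ_{k,l}`: the angle, at the first end point of the edge, between the edge and the segment that
joins this end point to `s k` (it is `0` when the edge is unbounded on that side). -/
def psiPar (k l : Fin M) : ℝ := sInf (edgeAngles s k l)

/-- `φ_{k,l}`: the angle subtended at `s k` by the common edge of `s k` and `s l`. -/
def phiPar (k l : Fin M) : ℝ := sSup (edgeAngles s k l) - sInf (edgeAngles s k l)

/-- `s` lists an `M`-PSK constellation (any radius `a > 0` and phase offset `t`). -/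
def IsPSK : Prop :=
  2 ≤ M ∧ ∃ a t : ℝ, 0 < a ∧ Set.range s =
    {z | ∃ j < M, z = a * Complex.exp (Complex.I * (t + 2 * Real.pi * j / M : ℝ))}

/-- `s` lists a square `M`-QAM constellation, `M = m²`, with spacing `2 d > 0` between adjacent
points. -/
def IsSquareQAM : Prop :=
  ∃ m : ℕ, 2 ≤ m ∧ M = m ^ 2 ∧ ∃ d : ℝ, 0 < d ∧ Set.range s =
    {z | ∃ u < m, ∃ v < m,
      z = (d * (2 * u - (m - 1)) : ℝ) + (d * (2 * v - (m - 1)) : ℝ) * Complex.I}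

/-- A coherent minimum-distance detector (with any measurable tie-breaking rule): given the channel
gain `h` and the observation `z`, it selects a symbol `s k` for which `h s_k` is nearest to `z`. -/
structure IsMinDistDetector (det : ℝ → ℂ → Fin M) : Prop where
  measurable : Measurable (Function.uncurry det)
  nearest : ∀ h z l, ‖z - h * s (det h z)‖ ≤ ‖z - h * s l‖

end Constellation

/-! ### The network model -/

/-- Parameters of the network: a probe link with `M` symbols and interferers with `L` symbols. -/
structure Params (M L : ℕ) where
  /-- spatial density of the interferers -/
  lam : ℝ
  /-- amplitude loss exponent -/
  b : ℝ
  /-- path gain constant -/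
  k : ℝ
  /-- shadowing coefficient -/
  sigma : ℝ
  /-- symbol period -/
  T : ℝ
  /-- length of the probe link -/
  r0 : ℝ
  /-- noise level -/
  N0 : ℝ
  /-- signal points of the probe transmitter -/
  s : Fin M → ℂ
  /-- symbol probabilities of the probe transmitter -/
  p : Fin M → ℝ
  /-- signal points of the interferers -/
  c : Fin L → ℂ
  /-- symbol probabilities of the interferers -/
  q : Fin L → ℝ
  /-- law of the fading amplitude of the interferers -/
  fadeLaw : Measure ℝ
  lam_pos : 0 < lam
  one_lt_b : 1 < b
  k_pos : 0 < k
  T_pos : 0 < T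
  r0_pos : 0 < r0
  N0_pos : 0 < N0
  s_injective : Function.Injective s
  p_nonneg : ∀ i, 0 ≤ p i
  p_sum : ∑ i, p i = 1
  energy_pos : 0 < avgEnergy s p
  q_nonneg : ∀ i, 0 ≤ q i
  q_sum : ∑ i, q i = 1
  fade_prob : IsProbabilityMeasure fadeLaw
  fade_nonneg : ∀ᵐ x ∂fadeLaw, 0 ≤ x
  fade_power : ∫ x, x ^ 2 ∂fadeLaw = 1

/-- The random variables of the model. Interferers are indexed by `i : ℕ`, by increasing distance
to the receiver. -/
structure Signals (Ω : Type*) (M L : ℕ) where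
  /-- positions of the interferers -/
  pt : ℕ → Ω → Plane
  /-- fading amplitudes of the interferers -/
  fade : ℕ → Ω → ℝ
  /-- fading phases of the interferers -/
  phase : ℕ → Ω → ℝ
  /-- shadowing of the interferers -/
  shadow : ℕ → Ω → ℝ
  /-- symbol sent by an interferer before the symbol change -/
  symA : ℕ → Ω → Fin L
  /-- symbol sent by an interferer after the symbol change -/
  symB : ℕ → Ω → Fin L
  /-- delays of the interferers -/
  delay : ℕ → Ω → ℝ
  /-- receiver noise -/
  noise : Ω → ℂ
  /-- fading amplitude of the probe link -/
  fade0 : Ω → ℝ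
  /-- shadowing of the probe link -/
  shadow0 : Ω → ℝ
  /-- symbol sent by the probe transmitter -/
  sym0 : Ω → Fin M

/-- Labels for the independent sources of randomness; all positions form one source. -/
inductive Source : Type
  | points | noise | fade0 | shadow0 | sym0
  | fade (i : ℕ) | phase (i : ℕ) | shadow (i : ℕ) | symA (i : ℕ) | symB (i : ℕ) | delay (i : ℕ)

/-- The σ-algebra generated by a source. -/
@[reducible]
def Signals.sigmaAlg {Ω : Type*} {M L : ℕ} (X : Signals Ω M L) : Source → MeasurableSpace Ω
  | .points => MeasurableSpace.comap (fun ω i => X.pt i ω) inferInstance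
  | .noise => MeasurableSpace.comap X.noise inferInstance
  | .fade0 => MeasurableSpace.comap X.fade0 inferInstance
  | .shadow0 => MeasurableSpace.comap X.shadow0 inferInstance
  | .sym0 => MeasurableSpace.comap X.sym0 inferInstance
  | .fade i => MeasurableSpace.comap (X.fade i) inferInstance
  | .phase i => MeasurableSpace.comap (X.phase i) inferInstance
  | .shadow i => MeasurableSpace.comap (X.shadow i) inferInstance
  | .symA i => MeasurableSpace.comap (X.symA i) inferInstance
  | .symB i => MeasurableSpace.comap (X.symB i) inferInstance
  | .delay i => MeasurableSpace.comap (X.delay i) inferInstance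

/-- The laws and the mutual independence of the random variables of the model, with Rayleigh fading
on the probe link. -/
structure IsNetwork {Ω : Type*} [MeasurableSpace Ω] (μ : Measure Ω) {M L : ℕ} (P : Params M L)
    (X : Signals Ω M L) : Prop where
  poisson : IsPoissonField μ P.lam X.pt
  fade_meas : ∀ i, Measurable (X.fade i)
  phase_meas : ∀ i, Measurable (X.phase i)
  shadow_meas : ∀ i, Measurable (X.shadow i)
  symA_meas : ∀ i, Measurable (X.symA i)
  symB_meas : ∀ i, Measurable (X.symB i)
  delay_meas : ∀ i, Measurable (X.delay i)
  noise_meas : Measurable X.noise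
  fade0_meas : Measurable X.fade0
  shadow0_meas : Measurable X.shadow0
  sym0_meas : Measurable X.sym0
  fade_law : ∀ i, μ.map (X.fade i) = P.fadeLaw
  phase_law : ∀ i, μ.map (X.phase i) = cond volume (Set.Icc 0 (2 * Real.pi))
  shadow_law : ∀ i, μ.map (X.shadow i) = gaussianReal 0 1
  symA_law : ∀ i j, μ {ω | X.symA i ω = j} = ENNReal.ofReal (P.q j)
  symB_law : ∀ i j, μ {ω | X.symB i ω = j} = ENNReal.ofReal (P.q j)
  delay_law : ∀ i, μ.map (X.delay i) = cond volume (Set.Icc 0 P.T)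
  noise_law : μ.map X.noise = complexGaussian P.N0
  fade0_law : μ.map X.fade0 = unitRayleigh
  shadow0_law : μ.map X.shadow0 = gaussianReal 0 1
  sym0_law : ∀ j, μ {ω | X.sym0 ω = j} = ENNReal.ofReal (P.p j)
  indep : iIndep X.sigmaAlg μ

section Model

variable {Ω : Type*} {M L : ℕ} (P : Params M L) (X : Signals Ω M L)

/-- `X_i = k α_i e^{jφ_i} [ (D_i/T) a_i e^{jθ_i} + (1 - D_i/T) a_i' e^{jθ_i'} ]`. -/
def contribution (i : ℕ) (ω : Ω) : ℂ :=
  P.k * X.fade i ω * Complex.exp (Complex.I * X.phase i ω) *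
    ((X.delay i ω / P.T : ℝ) * P.c (X.symA i ω) +
      (1 - X.delay i ω / P.T : ℝ) * P.c (X.symB i ω))

/-- Interference of the `n` interferers nearest to the receiver:
`∑_{i < n} e^{σ G_i} X_i / R_i^b`. -/
def partialInterference (n : ℕ) (ω : Ω) : ℂ :=
  ∑ i ∈ Finset.range n,
    (Real.exp (P.sigma * X.shadow i ω) / ‖X.pt i ω‖ ^ P.b : ℝ) * contribution P X i ω

/-- The aggregate interference `Y`, the sum of the series over all interferers. -/
def interference (ω : Ω) : ℂ := limUnder atTop fun n => partialInterference P X n ω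

/-- Channel gain `k α_0 e^{σ G_0} / r_0^b` of the probe link. -/
def gain (ω : Ω) : ℝ :=
  P.k * X.fade0 ω * Real.exp (P.sigma * X.shadow0 ω) / P.r0 ^ P.b

/-- The received signal `Z`. -/
def received (ω : Ω) : ℂ :=
  gain P X ω * P.s (X.sym0 ω) + interference P X ω + X.noise ω

/-- The event that the detector `det` decides for a wrong symbol. -/
def errorEvent (det : ℝ → ℂ → Fin M) : Set Ω :=
  {ω | det (gain P X ω) (received P X ω) ≠ X.sym0 ω}

/-- The constant `C_x`. -/
def stableConst (x : ℝ) : ℝ :=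
  if x ≠ 1 then (1 - x) / (Real.Gamma (2 - x) * Real.cos (Real.pi * x / 2)) else 2 / Real.pi

/-- `V_G = 2 e^{2σ²/b} (λ π C_{2/b}⁻¹ E|X_{i,n}|^{2/b})^b`. The real parts of all `X_i` have the
same law, so that the first one can be used. -/
def VG [MeasurableSpace Ω] (μ : Measure Ω) : ℝ :=
  2 * Real.exp (2 * P.sigma ^ 2 / P.b) *
    (P.lam * Real.pi * (stableConst (2 / P.b))⁻¹ *
      ∫ ω, |(contribution P X 0 ω).re| ^ (2 / P.b) ∂μ) ^ P.b

/-- Average symbol energy `E_0 = k² E{a_0²}` of the probe transmitter. -/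
def E0 : ℝ := P.k ^ 2 * avgEnergy P.s P.p

/-- `η_B = e^{2σ g} E_0 / (r_0^{2b} (2 B V + N_0))`, for the value `g` of the probe shadowing and the
value `B` of the stable variable. -/
def eta (V g B : ℝ) : ℝ :=
  Real.exp (2 * P.sigma * g) * E0 P / (P.r0 ^ (2 * P.b) * (2 * B * V + P.N0))

/-- The symbol error probability of a general constellation, with `B` of law `ν`. -/
def errorFormula (ν : Measure ℝ) (V g : ℝ) : ℝ :=
  ∑ k, P.p k * ∑ l ∈ neighbors P.s k, 1 / (2 * Real.pi) *
    ∫ t in (0 : ℝ)..phiPar P.s k l,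
      ∫ B, (1 + wPar P.s P.p k l / (4 * Real.sin (t + psiPar P.s k l) ^ 2) * eta P V g B)⁻¹ ∂ν

/-- The integral `I_B(x, y) = (1/π) ∫_0^x E_B{(1 + (y / sin² θ) η_B)⁻¹} dθ`. -/
def craigIntegral (ν : Measure ℝ) (V g x y : ℝ) : ℝ :=
  1 / Real.pi * ∫ t in (0 : ℝ)..x, ∫ B, (1 + y / Real.sin t ^ 2 * eta P V g B)⁻¹ ∂ν

end Model

end PoissonInterference

end

/-! Law of the interference. A mark, that is, a contribution with shadowing and without path loss,
is circularly symmetric because its phase is uniform; its characteristic function is therefore a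
real radial function, `markCF`. Given the positions, the interference from a disc has as
characteristic function a product over the points of `markCF (‖w‖ R_i^(-b))`, and the generating
functional of the Poisson process (`IsPoissonField.integral_finprod`) averages it to `exp(-λ ∫ (1 -
markCF (‖w‖ ‖x‖^(-b))) dx)`. Taking the path loss as radial variable makes the integral homogeneous
in `‖w‖`, and Fubini identifies its constant as an absolute moment of the mark
(`charFun_map_interference`): the law is isotropic stable of index `2/b`.

Gaussian mixture. A function `exp(-c ‖w‖^(2/b))` is the Laplace transform `exp(-r^(1/b))` of a
positive stable variable `B`, taken at an `r` proportional to `‖w‖²`, hence an average of Gaussian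
characteristic functions. Such a `B` is found inside the model: it is a normalised sum of the
`R_i^(-2b)` (`stableVar`), whose Laplace transform follows from the same generating functional;
analytic continuation then gives its characteristic function (`isStableLaw_of_laplace`). Only its
law is used afterwards.

Convergence. The series need not converge absolutely when `b ≤ 2`. Its terms are centred, and away
from the receiver the partial sums of each component form a martingale, bounded in `L²` since the
sum of `R_i^(-2b)` over the points outside the unit disc has finite mean for `b > 1`.

Error probability. Given `B`, interference plus noise is circular Gaussian of variance `2 B V_G +
N_0`. For Gaussian noise, polar coordinates around the sent symbol give the probability of leaving
its decision region: a direction contributes `exp(-ρ²)`, with `ρ` the distance at which the ray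
leaves (`complexGaussian_real_of_rays`). Rayleigh fading averages `exp(-C α²)` to `1/(1+C)`, and
Fubini brings in the mean over `B`. `condExp_errorEvent_of_sum_eq` carries any formula of this type
from Gaussian noise to the network, so the general, PSK and QAM cases differ only by planar
geometry. -/

namespace PoissonInterference

/-! ### Poisson point processes: generating functional, intensity, summability of powers of the
distances. -/

section PoissonField

variable {Ω : Type*} [MeasurableSpace Ω] {μ : Measure Ω} {lam : ℝ} {pt : ℕ → Ω → Plane}

lemma toENNReal_encard_eq_tsum (S : Set Plane) (x : ℕ → Plane) :
    ((({i | x i ∈ S} : Set ℕ).encard : ℕ∞) : ENNReal) = ∑' i, S.indicator 1 (x i) := by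
  rw [← ENNReal.tsum_set_one, tsum_subtype {i | x i ∈ S} (fun _ => (1 : ENNReal))]
  rfl

lemma measurable_encard (hpt : ∀ i, Measurable (pt i)) {S : Set Plane} (hS : MeasurableSet S) :
    Measurable fun ω => ({i | pt i ω ∈ S} : Set ℕ).encard := by
  have h : Measurable fun ω => ((({i | pt i ω ∈ S} : Set ℕ).encard : ℕ∞) : ENNReal) := by
    simp_rw [toENNReal_encard_eq_tsum]
    exact Measurable.tsum fun i => (measurable_one.indicator hS).comp (hpt i)
  refine measurable_to_countable' fun n => ?_
  have : (fun ω => ({i | pt i ω ∈ S} : Set ℕ).encard) ⁻¹' {n} =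
      (fun ω => ((({i | pt i ω ∈ S} : Set ℕ).encard : ℕ∞) : ENNReal)) ⁻¹' {(n : ENNReal)} := by
    ext ω; simp
  rw [this]
  exact h (measurableSet_singleton _)

lemma IsPoissonField.measure_encard (h : IsPoissonField μ lam pt) (hl : 0 ≤ lam) {S : Set Plane}
    (hS : MeasurableSet S) (hv : volume S ≠ ⊤) (n : ℕ) :
    μ {ω | ({i | pt i ω ∈ S} : Set ℕ).encard = n} =
      poissonMeasure (lam * (volume S).toReal).toNNReal {n} := by
  have hr' : (((lam * (volume S).toReal).toNNReal : NNReal) : ℝ) = lam * (volume S).toReal :=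
    Real.coe_toNNReal _ (by positivity)
  rw [h.count S hS hv, poissonMeasure_singleton, hr']
  congr 1
  ring

variable [IsProbabilityMeasure μ]

/-- The Poisson probabilities of the finite counts already add up to `1`, so no mass is left for the
value `⊤`. -/
lemma IsPoissonField.ae_finite (h : IsPoissonField μ lam pt) (hl : 0 ≤ lam) {S : Set Plane}
    (hS : MeasurableSet S) (hv : volume S ≠ ⊤) :
    ∀ᵐ ω ∂μ, ({i | pt i ω ∈ S} : Set ℕ).Finite := by
  have hm := measurable_encard h.measurable hS
  have h1 : μ (⋃ n : ℕ, {ω | ({i | pt i ω ∈ S} : Set ℕ).encard = n}) = 1 := by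
    rw [measure_iUnion]
    · simp_rw [h.measure_encard hl hS hv]
      have := Measure.tsum_indicator_apply_singleton
        (poissonMeasure (lam * (volume S).toReal).toNNReal) Set.univ MeasurableSet.univ
      simpa using this
    · intro a b hab
      refine Set.disjoint_left.2 fun ω (h1 : _ = _) (h2 : _ = _) => hab ?_
      exact_mod_cast h1.symm.trans h2
    · intro n
      exact hm (measurableSet_singleton _)
  have h2 : ∀ᵐ ω ∂μ, ω ∈ ⋃ n : ℕ, {ω | ({i | pt i ω ∈ S} : Set ℕ).encard = n} := by
    rw [← prob_compl_eq_zero_iff] at h1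
    · exact h1
    · exact MeasurableSet.iUnion fun n => hm (measurableSet_singleton _)
  filter_upwards [h2] with ω hω
  obtain ⟨n, hn⟩ := Set.mem_iUnion.1 hω
  exact Set.finite_of_encard_eq_coe hn

/-- `toNat` sends `⊤` to `0`; this is harmless because the count is almost surely finite. -/
lemma IsPoissonField.map_toNat_encard (h : IsPoissonField μ lam pt) (hl : 0 ≤ lam) {S : Set Plane}
    (hS : MeasurableSet S) (hv : volume S ≠ ⊤) :
    μ.map (fun ω => ({i | pt i ω ∈ S} : Set ℕ).encard.toNat) =
      poissonMeasure (lam * (volume S).toReal).toNNReal := by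
  have hm := measurable_encard h.measurable hS
  have hm' : Measurable fun ω => ({i | pt i ω ∈ S} : Set ℕ).encard.toNat :=
    (measurable_of_countable ENat.toNat).comp hm
  refine Measure.ext_of_singleton fun n => ?_
  rw [Measure.map_apply hm' (measurableSet_singleton _), ← h.measure_encard hl hS hv]
  refine measure_congr ?_
  filter_upwards [h.ae_finite hl hS hv] with ω hω
  obtain ⟨m, hm⟩ := ENat.ne_top_iff_exists.1 (Set.encard_ne_top_iff.2 hω)
  apply propext
  change ({i | pt i ω ∈ S} : Set ℕ).encard.toNat = n ↔ ({i | pt i ω ∈ S} : Set ℕ).encard = n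
  rw [← hm]
  simp

/-- This is the exponential series; it is entire, so `z` needs no bound. -/
lemma integral_pow_poissonMeasure (r : NNReal) (z : ℂ) :
    ∫ n, z ^ n ∂(poissonMeasure r) = Complex.exp (-(r * (1 - z))) := by
  rw [integral_poissonMeasure]
  have h := (NormedSpace.expSeries_div_hasSum_exp ((r : ℂ) * z)).mul_left (Complex.exp (-r))
  rw [← Complex.exp_eq_exp_ℂ, ← Complex.exp_add] at h
  have : -(r * (1 - z)) = -(r : ℂ) + r * z := by ring
  rw [this, ← h.tsum_eq]
  congr 1 with n
  rw [Complex.real_smul]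
  push_cast
  rw [mul_pow]
  ring

lemma IsPoissonField.integral_pow_encard (h : IsPoissonField μ lam pt) (hl : 0 ≤ lam)
    {S : Set Plane} (hS : MeasurableSet S) (hv : volume S ≠ ⊤) (z : ℂ) :
    ∫ ω, z ^ ({i | pt i ω ∈ S} : Set ℕ).encard.toNat ∂μ =
      Complex.exp (-(lam * (volume.real S : ℝ) * (1 - z))) := by
  have hm := measurable_encard h.measurable hS
  have hm' : Measurable fun ω => ({i | pt i ω ∈ S} : Set ℕ).encard.toNat :=
    (measurable_of_countable ENat.toNat).comp hm
  have := integral_pow_poissonMeasure (lam * (volume S).toReal).toNNReal z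
  rw [← h.map_toNat_encard hl hS hv, integral_map hm'.aemeasurable
    (measurable_of_countable _).aestronglyMeasurable] at this
  rw [this, Real.coe_toNNReal _ (by positivity)]
  push_cast
  rfl

/-- Points are grouped by the value of `ψ`; those outside `B` give the factor `1`. The product thus
depends only on counts in disjoint sets, about which the Poisson axioms speak. -/
lemma finprod_one_sub_simpleFunc (ψ : SimpleFunc Plane ℂ) (B : Set Plane) (x : ℕ → Plane)
    (hfin : ({i | x i ∈ B} : Set ℕ).Finite) :
    ∏ᶠ i, (1 - B.indicator ψ (x i)) =
      ∏ y ∈ ψ.range, (1 - y) ^ ({i | x i ∈ B ∩ ψ ⁻¹' {y}} : Set ℕ).encard.toNat := by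
  classical
  rw [finprod_eq_prod_of_mulSupport_subset (s := hfin.toFinset)]
  · rw [← Finset.prod_fiberwise_of_maps_to (g := fun i => ψ (x i)) (t := ψ.range)
      (fun i _ => SimpleFunc.mem_range_self _ _)]
    refine Finset.prod_congr rfl fun y _ => ?_
    have hset : ({i | x i ∈ B ∩ ψ ⁻¹' {y}} : Set ℕ) =
        ((hfin.toFinset.filter fun i => ψ (x i) = y : Finset ℕ) : Set ℕ) := by
      ext i; simp
    rw [hset, Set.encard_coe_eq_coe_finsetCard, ENat.toNat_natCast]
    refine Finset.prod_eq_pow_card fun i hi => ?_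
    rw [Finset.mem_filter, Set.Finite.mem_toFinset] at hi
    rw [Set.indicator_of_mem (show x i ∈ B from hi.1), hi.2]
  · intro i hi
    by_contra hc
    refine hi ?_
    have : x i ∉ B := by simpa using hc
    simp [this]

/-- The generating functional of a Poisson field at a simple function. -/
lemma IsPoissonField.integral_finprod_simpleFunc (h : IsPoissonField μ lam pt) (hl : 0 ≤ lam)
    {B : Set Plane} (hB : MeasurableSet B) (hv : volume B ≠ ⊤) (ψ : SimpleFunc Plane ℂ) :
    AEStronglyMeasurable (fun ω => ∏ᶠ i, (1 - B.indicator ψ (pt i ω))) μ ∧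
    ∫ ω, ∏ᶠ i, (1 - B.indicator ψ (pt i ω)) ∂μ = Complex.exp (-(lam * ∫ x in B, ψ x)) := by
  have hS : ∀ y, MeasurableSet (B ∩ ψ ⁻¹' {y}) := fun y => hB.inter (ψ.measurableSet_fiber y)
  have hSv : ∀ y, volume (B ∩ ψ ⁻¹' {y}) ≠ ⊤ := fun y =>
    ((measure_mono Set.inter_subset_left).trans_lt hv.lt_top).ne
  have hae : (fun ω => ∏ᶠ i, (1 - B.indicator ψ (pt i ω))) =ᵐ[μ] fun ω =>
      ∏ y ∈ ψ.range, (1 - y) ^ ({i | pt i ω ∈ B ∩ ψ ⁻¹' {y}} : Set ℕ).encard.toNat := by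
    filter_upwards [h.ae_finite hl hB hv] with ω hω
    exact finprod_one_sub_simpleFunc ψ B (fun i => pt i ω) hω
  have hmeas : ∀ y : ℂ, Measurable fun ω =>
      (1 - y) ^ ({i | pt i ω ∈ B ∩ ψ ⁻¹' {y}} : Set ℕ).encard.toNat := fun y =>
    (measurable_of_countable fun n : ℕ∞ => (1 - y) ^ n.toNat).comp
      (measurable_encard h.measurable (hS y))
  refine ⟨AEStronglyMeasurable.congr
    (Finset.measurable_prod _ fun y _ => hmeas y).aestronglyMeasurable hae.symm, ?_⟩
  rw [integral_congr_ae hae]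
  -- The independence axiom is indexed by `Fin n`, so the values of `ψ` are enumerated; their fibres
  -- are the disjoint sets.
  set n := ψ.range.card
  set e : ψ.range ≃ Fin n := ψ.range.equivFin
  have h1 : ∀ F : ℂ → ℂ, ∏ y ∈ ψ.range, F y = ∏ j : Fin n, F (e.symm j) := fun F => by
    rw [← Finset.prod_coe_sort]
    exact (Equiv.prod_comp e.symm (fun y : ψ.range => F y)).symm
  simp_rw [h1]
  have hind := h.indep n (fun j => B ∩ ψ ⁻¹' {(e.symm j : ℂ)}) (fun j => hS _) (fun j => hSv _) (by
    intro i j hij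
    refine Set.disjoint_left.2 fun x hx hx' => hij ?_
    have : (e.symm i : ℂ) = e.symm j := hx.2.symm.trans hx'.2
    exact e.symm.injective (Subtype.ext this))
  have hind' := hind.comp (fun j (m : ℕ∞) => (1 - (e.symm j : ℂ)) ^ m.toNat)
    (fun j => measurable_of_countable _)
  have := hind'.integral_fun_prod_eq_prod_integral
    (fun j => (hmeas (e.symm j)).aestronglyMeasurable)
  simp only [Function.comp_apply] at this
  rw [this]
  simp_rw [h.integral_pow_encard hl (hS _) (hSv _)]
  rw [← Complex.exp_sum]
  congr 1
  have hint : ∫ x in B, ψ x = ∑ y ∈ ψ.range, (volume.real (B ∩ ψ ⁻¹' {y}) : ℝ) • y := by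
    have hf : IsFiniteMeasure (volume.restrict B) := ⟨by simpa using hv.lt_top⟩
    rw [← SimpleFunc.integral_eq_integral ψ (SimpleFunc.integrable_of_isFiniteMeasure ψ),
      SimpleFunc.integral]
    refine Finset.sum_congr rfl fun y _ => ?_
    rw [weightedSMul_apply, measureReal_restrict_apply (ψ.measurableSet_fiber y), Set.inter_comm]
  rw [hint, ← Finset.sum_coe_sort ψ.range, Finset.mul_sum, ← Finset.sum_neg_distrib,
    ← Equiv.sum_comp e.symm]
  refine Finset.sum_congr rfl fun j _ => ?_
  rw [Complex.real_smul]
  ring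

/-- The generating functional of a Poisson field. -/
lemma IsPoissonField.integral_finprod (h : IsPoissonField μ lam pt) (hl : 0 ≤ lam)
    {B : Set Plane} (hB : MeasurableSet B) (hv : volume B ≠ ⊤) {f : Plane → ℂ}
    (hf : Measurable f) (hf1 : ∀ x, ‖f x‖ ≤ 1) :
    ∫ ω, ∏ᶠ i, (1 - B.indicator (fun x => 1 - f x) (pt i ω)) ∂μ =
      Complex.exp (-(lam * ∫ x in B, (1 - f x))) := by
  have hsm : StronglyMeasurable f := hf.stronglyMeasurable
  -- Approximants that stay in the unit disc keep every product bounded by `1`, however many points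
  -- there are: this is what dominates the limit.
  set φ := hsm.approxBounded 1 with hφ
  have hφ1 : ∀ n x, ‖φ n x‖ ≤ 1 := fun n x => hsm.norm_approxBounded_le zero_le_one n x
  have hφt : ∀ x, Tendsto (fun n => φ n x) atTop (𝓝 (f x)) := fun x =>
    hsm.tendsto_approxBounded_of_norm_le (hf1 x)
  set ψ : ℕ → SimpleFunc Plane ℂ := fun n => 1 - φ n
  have hfB : IsFiniteMeasure (volume.restrict B) := ⟨by simpa using hv.lt_top⟩
  have hψ : ∀ n x, ψ n x = 1 - φ n x := fun n x => rfl
  have hnorm : ∀ n (x : Plane), ‖1 - B.indicator (ψ n) x‖ ≤ 1 := fun n x => by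
    by_cases hx : x ∈ B
    · simpa [hx, hψ] using hφ1 n x
    · simp [hx]
  have key := fun n => h.integral_finprod_simpleFunc hl hB hv (ψ n)
  have lim1 : Tendsto (fun n => ∫ ω, ∏ᶠ i, (1 - B.indicator (ψ n) (pt i ω)) ∂μ) atTop
      (𝓝 (∫ ω, ∏ᶠ i, (1 - B.indicator (fun x => 1 - f x) (pt i ω)) ∂μ)) := by
    refine tendsto_integral_of_dominated_convergence (fun _ => 1) (fun n => (key n).1)
      (integrable_const _) (fun n => ?_) ?_
    · filter_upwards [h.ae_finite hl hB hv] with ω hω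
      rw [finprod_eq_prod_of_mulSupport_subset (s := hω.toFinset)]
      · rw [norm_prod]
        exact Finset.prod_le_one (fun _ _ => norm_nonneg _) fun i _ => hnorm n _
      · intro i hi
        by_contra hc
        exact hi (by have : pt i ω ∉ B := by simpa using hc
                     simp [this])
    · filter_upwards [h.ae_finite hl hB hv] with ω hω
      have hfp : ∀ g : Plane → ℂ, ∏ᶠ i, (1 - B.indicator g (pt i ω)) =
          ∏ i ∈ hω.toFinset, (1 - B.indicator g (pt i ω)) := fun g => by
        rw [finprod_eq_prod_of_mulSupport_subset]
        intro i hi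
        by_contra hc
        exact hi (by have : pt i ω ∉ B := by simpa using hc
                     simp [this])
      simp_rw [hfp]
      refine tendsto_finsetProd _ fun i hi => ?_
      have hi' : pt i ω ∈ B := by simpa using hi
      simp only [Set.indicator_of_mem hi', hψ, sub_sub_cancel]
      exact hφt _
  have lim2 : Tendsto (fun n => Complex.exp (-(lam * ∫ x in B, ψ n x))) atTop
      (𝓝 (Complex.exp (-(lam * ∫ x in B, (1 - f x))))) := by
    refine (Complex.continuous_exp.tendsto _).comp (Tendsto.neg (Tendsto.const_mul _ ?_))
    refine tendsto_integral_of_dominated_convergence (fun _ => 2)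
      (fun n => (ψ n).measurable.aestronglyMeasurable) (integrable_const _) (fun n => ?_) ?_
    · refine ae_of_all _ fun x => ?_
      rw [hψ]
      calc ‖1 - φ n x‖ ≤ ‖(1 : ℂ)‖ + ‖φ n x‖ := norm_sub_le _ _
        _ ≤ 2 := by rw [norm_one]; linarith [hφ1 n x]
    · exact ae_of_all _ fun x => by simpa only [hψ] using (hφt x).const_sub 1
  refine tendsto_nhds_unique lim1 ?_
  simpa only [(key _).2] using lim2

/-- The origin has area `0`, so the number of points there is Poisson of mean `0`. -/
lemma IsPoissonField.ae_ne_zero (h : IsPoissonField μ lam pt) : ∀ᵐ ω ∂μ, ∀ i, pt i ω ≠ 0 := by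
  have h0 := h.count {0} (measurableSet_singleton _) (by simp) 0
  have hm := measurable_encard h.measurable (measurableSet_singleton (0 : Plane))
  have h1 : μ {ω | ({i | pt i ω ∈ ({0} : Set Plane)} : Set ℕ).encard = (0 : ℕ)} = 1 := by
    rw [h0]; simp
  rw [← prob_compl_eq_zero_iff (show MeasurableSet {ω | _ = ((0 : ℕ) : ℕ∞)} from
    hm (measurableSet_singleton _))] at h1
  have h2 : ∀ᵐ ω ∂μ, ({i | pt i ω ∈ ({0} : Set Plane)} : Set ℕ).encard = (0 : ℕ) := h1
  filter_upwards [h2] with ω hω i hi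
  rw [Nat.cast_zero, Set.encard_eq_zero] at hω
  exact Set.notMem_empty i (hω ▸ (show i ∈ {i | pt i ω ∈ ({0} : Set Plane)} from hi))

/-- Each disc contains finitely many of the infinitely many indexed points; the ordering is not
needed. -/
lemma IsPoissonField.ae_tendsto_norm (h : IsPoissonField μ lam pt) (hl : 0 ≤ lam) :
    ∀ᵐ ω ∂μ, Tendsto (fun i => ‖pt i ω‖) atTop atTop := by
  have : ∀ᵐ ω ∂μ, ∀ m : ℕ, ({i | pt i ω ∈ Metric.closedBall (0 : Plane) m} : Set ℕ).Finite :=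
    ae_all_iff.2 fun m => h.ae_finite hl Metric.isClosed_closedBall.measurableSet
      measure_closedBall_lt_top.ne
  filter_upwards [this] with ω hω
  refine tendsto_atTop.2 fun b => ?_
  obtain ⟨m, hm⟩ := exists_nat_ge b
  rw [← Nat.cofinite_eq_atTop]
  refine (hω m).subset fun i hi => ?_
  simp only [Set.mem_compl_iff, Set.mem_ofPred_eq, not_le] at hi
  simpa using hi.le.trans hm

/-- From `(n + 1) P(n + 1) = r P(n)`, summed over `n`. -/
lemma lintegral_id_poissonMeasure (r : NNReal) :
    ∫⁻ n, (n : ENNReal) ∂(poissonMeasure r) = r := by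
  rw [lintegral_countable', tsum_eq_zero_add' ENNReal.summable]
  have hs : ∀ n : ℕ, ((n + 1 : ℕ) : ENNReal) * poissonMeasure r {n + 1} =
      r * poissonMeasure r {n} := fun n => by
    rw [poissonMeasure_singleton, poissonMeasure_singleton, ← ENNReal.ofReal_natCast,
      ← ENNReal.ofReal_coe_nnreal, ← ENNReal.ofReal_mul (by positivity),
      ← ENNReal.ofReal_mul (by positivity)]
    congr 1
    rw [Nat.factorial_succ]
    push_cast
    have : (n.factorial : ℝ) ≠ 0 := by positivity
    field_simp
    ring
  simp_rw [hs]
  rw [ENNReal.tsum_mul_left]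
  have := Measure.tsum_indicator_apply_singleton (poissonMeasure r) Set.univ MeasurableSet.univ
  simp only [Set.indicator_univ, measure_univ] at this
  rw [this]
  simp

/-- Campbell's theorem: the intensity measure of a Poisson field. -/
lemma IsPoissonField.sum_map (h : IsPoissonField μ lam pt) (hl : 0 ≤ lam) :
    Measure.sum (fun i => μ.map (pt i)) = ENNReal.ofReal lam • (volume : Measure Plane) := by
  have hfin : ∀ S : Set Plane, MeasurableSet S → volume S ≠ ⊤ →
      Measure.sum (fun i => μ.map (pt i)) S = ENNReal.ofReal lam * volume S := by
    intro S hS hv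
    have hm := measurable_encard h.measurable hS
    have hm' : Measurable fun ω => ({i | pt i ω ∈ S} : Set ℕ).encard.toNat :=
      (measurable_of_countable ENat.toNat).comp hm
    rw [Measure.sum_apply _ hS]
    have h1 : ∀ i, μ.map (pt i) S = ∫⁻ ω, S.indicator 1 (pt i ω) ∂μ := fun i => by
      rw [← lintegral_map (measurable_one.indicator hS) (h.measurable i),
        lintegral_indicator_one hS]
    simp_rw [h1]
    have h3 : ∀ i, Measurable fun ω => S.indicator (1 : Plane → ENNReal) (pt i ω) := fun i =>
      (measurable_one.indicator hS).comp (h.measurable i)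
    rw [← lintegral_tsum fun i => (h3 i).aemeasurable]
    simp_rw [← toENNReal_encard_eq_tsum]
    have h2 : ∫⁻ ω, ((({i | pt i ω ∈ S} : Set ℕ).encard : ℕ∞) : ENNReal) ∂μ =
        ∫⁻ ω, ((({i | pt i ω ∈ S} : Set ℕ).encard.toNat : ℕ) : ENNReal) ∂μ := by
      refine lintegral_congr_ae ?_
      filter_upwards [h.ae_finite hl hS hv] with ω hω
      obtain ⟨m, hm⟩ := ENat.ne_top_iff_exists.1 (Set.encard_ne_top_iff.2 hω)
      rw [← hm]
      simp
    rw [h2, ← lintegral_map (f := fun n : ℕ => (n : ENNReal)) (measurable_of_countable _) hm',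
      h.map_toNat_encard hl hS hv, lintegral_id_poissonMeasure]
    change ENNReal.ofReal _ = _
    rw [ENNReal.ofReal_mul hl, ENNReal.ofReal_toReal hv]
  ext S hS
  -- The mean count is known only for sets of finite area, so a general set is exhausted by discs.
  have hU : S = ⋃ m : ℕ, S ∩ Metric.closedBall (0 : Plane) m := by
    rw [← Set.inter_iUnion, Metric.iUnion_closedBall_nat, Set.inter_univ]
  have hmono : Monotone fun m : ℕ => S ∩ Metric.closedBall (0 : Plane) m := fun a b hab =>
    Set.inter_subset_inter_right _ (Metric.closedBall_subset_closedBall (by exact_mod_cast hab))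
  rw [hU, hmono.measure_iUnion, hmono.measure_iUnion]
  congr 1
  ext m
  rw [hfin _ (hS.inter Metric.isClosed_closedBall.measurableSet)
    ((measure_mono Set.inter_subset_right).trans_lt measure_closedBall_lt_top).ne]
  rfl

lemma IsPoissonField.tsum_lintegral (h : IsPoissonField μ lam pt) (hl : 0 ≤ lam)
    {F : Plane → ENNReal} (hF : Measurable F) :
    ∑' i, ∫⁻ ω, F (pt i ω) ∂μ = ENNReal.ofReal lam * ∫⁻ x, F x := by
  have := lintegral_smul_measure (μ := (volume : Measure Plane)) (ENNReal.ofReal lam) F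
  rw [smul_eq_mul] at this
  rw [← this, ← h.sum_map hl, lintegral_sum_measure]
  congr 1 with i
  rw [lintegral_map hF (h.measurable i)]

/-- Comparison with `(1 + ‖x‖)^(-q)`, integrable since `q` exceeds the dimension `2`; outside the
unit disc `‖x‖ ≥ (1 + ‖x‖)/2`. -/
lemma lintegral_rpow_neg_norm_lt_top {q : ℝ} (hq : 2 < q) :
    ∫⁻ x : Plane, ENNReal.ofReal (if 1 < ‖x‖ then ‖x‖ ^ (-q) else 0) < ⊤ := by
  have h1 : ∫⁻ x : Plane, ENNReal.ofReal ((1 + ‖x‖) ^ (-q)) < ⊤ :=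
    finite_integral_one_add_norm (by simpa using hq)
  have h2 : ∫⁻ x : Plane, ENNReal.ofReal (2 ^ q) * ENNReal.ofReal ((1 + ‖x‖) ^ (-q)) < ⊤ := by
    rw [lintegral_const_mul' _ _ ENNReal.ofReal_ne_top]
    exact ENNReal.mul_lt_top ENNReal.ofReal_lt_top h1
  refine lt_of_le_of_lt (lintegral_mono fun x => ?_) h2
  rw [← ENNReal.ofReal_mul (by positivity)]
  refine ENNReal.ofReal_le_ofReal ?_
  split_ifs with hx
  · have h3 : (1 + ‖x‖) / 2 ≤ ‖x‖ := by linarith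
    calc ‖x‖ ^ (-q) ≤ ((1 + ‖x‖) / 2) ^ (-q) :=
          Real.rpow_le_rpow_of_nonpos (by positivity) h3 (by linarith)
      _ = 2 ^ q * (1 + ‖x‖) ^ (-q) := by
          rw [Real.div_rpow (by positivity) (by norm_num), Real.rpow_neg zero_le_two q]
          field_simp
  · positivity

lemma IsPoissonField.tsum_lintegral_rpow_lt_top (h : IsPoissonField μ lam pt) (hl : 0 ≤ lam)
    {q : ℝ} (hq : 2 < q) :
    ∑' i, ∫⁻ ω, ENNReal.ofReal (if 1 < ‖pt i ω‖ then ‖pt i ω‖ ^ (-q) else 0) ∂μ < ⊤ := by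
  have hF : Measurable fun x : Plane => ENNReal.ofReal (if 1 < ‖x‖ then ‖x‖ ^ (-q) else 0) :=
    (Measurable.ite (measurableSet_lt measurable_const measurable_norm)
      (measurable_norm.pow_const _) measurable_const).ennreal_ofReal
  rw [h.tsum_lintegral hl hF]
  exact ENNReal.mul_lt_top ENNReal.ofReal_lt_top (lintegral_rpow_neg_norm_lt_top hq)

/-- By Campbell's theorem the sum over the points outside the unit disc has finite mean, and only
finitely many points are left out. -/
lemma IsPoissonField.ae_summable_rpow (h : IsPoissonField μ lam pt) (hl : 0 ≤ lam)
    {q : ℝ} (hq : 2 < q) : ∀ᵐ ω ∂μ, Summable fun i => ‖pt i ω‖ ^ (-q) := by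
  have hF : Measurable fun x : Plane => ENNReal.ofReal (if 1 < ‖x‖ then ‖x‖ ^ (-q) else 0) :=
    (Measurable.ite (measurableSet_lt measurable_const measurable_norm)
      (measurable_norm.pow_const _) measurable_const).ennreal_ofReal
  have h1 := h.tsum_lintegral_rpow_lt_top hl hq
  have hF' : ∀ i, Measurable fun ω =>
      ENNReal.ofReal (if 1 < ‖pt i ω‖ then ‖pt i ω‖ ^ (-q) else 0) := fun i =>
    hF.comp (h.measurable i)
  rw [← lintegral_tsum fun i => (hF' i).aemeasurable] at h1
  filter_upwards [ae_lt_top (Measurable.tsum hF') h1.ne,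
    h.ae_tendsto_norm hl] with ω h2 h3
  have h4 : Summable fun i => (if 1 < ‖pt i ω‖ then ‖pt i ω‖ ^ (-q) else 0) := by
    have := ENNReal.summable_toReal h2.ne
    refine this.congr fun i => ENNReal.toReal_ofReal ?_
    split_ifs <;> positivity
  refine h4.congr_atTop ?_
  filter_upwards [h3.eventually_gt_atTop 1] with i hi
  simp [hi]

end PoissonField

/-! ### Integrals over the plane and the constants of the stable laws. -/

section RadialIntegrals

/-- Integration over the plane of a function of a power of the distance to the origin. -/
lemma integral_norm_rpow_neg_plane {E : Type*} [NormedAddCommGroup E] [NormedSpace ℝ E]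
    (F : ℝ → E) {q : ℝ} (hq : 0 < q) :
    ∫ x : Plane, F (‖x‖ ^ (-q)) =
      (Real.pi * (2 / q)) • ∫ t in Set.Ioi (0 : ℝ), t ^ (-(2 / q) - 1) • F t := by
  have h1 := integral_fun_norm_addHaar (volume : Measure Plane) (fun y => F (y ^ (-q)))
  -- After polar coordinates, the substitution `t = y^(-q)` turns `y dy` into a multiple of
  -- `t^(-2/q-1) dt`.
  have h2 := integral_comp_rpow_Ioi (fun t => t ^ (-(2 / q) - 1) • F t) (p := -q) (by linarith)
  have h3 : volume.real (Metric.ball (0 : Plane) 1) = Real.pi := by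
    rw [Measure.real, EuclideanSpace.volume_ball_fin_two]
    simp [Real.pi_pos.le]
  rw [h1, ← h2, h3, finrank_euclideanSpace_fin, ← Nat.cast_smul_eq_nsmul ℝ]
  simp_rw [← integral_smul]
  refine setIntegral_congr_fun measurableSet_Ioi fun y (hy : 0 < y) => ?_
  simp only [smul_smul]
  congr 1
  rw [abs_neg, abs_of_pos hq, ← Real.rpow_mul hy.le]
  have h4 : y ^ (2 - 1) = y ^ (-q - 1) * y ^ (-q * (-(2 / q) - 1)) := by
    rw [← Real.rpow_add hy, show -q - 1 + -q * (-(2 / q) - 1) = 1 by field_simp; ring]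
    simp
  rw [h4]
  field_simp
  push_cast
  ring

/-- The measure `t^(-α-1) dt` is homogeneous. This scaling is where the exponent of the stable
characteristic function comes from. -/
lemma integral_rpow_smul_comp_mul {E : Type*} [NormedAddCommGroup E] [NormedSpace ℝ E]
    (F : ℝ → E) {α r : ℝ} (hα : 0 < α) (hr : 0 < r) :
    ∫ t in Set.Ioi (0 : ℝ), t ^ (-α - 1) • F (r * t) =
      r ^ α • ∫ t in Set.Ioi (0 : ℝ), t ^ (-α - 1) • F t := by
  have h := integral_comp_mul_left_Ioi (fun t => t ^ (-α - 1) • F t) 0 hr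
  rw [mul_zero] at h
  have h2 : ∫ t in Set.Ioi (0 : ℝ), t ^ (-α - 1) • F t =
      r • ∫ t in Set.Ioi (0 : ℝ), (r * t) ^ (-α - 1) • F (r * t) := by
    rw [h, smul_smul, mul_inv_cancel₀ hr.ne', one_smul]
  rw [h2, smul_smul, ← integral_smul]
  refine setIntegral_congr_fun measurableSet_Ioi fun t (ht : 0 < t) => ?_
  simp only [smul_smul]
  congr 1
  have h3 : r ^ α * (r * r ^ (-α - 1)) = 1 := by
    rw [← Real.rpow_one_add' hr.le (by linarith), ← Real.rpow_add hr,
      show α + (1 + (-α - 1)) = 0 by ring, Real.rpow_zero]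
  rw [Real.mul_rpow hr.le ht.le]
  linear_combination (-t ^ (-α - 1)) * h3

/-- A function bounded by `min C (C t^κ)` is integrable against `t^(-α-1) dt`, for `0 < α < κ`. -/
lemma integrableOn_rpow_smul {E : Type*} [NormedAddCommGroup E] [NormedSpace ℝ E]
    {F : ℝ → E} (hF : AEStronglyMeasurable F (volume.restrict (Set.Ioi 0))) {α κ C : ℝ}
    (hα : 0 < α) (hκ : α < κ) (h1 : ∀ t, 0 < t → ‖F t‖ ≤ C) (h2 : ∀ t, 0 < t → ‖F t‖ ≤ C * t ^ κ) :
    IntegrableOn (fun t : ℝ => t ^ (-α - 1) • F t) (Set.Ioi 0) := by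
  have hm : AEStronglyMeasurable (fun t : ℝ => t ^ (-α - 1) • F t)
      (volume.restrict (Set.Ioi 0)) :=
    (measurable_id.pow_const _).aestronglyMeasurable.smul hF
  rw [← Set.Ioc_union_Ioi_eq_Ioi zero_le_one] at hm ⊢
  have hm1 := hm.mono_measure (Measure.restrict_mono_set volume
    (Set.subset_union_left (s := Set.Ioc (0 : ℝ) 1) (t := Set.Ioi 1)))
  have hm2 := hm.mono_measure (Measure.restrict_mono_set volume
    (Set.subset_union_right (s := Set.Ioc (0 : ℝ) 1) (t := Set.Ioi 1)))
  refine IntegrableOn.union ?_ ?_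
  · have hi : IntegrableOn (fun t : ℝ => C * t ^ (κ - α - 1)) (Set.Ioc 0 1) := by
      rw [← intervalIntegrable_iff_integrableOn_Ioc_of_le zero_le_one]
      exact (intervalIntegral.intervalIntegrable_rpow' (by linarith)).const_mul C
    refine hi.mono' hm1 ?_
    filter_upwards [ae_restrict_mem measurableSet_Ioc] with t ht
    rw [norm_smul, Real.norm_of_nonneg (Real.rpow_nonneg ht.1.le _)]
    calc t ^ (-α - 1) * ‖F t‖ ≤ t ^ (-α - 1) * (C * t ^ κ) :=
          mul_le_mul_of_nonneg_left (h2 t ht.1) (Real.rpow_nonneg ht.1.le _)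
      _ = C * t ^ (κ - α - 1) := by
          rw [show κ - α - 1 = (-α - 1) + κ by ring, Real.rpow_add ht.1]; ring
  · have hi : IntegrableOn (fun t : ℝ => C * t ^ (-α - 1)) (Set.Ioi 1) :=
      (integrableOn_Ioi_rpow_of_lt (by linarith) zero_lt_one).const_mul C
    refine hi.mono' hm2 ?_
    filter_upwards [ae_restrict_mem measurableSet_Ioi] with t ht
    have ht0 : (0 : ℝ) < t := zero_lt_one.trans ht
    rw [norm_smul, Real.norm_of_nonneg (Real.rpow_nonneg ht0.le _), mul_comm]
    exact mul_le_mul_of_nonneg_right (h1 t ht0) (Real.rpow_nonneg ht0.le _)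

/-- A function bounded by `min C (C ‖x‖^(-q))` is integrable over the plane, for `q > 2`. -/
lemma integrable_plane_of_bound {E : Type*} [NormedAddCommGroup E] {f : Plane → E}
    (hf : AEStronglyMeasurable f volume) {q C : ℝ} (hq : 2 < q) (h1 : ∀ x, ‖f x‖ ≤ C)
    (h2 : ∀ x, ‖f x‖ ≤ C * ‖x‖ ^ (-q)) : Integrable f := by
  have hC : 0 ≤ C := (norm_nonneg _).trans (h1 0)
  have hi1 : IntegrableOn (fun _ : Plane => C) (Metric.closedBall 0 1) :=
    integrableOn_const measure_closedBall_lt_top.ne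
  have hi2 : Integrable fun x : Plane => if 1 < ‖x‖ then ‖x‖ ^ (-q) else 0 := by
    refine ⟨(Measurable.ite (measurableSet_lt measurable_const measurable_norm)
      (measurable_norm.pow_const _) measurable_const).aestronglyMeasurable, ?_⟩
    rw [hasFiniteIntegral_iff_ofReal]
    · exact lintegral_rpow_neg_norm_lt_top hq
    · refine ae_of_all _ fun x => ?_
      simp only [Pi.zero_apply]
      split_ifs <;> positivity
  have hi3 := (integrable_indicator_iff Metric.isClosed_closedBall.measurableSet).2 hi1
  refine (hi3.add (hi2.const_mul C)).mono' hf (ae_of_all _ fun x => ?_)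
  simp only [Pi.add_apply]
  by_cases hx : 1 < ‖x‖
  · have : x ∉ Metric.closedBall (0 : Plane) 1 := by simpa using hx
    simpa [this, hx] using h2 x
  · have : x ∈ Metric.closedBall (0 : Plane) 1 := by simpa using hx
    simpa [this, hx] using h1 x

/-- Integration by parts against `-t^(-α)/α` leaves a Gamma integral. Since `1 - e^(-t)` is at most
`min 1 t`, the boundary terms vanish at `0` (as `α < 1`) and at infinity (as `α > 0`). -/
lemma integral_rpow_mul_one_sub_exp_neg {α : ℝ} (h0 : 0 < α) (h1 : α < 1) :
    ∫ t in Set.Ioi (0 : ℝ), t ^ (-α - 1) * (1 - Real.exp (-t)) = Real.Gamma (1 - α) / α := by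
  have hb : ∀ t : ℝ, 0 < t → 0 ≤ 1 - Real.exp (-t) ∧ 1 - Real.exp (-t) ≤ 1 ∧
      1 - Real.exp (-t) ≤ t := fun t ht => by
    have := Real.add_one_le_exp (-t)
    have := Real.exp_pos (-t)
    have : Real.exp (-t) ≤ 1 := Real.exp_le_one_iff.2 (by linarith)
    refine ⟨?_, ?_, ?_⟩ <;> linarith
  have hG := Real.integral_rpow_mul_exp_neg_mul_Ioi (a := 1 - α) (r := 1) (by linarith) one_pos
  have hΓ : 0 < Real.Gamma (1 - α) := Real.Gamma_pos_of_pos (by linarith)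
  have hint : IntegrableOn (fun t : ℝ => t ^ (-α) * Real.exp (-t)) (Set.Ioi 0) := by
    have := Real.GammaIntegral_convergent (s := 1 - α) (by linarith)
    refine this.congr_fun (fun t _ => ?_) measurableSet_Ioi
    simp only
    rw [mul_comm]; congr 2; ring
  have hparts := integral_Ioi_mul_deriv_eq_deriv_mul (a := (0 : ℝ)) (a' := (0 : ℝ)) (b' := (0 : ℝ))
    (u := fun t => 1 - Real.exp (-t)) (u' := fun t => Real.exp (-t))
    (v := fun t => -t ^ (-α) / α) (v' := fun t => t ^ (-α - 1)) ?_ ?_ ?_ ?_ ?_ ?_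
  · rw [show (∫ t in Set.Ioi (0 : ℝ), t ^ (-α - 1) * (1 - Real.exp (-t))) =
      ∫ t in Set.Ioi (0 : ℝ), (1 - Real.exp (-t)) * t ^ (-α - 1) by simp_rw [mul_comm], hparts]
    have : ∀ t : ℝ, Real.exp (-t) * (-t ^ (-α) / α) =
        (-1 / α) * (t ^ (1 - α - 1) * Real.exp (-(1 * t))) := fun t => by
      rw [show 1 - α - 1 = -α by ring, one_mul]; ring
    simp_rw [this]
    rw [integral_const_mul, hG]
    simp; ring
  · intro t _
    simpa using ((hasDerivAt_neg t).exp).const_sub 1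
  · intro t ht
    have := ((Real.hasDerivAt_rpow_const (x := t) (p := -α) (Or.inl (ne_of_gt ht))).neg).div_const α
    convert! this using 1
    field_simp
  · have := integrableOn_rpow_smul (F := fun t : ℝ => 1 - Real.exp (-t)) (α := α) (κ := 1) (C := 1)
      (by fun_prop) h0 h1
      (fun t ht => by rw [Real.norm_of_nonneg (hb t ht).1]; exact (hb t ht).2.1)
      (fun t ht => by rw [Real.norm_of_nonneg (hb t ht).1]; simpa using (hb t ht).2.2)
    refine this.congr_fun (fun t _ => ?_) measurableSet_Ioi
    simp [mul_comm]
  · refine IntegrableOn.congr_fun (f := fun t : ℝ => (-1 / α) * (t ^ (-α) * Real.exp (-t)))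
      (hint.const_mul (-1 / α)) (fun t _ => ?_) measurableSet_Ioi
    simp; ring
  · have hlim : Tendsto (fun t : ℝ => t ^ (1 - α) / α) (𝓝[>] 0) (𝓝 0) := by
      have := (Real.continuousAt_rpow_const 0 (1 - α) (Or.inr (by linarith))).tendsto.div_const α
      rw [Real.zero_rpow (by linarith), zero_div] at this
      exact this.mono_left nhdsWithin_le_nhds
    refine squeeze_zero_norm' ?_ hlim
    filter_upwards [self_mem_nhdsWithin] with t (ht : 0 < t)
    have := Real.rpow_pos_of_pos ht (-α)
    rw [Pi.mul_apply, norm_mul, Real.norm_of_nonneg (hb t ht).1, norm_div, norm_neg,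
      Real.norm_of_nonneg this.le, Real.norm_of_nonneg h0.le, ← mul_div_assoc,
      show 1 - α = 1 + -α by ring, Real.rpow_add ht, Real.rpow_one]
    gcongr
    exact (hb t ht).2.2
  · have hlim : Tendsto (fun t : ℝ => t ^ (-α) / α) atTop (𝓝 0) := by
      simpa using (tendsto_rpow_neg_atTop h0).div_const α
    refine squeeze_zero_norm' ?_ hlim
    filter_upwards [eventually_gt_atTop 0] with t ht
    have := Real.rpow_pos_of_pos ht (-α)
    rw [Pi.mul_apply, norm_mul, Real.norm_of_nonneg (hb t ht).1, norm_div, norm_neg,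
      Real.norm_of_nonneg this.le, Real.norm_of_nonneg h0.le]
    exact mul_le_of_le_one_left (by positivity) (hb t ht).2.1

/-- A nonzero Bochner integral forces integrability, the integral being `0` otherwise. Known values
of real integrals can thus be used in Tonelli computations without a separate integrability proof.
-/
lemma lintegral_ofReal_eq_of_integral_eq {s : Set ℝ} (hs : MeasurableSet s) {f : ℝ → ℝ} {c : ℝ}
    (hf : ∀ t ∈ s, 0 ≤ f t) (hc : 0 < c) (h : ∫ t in s, f t = c) :
    ∫⁻ t in s, ENNReal.ofReal (f t) = ENNReal.ofReal c := by
  have hi : IntegrableOn f s := by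
    by_contra hi
    rw [integral_undef hi] at h
    exact hc.ne h
  rw [← h, ofReal_integral_eq_lintegral_ofReal hi]
  filter_upwards [ae_restrict_mem hs] with t ht using hf t ht

/-- Real part of the difference of the integrals of `e^(-xt)` and `e^((-x+i)t)`, which is `1/x -
x/(1+x²)`. -/
lemma integral_one_sub_cos_mul_exp_neg {x : ℝ} (hx : 0 < x) :
    ∫ t in Set.Ioi (0 : ℝ), (1 - Real.cos t) * Real.exp (-(t * x)) = 1 / (x * (1 + x ^ 2)) := by
  have h1 := integral_exp_mul_complex_Ioi (a := ((-x : ℝ) : ℂ)) (by simpa using hx) 0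
  have h2 := integral_exp_mul_complex_Ioi (a := ((-x : ℝ) : ℂ) + Complex.I) (by simpa using hx) 0
  have i1 := integrableOn_exp_mul_complex_Ioi (a := ((-x : ℝ) : ℂ)) (by simpa using hx) 0
  have i2 := integrableOn_exp_mul_complex_Ioi (a := ((-x : ℝ) : ℂ) + Complex.I)
    (by simpa using hx) 0
  have h3 := integral_sub i1 i2
  rw [h1, h2] at h3
  have h4 := congrArg Complex.re h3
  have h5 := integral_re (i1.sub i2)
  simp only [RCLike.re_eq_complex_re, Pi.sub_apply] at h5
  rw [← h5] at h4
  have h6 : ∀ t : ℝ, (Complex.exp (((-x : ℝ) : ℂ) * t) -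
      Complex.exp ((((-x : ℝ) : ℂ) + Complex.I) * t)).re =
      (1 - Real.cos t) * Real.exp (-(t * x)) := fun t => by
    rw [Complex.sub_re, Complex.exp_re, Complex.exp_re]
    simp
    rw [mul_comm x t]; ring
  simp_rw [h6] at h4
  rw [h4]
  simp [Complex.div_re, Complex.normSq_apply]
  have : x * x + 1 ≠ 0 := by positivity
  field_simp
  ring

/-- Write `1/(1+x²)` as `∫ e^(-(1+x²)y) dy` and exchange: the result is `Γ(α/2) Γ(1-α/2)/2`, to
which the reflection formula applies. -/
lemma integral_rpow_div_one_add_sq {α : ℝ} (h0 : 0 < α) (h2 : α < 2) :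
    ∫⁻ x in Set.Ioi (0 : ℝ), ENNReal.ofReal (x ^ (α - 1) / (1 + x ^ 2)) =
      ENNReal.ofReal (Real.pi / (2 * Real.sin (Real.pi * α / 2))) := by
  have e1 : ∀ x ∈ Set.Ioi (0 : ℝ), ENNReal.ofReal (x ^ (α - 1) / (1 + x ^ 2)) =
      ∫⁻ y in Set.Ioi (0 : ℝ),
        ENNReal.ofReal (x ^ (α - 1) * Real.exp (-(1 + x ^ 2) * y)) := fun x (hx : 0 < x) => by
    symm
    have hx' := Real.rpow_pos_of_pos hx (α - 1)
    refine lintegral_ofReal_eq_of_integral_eq measurableSet_Ioi (fun y _ => by positivity)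
      (by positivity) ?_
    rw [integral_const_mul, integral_exp_mul_Ioi (by nlinarith), mul_zero, Real.exp_zero,
      neg_div_neg_eq]
    ring
  rw [setLIntegral_congr_fun measurableSet_Ioi e1, lintegral_lintegral_swap]
  · have e2 : ∀ y ∈ Set.Ioi (0 : ℝ), ∫⁻ x in Set.Ioi (0 : ℝ),
        ENNReal.ofReal (x ^ (α - 1) * Real.exp (-(1 + x ^ 2) * y)) =
        ENNReal.ofReal (y ^ (1 - α / 2 - 1) * Real.exp (-(1 * y)) *
          (Real.Gamma (α / 2) / 2)) := fun y (hy : 0 < y) => by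
      have hy' := Real.rpow_pos_of_pos hy (1 - α / 2 - 1)
      have hΓ : 0 < Real.Gamma (α / 2) := Real.Gamma_pos_of_pos (by linarith)
      refine lintegral_ofReal_eq_of_integral_eq measurableSet_Ioi
        (fun x (hx : 0 < x) => mul_nonneg (Real.rpow_nonneg hx.le _) (Real.exp_pos _).le)
        (by positivity) ?_
      have := integral_rpow_mul_exp_neg_mul_rpow (p := 2) (q := α - 1) (b := y) two_pos
        (by linarith) hy
      have e3 : ∀ x : ℝ, x ^ (α - 1) * Real.exp (-(1 + x ^ 2) * y) =
          Real.exp (-y) * (x ^ (α - 1) * Real.exp (-y * x ^ (2 : ℝ))) := fun x => by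
        rw [Real.rpow_two, mul_left_comm, ← Real.exp_add]; congr 2; ring
      simp_rw [e3]
      rw [integral_const_mul, this, show -(α - 1 + 1) / 2 = 1 - α / 2 - 1 by ring,
        show (α - 1 + 1) / 2 = α / 2 by ring, one_mul]
      ring
    rw [setLIntegral_congr_fun measurableSet_Ioi e2]
    have hsin : 0 < Real.sin (Real.pi * α / 2) :=
      Real.sin_pos_of_pos_of_lt_pi (by positivity) (by nlinarith [Real.pi_pos])
    refine lintegral_ofReal_eq_of_integral_eq measurableSet_Ioi (fun y (hy : 0 < y) => ?_)
      (by positivity) ?_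
    · have hΓ : 0 < Real.Gamma (α / 2) := Real.Gamma_pos_of_pos (by linarith)
      have hy' := Real.rpow_pos_of_pos hy (1 - α / 2 - 1)
      positivity
    · rw [integral_mul_const, Real.integral_rpow_mul_exp_neg_mul_Ioi (by linarith) one_pos]
      have := Real.Gamma_mul_Gamma_one_sub (α / 2)
      rw [mul_div_assoc]
      simp only [div_one, Real.one_rpow, one_mul]
      rw [mul_div_assoc', mul_comm, this]
      field_simp
  · apply Measurable.aemeasurable
    fun_prop

/-- The constant of the symmetric stable laws. -/
lemma integral_rpow_mul_one_sub_cos {α : ℝ} (h0 : 0 < α) (h2 : α < 2) :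
    ∫ t in Set.Ioi (0 : ℝ), t ^ (-α - 1) * (1 - Real.cos t) = (stableConst α)⁻¹ / α := by
  have hsin : 0 < Real.sin (Real.pi * α / 2) :=
    Real.sin_pos_of_pos_of_lt_pi (by positivity) (by nlinarith [Real.pi_pos])
  have hΓ : 0 < Real.Gamma (α + 1) := Real.Gamma_pos_of_pos (by linarith)
  have hcos : ∀ t : ℝ, 0 ≤ 1 - Real.cos t := fun t => by linarith [Real.cos_le_one t]
  -- The factor `t^(-α-1) Γ(α+1)` is the Laplace transform of `x^α` at `t`. Exchanging the integrals
  -- replaces `1 - cos t` by its own Laplace transform `1/(x(1+x²))`.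
  have e1 : ∀ t ∈ Set.Ioi (0 : ℝ),
      ENNReal.ofReal (t ^ (-α - 1) * (1 - Real.cos t) * Real.Gamma (α + 1)) =
      ∫⁻ x in Set.Ioi (0 : ℝ),
        ENNReal.ofReal ((1 - Real.cos t) * Real.exp (-(t * x)) * x ^ α) := fun t (ht : 0 < t) => by
    have hi := Real.integral_rpow_mul_exp_neg_mul_Ioi (a := α + 1) (r := t) (by linarith) ht
    have e3 : ∀ x : ℝ, (1 - Real.cos t) * Real.exp (-(t * x)) * x ^ α =
        (1 - Real.cos t) * (x ^ (α + 1 - 1) * Real.exp (-(t * x))) := fun x => by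
      rw [add_sub_cancel_right]; ring
    have e4 : t ^ (-α - 1) * (1 - Real.cos t) * Real.Gamma (α + 1) =
        (1 - Real.cos t) * ((1 / t) ^ (α + 1) * Real.Gamma (α + 1)) := by
      rw [one_div, Real.inv_rpow ht.le, ← Real.rpow_neg ht.le, show -(α + 1) = -α - 1 by ring]
      ring
    rw [e4]
    simp_rw [e3]
    rcases (hcos t).eq_or_lt with h | h
    · simp [← h]
    · symm
      refine lintegral_ofReal_eq_of_integral_eq measurableSet_Ioi
        (fun x (hx : 0 < x) => ?_) (by positivity) ?_
      · have := Real.rpow_pos_of_pos hx (α + 1 - 1)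
        positivity
      · rw [integral_const_mul, hi]
  have key : ∫⁻ t in Set.Ioi (0 : ℝ),
      ENNReal.ofReal (t ^ (-α - 1) * (1 - Real.cos t) * Real.Gamma (α + 1)) =
      ENNReal.ofReal (Real.pi / (2 * Real.sin (Real.pi * α / 2))) := by
    rw [setLIntegral_congr_fun measurableSet_Ioi e1, lintegral_lintegral_swap,
      ← integral_rpow_div_one_add_sq h0 h2]
    · refine setLIntegral_congr_fun measurableSet_Ioi fun x (hx : 0 < x) => ?_
      have hx' := Real.rpow_pos_of_pos hx α
      refine lintegral_ofReal_eq_of_integral_eq measurableSet_Ioi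
        (fun t _ => by have := hcos t; positivity)
        (div_pos (Real.rpow_pos_of_pos hx _) (by positivity)) ?_
      rw [integral_mul_const, integral_one_sub_cos_mul_exp_neg hx, Real.rpow_sub_one hx.ne']
      field_simp
    · apply Measurable.aemeasurable
      fun_prop
  have hmeas : AEStronglyMeasurable (fun t : ℝ => t ^ (-α - 1) * (1 - Real.cos t))
      (volume.restrict (Set.Ioi 0)) := by
    apply Measurable.aestronglyMeasurable
    fun_prop
  have h3 : ∫ t in Set.Ioi (0 : ℝ), t ^ (-α - 1) * (1 - Real.cos t) * Real.Gamma (α + 1) =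
      Real.pi / (2 * Real.sin (Real.pi * α / 2)) := by
    rw [integral_eq_lintegral_of_nonneg_ae _ (hmeas.mul_const _), key,
      ENNReal.toReal_ofReal (by positivity)]
    filter_upwards [ae_restrict_mem measurableSet_Ioi] with t (ht : 0 < t)
    have := Real.rpow_pos_of_pos ht (-α - 1)
    have := hcos t
    simp only [Pi.zero_apply]
    positivity
  rw [integral_mul_const] at h3
  rw [← eq_div_iff hΓ.ne'] at h3
  rw [h3, Real.Gamma_add_one h0.ne']
  have hΓ' : 0 < Real.Gamma α := Real.Gamma_pos_of_pos h0
  unfold stableConst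
  -- For `α ≠ 1`, reflection and duplication of the sine give the closed form; it is undefined at `α
  -- = 1`, where `C_1 = 2/π` is checked directly. This case occurs, for `b = 2`.
  split_ifs with hα
  · have h5 := Real.Gamma_mul_Gamma_one_sub α
    have h6 : Real.Gamma (2 - α) = (1 - α) * Real.Gamma (1 - α) := by
      rw [← Real.Gamma_add_one (sub_ne_zero.2 hα.symm)]; congr 1; ring
    have h7 : Real.sin (Real.pi * α) =
        2 * Real.sin (Real.pi * α / 2) * Real.cos (Real.pi * α / 2) := by
      rw [← Real.sin_two_mul]; congr 1; ring
    have h8 : Real.cos (Real.pi * α / 2) ≠ 0 := by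
      intro h
      rcases lt_or_gt_of_ne hα with hα | hα
      · exact (Real.cos_pos_of_mem_Ioo ⟨by nlinarith [Real.pi_pos],
          by nlinarith [Real.pi_pos]⟩).ne' h
      · exact (Real.cos_neg_of_pi_div_two_lt_of_lt (x := Real.pi * α / 2)
          (by nlinarith [Real.pi_pos]) (by nlinarith [Real.pi_pos])).ne h
    have h9 : 1 - α ≠ 0 := sub_ne_zero.2 hα.symm
    rw [h6]
    rw [h7, eq_div_iff (by positivity)] at h5
    field_simp
    linear_combination (-1 : ℝ) * h5
  · push Not at hα
    subst hα
    simp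

end RadialIntegrals

/-- The index of the interferer to which a source belongs. -/
def Source.index : Source → Option ℕ
  | .fade i | .phase i | .shadow i | .symA i | .symB i | .delay i => some i
  | _ => none

/-! ### Sources of randomness, independence by groups, and the symmetry of the marks. -/

section Sources

variable {Ω : Type*} {M L : ℕ}
  {P : Params M L} {X : Signals Ω M L}

/-- The σ-algebra generated by a set of sources. -/
@[reducible]
noncomputable def Signals.sigmaOf (X : Signals Ω M L) (S : Set Source) : MeasurableSpace Ω :=
  ⨆ x ∈ S, X.sigmaAlg x

lemma Signals.sigmaAlg_le_sigmaOf (X : Signals Ω M L) {S : Set Source} {x : Source} (hx : x ∈ S) :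
    X.sigmaAlg x ≤ X.sigmaOf S :=
  le_iSup₂_of_le x hx le_rfl

lemma Signals.sigmaOf_mono (X : Signals Ω M L) {S T : Set Source} (h : S ⊆ T) :
    X.sigmaOf S ≤ X.sigmaOf T :=
  biSup_mono fun _ hx => h hx

lemma measurable_points {S : Set Source} (h : Source.points ∈ S) (i : ℕ) :
    Measurable[X.sigmaOf S] (X.pt i) := by
  have h1 : Measurable[X.sigmaAlg .points] (fun ω i => X.pt i ω) := comap_measurable _
  exact (Measurable.comp (measurable_pi_apply (X := fun _ : ℕ => Plane) i) h1).mono (X.sigmaAlg_le_sigmaOf h) le_rfl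

lemma measurable_fade {S : Set Source} {i : ℕ} (h : Source.fade i ∈ S) :
    Measurable[X.sigmaOf S] (X.fade i) :=
  (comap_measurable _).mono (X.sigmaAlg_le_sigmaOf h) le_rfl

lemma measurable_phase {S : Set Source} {i : ℕ} (h : Source.phase i ∈ S) :
    Measurable[X.sigmaOf S] (X.phase i) :=
  (comap_measurable _).mono (X.sigmaAlg_le_sigmaOf h) le_rfl

lemma measurable_shadow {S : Set Source} {i : ℕ} (h : Source.shadow i ∈ S) :
    Measurable[X.sigmaOf S] (X.shadow i) :=
  (comap_measurable _).mono (X.sigmaAlg_le_sigmaOf h) le_rfl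

lemma measurable_symA {S : Set Source} {i : ℕ} (h : Source.symA i ∈ S) :
    Measurable[X.sigmaOf S] (X.symA i) :=
  (comap_measurable _).mono (X.sigmaAlg_le_sigmaOf h) le_rfl

lemma measurable_symB {S : Set Source} {i : ℕ} (h : Source.symB i ∈ S) :
    Measurable[X.sigmaOf S] (X.symB i) :=
  (comap_measurable _).mono (X.sigmaAlg_le_sigmaOf h) le_rfl

lemma measurable_delay {S : Set Source} {i : ℕ} (h : Source.delay i ∈ S) :
    Measurable[X.sigmaOf S] (X.delay i) :=
  (comap_measurable _).mono (X.sigmaAlg_le_sigmaOf h) le_rfl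

lemma measurable_noise {S : Set Source} (h : Source.noise ∈ S) :
    Measurable[X.sigmaOf S] X.noise :=
  (comap_measurable _).mono (X.sigmaAlg_le_sigmaOf h) le_rfl

lemma measurable_fade0 {S : Set Source} (h : Source.fade0 ∈ S) :
    Measurable[X.sigmaOf S] X.fade0 :=
  (comap_measurable _).mono (X.sigmaAlg_le_sigmaOf h) le_rfl

lemma measurable_shadow0 {S : Set Source} (h : Source.shadow0 ∈ S) :
    Measurable[X.sigmaOf S] X.shadow0 :=
  (comap_measurable _).mono (X.sigmaAlg_le_sigmaOf h) le_rfl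

lemma measurable_sym0 {S : Set Source} (h : Source.sym0 ∈ S) :
    Measurable[X.sigmaOf S] X.sym0 :=
  (comap_measurable _).mono (X.sigmaAlg_le_sigmaOf h) le_rfl

variable (P X)

/-- Amplitude of the contribution of interferer `i`, without the phase rotation. -/
noncomputable def amplitude (i : ℕ) (ω : Ω) : ℂ :=
  P.k * X.fade i ω * ((X.delay i ω / P.T : ℝ) * P.c (X.symA i ω) +
    (1 - X.delay i ω / P.T : ℝ) * P.c (X.symB i ω))

/-- The contribution of interferer `i`, with shadowing and without path loss. -/
noncomputable def mark (i : ℕ) (ω : Ω) : ℂ := Real.exp (P.sigma * X.shadow i ω) * contribution P X i ω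

lemma contribution_eq (i : ℕ) (ω : Ω) :
    contribution P X i ω = Complex.exp (Complex.I * X.phase i ω) * amplitude P X i ω := by
  unfold contribution amplitude; ring

lemma partialInterference_eq (n : ℕ) (ω : Ω) :
    partialInterference P X n ω =
      ∑ i ∈ Finset.range n, ((‖X.pt i ω‖ ^ (-P.b) : ℝ) : ℂ) * mark P X i ω := by
  unfold partialInterference mark
  refine Finset.sum_congr rfl fun i _ => ?_
  rw [Real.rpow_neg (norm_nonneg _)]
  push_cast
  ring

variable {P X}

lemma measurable_amplitude {S : Set Source} {i : ℕ} (h1 : Source.fade i ∈ S)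
    (h2 : Source.delay i ∈ S) (h3 : Source.symA i ∈ S) (h4 : Source.symB i ∈ S) :
    Measurable[X.sigmaOf S] (amplitude P X i) := by
  have a1 := measurable_fade (X := X) h1
  have a2 := measurable_delay (X := X) h2
  have a3 : Measurable[X.sigmaOf S] fun ω => P.c (X.symA i ω) :=
    (measurable_of_countable P.c).comp (measurable_symA h3)
  have a4 : Measurable[X.sigmaOf S] fun ω => P.c (X.symB i ω) :=
    (measurable_of_countable P.c).comp (measurable_symB h4)
  have a5 : Measurable[X.sigmaOf S] fun ω => ((X.delay i ω / P.T : ℝ) : ℂ) :=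
    Complex.measurable_ofReal.comp (a2.div_const _)
  have a6 : Measurable[X.sigmaOf S] fun ω => ((1 - X.delay i ω / P.T : ℝ) : ℂ) :=
    Complex.measurable_ofReal.comp ((a2.div_const _).const_sub _)
  exact ((Complex.measurable_ofReal.comp a1).const_mul _).mul ((a5.mul a3).add (a6.mul a4))

lemma measurable_contribution {S : Set Source} {i : ℕ} (h1 : Source.fade i ∈ S)
    (h2 : Source.delay i ∈ S) (h3 : Source.symA i ∈ S) (h4 : Source.symB i ∈ S)
    (h5 : Source.phase i ∈ S) :
    Measurable[X.sigmaOf S] (contribution P X i) := by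
  have : contribution P X i = fun ω =>
    Complex.exp (Complex.I * X.phase i ω) * amplitude P X i ω := funext (contribution_eq P X i)
  rw [this]
  exact (Complex.measurable_exp.comp ((Complex.measurable_ofReal.comp
    (measurable_phase h5)).const_mul _)).mul (measurable_amplitude h1 h2 h3 h4)

lemma measurable_mark {S : Set Source} {i : ℕ} (h : ∀ x : Source, x.index = some i → x ∈ S) :
    Measurable[X.sigmaOf S] (mark P X i) :=
  (Complex.measurable_ofReal.comp (Real.measurable_exp.comp
    ((measurable_shadow (h _ rfl)).const_mul _))).mul
    (measurable_contribution (h _ rfl) (h _ rfl) (h _ rfl) (h _ rfl) (h _ rfl))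

variable [MeasurableSpace Ω] {μ : Measure Ω}

lemma IsNetwork.sigmaAlg_le (hX : IsNetwork μ P X) (x : Source) :
    X.sigmaAlg x ≤ ‹MeasurableSpace Ω› := by
  cases x with
  | points => exact (measurable_pi_lambda _ hX.poisson.measurable).comap_le
  | noise => exact hX.noise_meas.comap_le
  | fade0 => exact hX.fade0_meas.comap_le
  | shadow0 => exact hX.shadow0_meas.comap_le
  | sym0 => exact hX.sym0_meas.comap_le
  | fade i => exact (hX.fade_meas i).comap_le
  | phase i => exact (hX.phase_meas i).comap_le
  | shadow i => exact (hX.shadow_meas i).comap_le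
  | symA i => exact (hX.symA_meas i).comap_le
  | symB i => exact (hX.symB_meas i).comap_le
  | delay i => exact (hX.delay_meas i).comap_le

lemma IsNetwork.sigmaOf_le (hX : IsNetwork μ P X) (S : Set Source) :
    X.sigmaOf S ≤ ‹MeasurableSpace Ω› :=
  iSup₂_le fun x _ => hX.sigmaAlg_le x

/-- Grouping of independent σ-algebras. Independence of two functions is from here on a matter of
listing the sources they use. -/
lemma IsNetwork.indep_sigmaOf (hX : IsNetwork μ P X) {S T : Set Source} (h : Disjoint S T) :
    Indep (X.sigmaOf S) (X.sigmaOf T) μ :=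
  indep_iSup_of_disjoint hX.sigmaAlg_le hX.indep h

lemma IsNetwork.indepFun {α β : Type*} [MeasurableSpace α] [MeasurableSpace β]
    (hX : IsNetwork μ P X) {S T : Set Source} (h : Disjoint S T) {f : Ω → α} {g : Ω → β}
    (hf : Measurable[X.sigmaOf S] f) (hg : Measurable[X.sigmaOf T] g) : IndepFun f g μ :=
  indep_of_indep_of_le_left (indep_of_indep_of_le_right (hX.indep_sigmaOf h) hg.comap_le)
    hf.comap_le

lemma IsNetwork.measurable_mark (hX : IsNetwork μ P X) (i : ℕ) : Measurable (mark P X i) :=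
  (PoissonInterference.measurable_mark (S := Set.univ) fun _ _ => trivial).mono
    (hX.sigmaOf_le _) le_rfl

lemma IsNetwork.measurable_contribution (hX : IsNetwork μ P X) (i : ℕ) :
    Measurable (contribution P X i) :=
  (PoissonInterference.measurable_contribution (S := Set.univ) trivial trivial trivial trivial
    trivial).mono (hX.sigmaOf_le _) le_rfl

variable [IsProbabilityMeasure μ]

/-- The marginals agree and, for each index, the six variables are independent; the tuple is
assembled from the right, one variable at a time. Every function of one interferer's variables then
has a law that does not depend on the index. -/
lemma IsNetwork.identDistrib_tuple (hX : IsNetwork μ P X) (i : ℕ) :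
    IdentDistrib
      (fun ω => (X.fade i ω, X.phase i ω, X.shadow i ω, X.symA i ω, X.symB i ω, X.delay i ω))
      (fun ω => (X.fade 0 ω, X.phase 0 ω, X.shadow 0 ω, X.symA 0 ω, X.symB 0 ω, X.delay 0 ω))
      μ μ := by
  have d1 : IdentDistrib (X.fade i) (X.fade 0) μ μ :=
    ⟨(hX.fade_meas i).aemeasurable, (hX.fade_meas 0).aemeasurable, by simp [hX.fade_law]⟩
  have d2 : IdentDistrib (X.phase i) (X.phase 0) μ μ :=
    ⟨(hX.phase_meas i).aemeasurable, (hX.phase_meas 0).aemeasurable, by simp [hX.phase_law]⟩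
  have d3 : IdentDistrib (X.shadow i) (X.shadow 0) μ μ :=
    ⟨(hX.shadow_meas i).aemeasurable, (hX.shadow_meas 0).aemeasurable, by simp [hX.shadow_law]⟩
  have d4 : IdentDistrib (X.symA i) (X.symA 0) μ μ := by
    refine ⟨(hX.symA_meas i).aemeasurable, (hX.symA_meas 0).aemeasurable,
      Measure.ext_of_singleton fun j => ?_⟩
    rw [Measure.map_apply (hX.symA_meas i) (measurableSet_singleton _),
      Measure.map_apply (hX.symA_meas 0) (measurableSet_singleton _)]
    exact (hX.symA_law i j).trans (hX.symA_law 0 j).symm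
  have d5 : IdentDistrib (X.symB i) (X.symB 0) μ μ := by
    refine ⟨(hX.symB_meas i).aemeasurable, (hX.symB_meas 0).aemeasurable,
      Measure.ext_of_singleton fun j => ?_⟩
    rw [Measure.map_apply (hX.symB_meas i) (measurableSet_singleton _),
      Measure.map_apply (hX.symB_meas 0) (measurableSet_singleton _)]
    exact (hX.symB_law i j).trans (hX.symB_law 0 j).symm
  have d6 : IdentDistrib (X.delay i) (X.delay 0) μ μ :=
    ⟨(hX.delay_meas i).aemeasurable, (hX.delay_meas 0).aemeasurable, by simp [hX.delay_law]⟩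
  have m6 : ∀ i, Measurable[X.sigmaOf {.delay i}] (X.delay i) := fun i => measurable_delay rfl
  have m5 : ∀ i, Measurable[X.sigmaOf {.symB i, .delay i}]
      fun ω => (X.symB i ω, X.delay i ω) := fun i =>
    (measurable_symB (by simp)).prodMk (measurable_delay (by simp))
  have m4 : ∀ i, Measurable[X.sigmaOf {.symA i, .symB i, .delay i}]
      fun ω => (X.symA i ω, X.symB i ω, X.delay i ω) := fun i =>
    (measurable_symA (by simp)).prodMk
      ((measurable_symB (by simp)).prodMk (measurable_delay (by simp)))
  have m3 : ∀ i, Measurable[X.sigmaOf {.shadow i, .symA i, .symB i, .delay i}]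
      fun ω => (X.shadow i ω, X.symA i ω, X.symB i ω, X.delay i ω) := fun i =>
    (measurable_shadow (by simp)).prodMk ((measurable_symA (by simp)).prodMk
      ((measurable_symB (by simp)).prodMk (measurable_delay (by simp))))
  have m2 : ∀ i, Measurable[X.sigmaOf {.phase i, .shadow i, .symA i, .symB i, .delay i}]
      fun ω => (X.phase i ω, X.shadow i ω, X.symA i ω, X.symB i ω, X.delay i ω) := fun i =>
    (measurable_phase (by simp)).prodMk ((measurable_shadow (by simp)).prodMk
      ((measurable_symA (by simp)).prodMk
        ((measurable_symB (by simp)).prodMk (measurable_delay (by simp)))))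
  refine d1.prodMk (d2.prodMk (d3.prodMk (d4.prodMk (d5.prodMk d6 ?_ ?_) ?_ ?_) ?_ ?_) ?_ ?_) ?_ ?_
  · exact hX.indepFun (by simp) (measurable_symB (S := {.symB i}) rfl) (m6 i)
  · exact hX.indepFun (by simp) (measurable_symB (S := {.symB 0}) rfl) (m6 0)
  · exact hX.indepFun (by simp) (measurable_symA (S := {.symA i}) rfl) (m5 i)
  · exact hX.indepFun (by simp) (measurable_symA (S := {.symA 0}) rfl) (m5 0)
  · exact hX.indepFun (by simp) (measurable_shadow (S := {.shadow i}) rfl) (m4 i)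
  · exact hX.indepFun (by simp) (measurable_shadow (S := {.shadow 0}) rfl) (m4 0)
  · exact hX.indepFun (by simp) (measurable_phase (S := {.phase i}) rfl) (m3 i)
  · exact hX.indepFun (by simp) (measurable_phase (S := {.phase 0}) rfl) (m3 0)
  · exact hX.indepFun (by simp) (measurable_fade (S := {.fade i}) rfl) (m2 i)
  · exact hX.indepFun (by simp) (measurable_fade (S := {.fade 0}) rfl) (m2 0)

lemma IsNetwork.map_mark (hX : IsNetwork μ P X) (i : ℕ) :
    μ.map (mark P X i) = μ.map (mark P X 0) := by
  have hΨ : Measurable fun t : ℝ × ℝ × ℝ × Fin L × Fin L × ℝ =>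
      ((Real.exp (P.sigma * t.2.2.1) : ℝ) : ℂ) *
        (P.k * t.1 * Complex.exp (Complex.I * t.2.1) *
          ((t.2.2.2.2.2 / P.T : ℝ) * P.c t.2.2.2.1 +
            (1 - t.2.2.2.2.2 / P.T : ℝ) * P.c t.2.2.2.2.1)) := by
    have hc : Measurable P.c := measurable_of_countable _
    fun_prop
  exact ((hX.identDistrib_tuple i).comp hΨ).map_eq

/-- The marks are circularly symmetric. -/
lemma IsNetwork.map_rotate_mark (hX : IsNetwork μ P X) (i : ℕ) {u : ℂ} (hu : ‖u‖ = 1) :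
    μ.map (fun ω => u * mark P X i ω) = μ.map (mark P X i) := by
  obtain ⟨θ, rfl⟩ : ∃ θ : ℝ, Complex.exp (θ * Complex.I) = u := (Complex.norm_eq_one_iff u).1 hu
  -- `U` is the mark without its phase factor, hence independent of the phase.
  set U : Ω → ℂ := fun ω => Real.exp (P.sigma * X.shadow i ω) * amplitude P X i ω with hU
  have hUm : Measurable[X.sigmaOf {.shadow i, .fade i, .delay i, .symA i, .symB i}] U :=
    (Complex.measurable_ofReal.comp (Real.measurable_exp.comp
      ((measurable_shadow (by simp)).const_mul _))).mul
      (measurable_amplitude (by simp) (by simp) (by simp) (by simp))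
  have hUm' : Measurable U := hUm.mono (hX.sigmaOf_le _) le_rfl
  have hind : IndepFun U (X.phase i) μ :=
    hX.indepFun (by simp) hUm (measurable_phase (S := {.phase i}) rfl)
  have hmark : ∀ ω, mark P X i ω = Complex.exp (Complex.I * X.phase i ω) * U ω := fun ω => by
    simp only [mark, contribution_eq, hU]; ring
  have hmm := hX.measurable_mark i
  have hprob : IsProbabilityMeasure (μ.map (fun ω => Complex.exp (θ * Complex.I) * mark P X i ω)) :=
    Measure.isProbabilityMeasure_map (by fun_prop)
  have hprob' : IsProbabilityMeasure (μ.map (mark P X i)) :=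
    Measure.isProbabilityMeasure_map (by fun_prop)
  have hmap := (indepFun_iff_map_prod_eq_prod_map_map hUm'.aemeasurable
    (hX.phase_meas i).aemeasurable).1 hind
  have key : ∀ (τ : ℝ) (w : ℂ), charFun (μ.map fun ω =>
      Complex.exp (τ * Complex.I) * mark P X i ω) w =
      ∫ u, ∫ t, Complex.exp (inner ℝ (Complex.exp (τ * Complex.I) *
        (Complex.exp (Complex.I * t) * u)) w * Complex.I) ∂(μ.map (X.phase i)) ∂(μ.map U) := by
    intro τ w
    have hPU : IsProbabilityMeasure (μ.map U) := Measure.isProbabilityMeasure_map hUm'.aemeasurable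
    have hPΦ : IsProbabilityMeasure (μ.map (X.phase i)) :=
      Measure.isProbabilityMeasure_map (hX.phase_meas i).aemeasurable
    have hcont : Continuous fun q : ℂ × ℝ => Complex.exp (inner ℝ (Complex.exp (τ * Complex.I) *
        (Complex.exp (Complex.I * q.2) * q.1)) w * Complex.I) := by fun_prop
    rw [charFun_apply, integral_map (by fun_prop) (by fun_prop)]
    simp_rw [hmark]
    rw [← integral_prod (f := fun q : ℂ × ℝ => Complex.exp (inner ℝ (Complex.exp (τ * Complex.I) *
        (Complex.exp (Complex.I * q.2) * q.1)) w * Complex.I)), ← hmap, integral_map]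
    · exact (hUm'.prodMk (hX.phase_meas i)).aemeasurable
    · exact hcont.aestronglyMeasurable
    · refine Integrable.of_bound hcont.aestronglyMeasurable 1 (ae_of_all _ fun q => ?_)
      rw [Complex.norm_exp_ofReal_mul_I]
  -- A rotation by `τ` only shifts the phase, and the integral of a `2π`-periodic function over a
  -- period is invariant under shifts.
  have key2 : ∀ (τ : ℝ) (w u : ℂ), ∫ t, Complex.exp (inner ℝ (Complex.exp (τ * Complex.I) *
        (Complex.exp (Complex.I * t) * u)) w * Complex.I) ∂(μ.map (X.phase i)) =
      ∫ t, Complex.exp (inner ℝ (Complex.exp (Complex.I * t) * u) w * Complex.I)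
        ∂(μ.map (X.phase i)) := by
    intro τ w u
    rw [hX.phase_law, ProbabilityTheory.cond, integral_smul_measure, integral_smul_measure]
    congr 1
    rw [integral_Icc_eq_integral_Ioc, integral_Icc_eq_integral_Ioc,
      ← intervalIntegral.integral_of_le Real.two_pi_pos.le,
      ← intervalIntegral.integral_of_le Real.two_pi_pos.le]
    set g : ℝ → ℂ := fun t =>
      Complex.exp (inner ℝ (Complex.exp (Complex.I * t) * u) w * Complex.I) with hg
    have hper : Function.Periodic g (2 * Real.pi) := fun t => by
      simp only [hg]
      congr 5
      push_cast
      rw [show Complex.I * (t + 2 * Real.pi) = Complex.I * t + 2 * Real.pi * Complex.I by ring,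
        Complex.exp_periodic]
    have h1 : ∀ t : ℝ, Complex.exp (inner ℝ (Complex.exp (τ * Complex.I) *
        (Complex.exp (Complex.I * t) * u)) w * Complex.I) = g (t + τ) := fun t => by
      simp only [hg]
      rw [← mul_assoc, ← Complex.exp_add]
      congr 5
      push_cast; ring_nf
    simp_rw [h1]
    rw [intervalIntegral.integral_comp_add_right, zero_add, add_comm (2 * Real.pi),
      hper.intervalIntegral_add_eq τ 0, zero_add]
  refine Measure.ext_of_charFun ?_
  ext w
  have h0 := key 0 w
  simp only [Complex.ofReal_zero, zero_mul, Complex.exp_zero, one_mul] at h0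
  rw [key, show μ.map (mark P X i) = μ.map fun ω => mark P X i ω from rfl, h0]
  simp_rw [key2]

attribute [irreducible] mark

end Sources

/-! ### Moments and characteristic function of a mark. -/

section Moments

variable {Ω : Type*} {M L : ℕ} {P : Params M L} {X : Signals Ω M L}

lemma norm_amplitude_le {i : ℕ} {ω : Ω} (hd : X.delay i ω ∈ Set.Icc 0 P.T) :
    ‖amplitude P X i ω‖ ≤ P.k * |X.fade i ω| * (2 * ∑ j, ‖P.c j‖) := by
  have hx0 : 0 ≤ X.delay i ω / P.T := div_nonneg hd.1 P.T_pos.le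
  have hx1 : X.delay i ω / P.T ≤ 1 := (div_le_one P.T_pos).2 hd.2
  have hc : ∀ j, ‖P.c j‖ ≤ ∑ j, ‖P.c j‖ := fun j =>
    Finset.single_le_sum (f := fun j => ‖P.c j‖) (fun _ _ => norm_nonneg _) (Finset.mem_univ j)
  unfold amplitude
  rw [norm_mul, norm_mul, Complex.norm_real, Complex.norm_real, Real.norm_of_nonneg P.k_pos.le,
    Real.norm_eq_abs]
  refine mul_le_mul_of_nonneg_left ((norm_add_le _ _).trans ?_)
    (mul_nonneg P.k_pos.le (abs_nonneg _))
  rw [norm_mul, norm_mul, Complex.norm_real, Complex.norm_real, Real.norm_of_nonneg hx0,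
    Real.norm_of_nonneg (sub_nonneg.2 hx1)]
  nlinarith [hc (X.symA i ω), hc (X.symB i ω), norm_nonneg (P.c (X.symA i ω)),
    norm_nonneg (P.c (X.symB i ω))]

variable [MeasurableSpace Ω] {μ : Measure Ω}

lemma IsNetwork.ae_delay_mem (hX : IsNetwork μ P X) (i : ℕ) :
    ∀ᵐ ω ∂μ, X.delay i ω ∈ Set.Icc 0 P.T := by
  have h : ∀ᵐ x ∂(μ.map (X.delay i)), x ∈ Set.Icc 0 P.T := by
    rw [hX.delay_law]
    exact ae_cond_mem measurableSet_Icc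
  exact ae_of_ae_map (hX.delay_meas i).aemeasurable h

lemma IsNetwork.integrable_exp_shadow (hX : IsNetwork μ P X) (i : ℕ) (t : ℝ) :
    Integrable (fun ω => Real.exp (t * X.shadow i ω)) μ := by
  have := integrable_exp_mul_gaussianReal (μ := 0) (v := 1) t
  rw [← hX.shadow_law i] at this
  exact (integrable_map_measure (by fun_prop) (hX.shadow_meas i).aemeasurable).1 this

lemma IsNetwork.integrable_fade_sq (hX : IsNetwork μ P X) (i : ℕ) :
    Integrable (fun ω => X.fade i ω ^ 2) μ := by
  have : Integrable (fun x : ℝ => x ^ 2) P.fadeLaw := by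
    -- An undefined integral is `0`, whereas the power is `1`.
    by_contra h
    have := P.fade_power
    rw [integral_undef h] at this
    exact zero_ne_one this
  rw [← hX.fade_law i] at this
  exact (integrable_map_measure (by fun_prop) (hX.fade_meas i).aemeasurable).1 this

/-- The shadowing factor is log-normal, the squared fading is integrable and independent of it, and
the phase, delay and symbols contribute bounded factors. Second moments suffice for the martingale
and for the bound on `1 - markCF` near `0`. -/
lemma IsNetwork.memLp_mark (hX : IsNetwork μ P X) (i : ℕ) : MemLp (mark P X i) 2 μ := by
  rw [memLp_two_iff_integrable_sq_norm (hX.measurable_mark i).aestronglyMeasurable]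
  have hind : IndepFun (fun ω => Real.exp (2 * P.sigma * X.shadow i ω))
      (fun ω => X.fade i ω ^ 2) μ :=
    (hX.indepFun (S := {.shadow i}) (T := {.fade i}) (by simp) (measurable_shadow rfl)
      (measurable_fade rfl)).comp (φ := fun x => Real.exp (2 * P.sigma * x))
      (ψ := fun x => x ^ 2) (by fun_prop) (by fun_prop)
  have hint := (hind.integrable_mul (hX.integrable_exp_shadow i _) (hX.integrable_fade_sq i)).const_mul
    ((P.k * (2 * ∑ j, ‖P.c j‖)) ^ 2)
  refine hint.mono' ((hX.measurable_mark i).norm.pow_const 2).aestronglyMeasurable ?_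
  filter_upwards [hX.ae_delay_mem i] with ω hω
  rw [Real.norm_of_nonneg (sq_nonneg _)]
  have h1 : ‖mark P X i ω‖ = Real.exp (P.sigma * X.shadow i ω) * ‖amplitude P X i ω‖ := by
    rw [mark, contribution_eq, norm_mul, norm_mul, mul_comm Complex.I, Complex.norm_exp_ofReal_mul_I,
      one_mul, Complex.norm_real, Real.norm_of_nonneg (Real.exp_pos _).le]
  have h2 : ‖mark P X i ω‖ ≤
      Real.exp (P.sigma * X.shadow i ω) * (P.k * |X.fade i ω| * (2 * ∑ j, ‖P.c j‖)) := by
    rw [h1]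
    exact mul_le_mul_of_nonneg_left (norm_amplitude_le hω) (Real.exp_pos _).le
  have h3 := pow_le_pow_left₀ (norm_nonneg _) h2 2
  refine h3.trans (le_of_eq ?_)
  simp only [Pi.mul_apply]
  rw [show 2 * P.sigma * X.shadow i ω = P.sigma * X.shadow i ω + P.sigma * X.shadow i ω by ring,
    Real.exp_add, ← sq_abs (X.fade i ω)]
  ring

lemma IsNetwork.memLp_re_mark (hX : IsNetwork μ P X) (i : ℕ) :
    MemLp (fun ω => (mark P X i ω).re) 2 μ :=
  (hX.memLp_mark i).re

/-- The shadowing factors out through the Gaussian moment generating function. At `α = 2/b` the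
factor is `e^(2σ²/b²)`, whose `b`-th power is the one in `VG`. -/
lemma IsNetwork.integral_abs_re_mark_rpow (hX : IsNetwork μ P X) (α : ℝ) :
    ∫ ω, |(mark P X 0 ω).re| ^ α ∂μ =
      Real.exp (α ^ 2 * P.sigma ^ 2 / 2) * ∫ ω, |(contribution P X 0 ω).re| ^ α ∂μ := by
  have hc : Measurable fun ω => |(contribution P X 0 ω).re| ^ α :=
    (show Measurable fun z : ℂ => |z.re| ^ α by fun_prop).comp (hX.measurable_contribution 0)
  have hs := hX.shadow_meas 0
  have hind : IndepFun (fun ω => Real.exp (α * P.sigma * X.shadow 0 ω))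
      (fun ω => |(contribution P X 0 ω).re| ^ α) μ :=
    (hX.indepFun (S := {.shadow 0}) (T := {.shadow 0}ᶜ) disjoint_compl_right
      (measurable_shadow rfl) (PoissonInterference.measurable_contribution (P := P) (i := 0)
        (by simp) (by simp) (by simp) (by simp) (by simp))).comp (φ := fun x => Real.exp (α * P.sigma * x))
      (ψ := fun z : ℂ => |z.re| ^ α) (by fun_prop) (by fun_prop)
  have h1 : ∫ ω, Real.exp (α * P.sigma * X.shadow 0 ω) ∂μ =
      Real.exp (α ^ 2 * P.sigma ^ 2 / 2) := by
    have := mgf_gaussianReal (hX.shadow_law 0) (α * P.sigma)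
    rw [mgf] at this
    rw [this]
    simp
    ring
  rw [← h1, ← hind.integral_fun_mul_eq_mul_integral
    (Measurable.aestronglyMeasurable (by fun_prop)) hc.aestronglyMeasurable]
  congr 1 with ω
  rw [mark, Complex.re_ofReal_mul, abs_mul, abs_of_pos (Real.exp_pos _),
    Real.mul_rpow (Real.exp_pos _).le (abs_nonneg _), ← Real.exp_mul]
  congr 2
  ring

variable [IsProbabilityMeasure μ]

lemma IsNetwork.integral_comp_mark (hX : IsNetwork μ P X) (i : ℕ) {E : Type*}
    [NormedAddCommGroup E] [NormedSpace ℝ E] {F : ℂ → E} (hF : StronglyMeasurable F) {u : ℂ}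
    (hu : ‖u‖ = 1) : ∫ ω, F (u * mark P X i ω) ∂μ = ∫ ω, F (mark P X 0 ω) ∂μ := by
  have h1 := hX.measurable_mark i
  have h0 := hX.measurable_mark 0
  rw [← integral_map (φ := fun ω => u * mark P X i ω) (by fun_prop) hF.aestronglyMeasurable,
    hX.map_rotate_mark i hu, hX.map_mark i, integral_map h0.aemeasurable hF.aestronglyMeasurable]

/-- The rotations by `u` and `-u` give the same law, so the mean equals its own opposite. -/
lemma IsNetwork.integral_re_mark (hX : IsNetwork μ P X) (i : ℕ) {u : ℂ} (hu : ‖u‖ = 1) :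
    ∫ ω, (u * mark P X i ω).re ∂μ = 0 := by
  have h1 := hX.integral_comp_mark i (F := Complex.re) (by fun_prop) hu
  have h2 := hX.integral_comp_mark i (F := Complex.re) (by fun_prop) (u := -u) (by simpa using hu)
  simp only [neg_mul, Complex.neg_re, integral_neg] at h2
  linarith

variable (P X μ) in
/-- The characteristic function of a mark, as a function of the radius. -/
noncomputable def markCF (r : ℝ) : ℝ := ∫ ω, Real.cos (r * (mark P X 0 ω).re) ∂μ

/-- Rotating `w` onto the positive real axis leaves only the real part of the mark and the radius
`‖w‖`; the symmetry under `-1` then kills the sine. -/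
lemma IsNetwork.charFun_map_mark (hX : IsNetwork μ P X) (i : ℕ) (w : ℂ) :
    charFun (μ.map (mark P X i)) w = (markCF P X μ ‖w‖ : ℝ) := by
  have hm0 := hX.measurable_mark 0
  have hre : ∀ u : ℂ, ‖u‖ = 1 → charFun (μ.map (mark P X i)) (‖w‖ * u) =
      ∫ ω, Complex.exp ((‖w‖ * (mark P X 0 ω).re : ℝ) * Complex.I) ∂μ := by
    intro u hu
    have hF : StronglyMeasurable fun z : ℂ => Complex.exp ((‖w‖ * z.re : ℝ) * Complex.I) := by
      fun_prop
    rw [← hX.integral_comp_mark i hF (u := starRingEnd ℂ u) (by simpa using hu), charFun_apply,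
      integral_map (hX.measurable_mark i).aemeasurable (by fun_prop)]
    congr 1 with ω
    rw [Complex.inner]
    congr 3
    simp [Complex.mul_re]
    ring
  obtain ⟨u, hu, hw⟩ : ∃ u : ℂ, ‖u‖ = 1 ∧ (‖w‖ : ℂ) * u = w := by
    refine ⟨Complex.exp (w.arg * Complex.I), Complex.norm_exp_ofReal_mul_I _, ?_⟩
    exact Complex.norm_mul_exp_arg_mul_I w
  have h1 := hre u hu
  rw [hw] at h1
  have hc : Integrable (fun ω => (Real.cos (‖w‖ * (mark P X 0 ω).re) : ℂ)) μ :=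
    Integrable.of_bound (Measurable.aestronglyMeasurable (by fun_prop)) 1 (ae_of_all _ fun ω => by
      rw [Complex.norm_real]; exact Real.abs_cos_le_one _)
  have hs : Integrable (fun ω => (Real.sin (‖w‖ * (mark P X 0 ω).re) : ℂ)) μ :=
    Integrable.of_bound (Measurable.aestronglyMeasurable (by fun_prop)) 1 (ae_of_all _ fun ω => by
      rw [Complex.norm_real]; exact Real.abs_sin_le_one _)
  have hs0 : ∫ ω, Real.sin (‖w‖ * (mark P X 0 ω).re) ∂μ = 0 := by
    have h2 := hX.integral_comp_mark 0 (F := fun z => Real.sin (‖w‖ * z.re))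
      (by fun_prop) (u := -1) (by simp)
    simp only [neg_mul, one_mul, Complex.neg_re, mul_neg, Real.sin_neg, integral_neg] at h2
    linarith
  rw [h1]
  simp_rw [Complex.exp_mul_I, ← Complex.ofReal_cos, ← Complex.ofReal_sin]
  rw [integral_add hc (hs.mul_const _), integral_mul_const]
  rw [integral_complex_ofReal, integral_complex_ofReal, hs0]
  simp [markCF]

lemma norm_markCF_le (r : ℝ) : ‖markCF P X μ r‖ ≤ 1 := by
  refine (norm_integral_le_of_norm_le_const (C := 1) (ae_of_all _ fun ω => ?_)).trans (by simp)
  exact Real.abs_cos_le_one _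

lemma IsNetwork.continuous_markCF (hX : IsNetwork μ P X) : Continuous (markCF P X μ) := by
  have hm0 := hX.measurable_mark 0
  refine continuous_of_dominated (bound := fun _ => 1) (fun r => Measurable.aestronglyMeasurable (by fun_prop))
    (fun r => ae_of_all _ fun ω => Real.abs_cos_le_one _) (integrable_const _)
    (ae_of_all _ fun ω => by fun_prop)

lemma IsNetwork.integrable_cos (hX : IsNetwork μ P X) (r : ℝ) :
    Integrable (fun ω => Real.cos (r * (mark P X 0 ω).re)) μ := by
  have hm0 := hX.measurable_mark 0
  exact Integrable.of_bound (Measurable.aestronglyMeasurable (by fun_prop)) 1 (ae_of_all _ fun ω => Real.abs_cos_le_one _)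

lemma IsNetwork.one_sub_markCF (hX : IsNetwork μ P X) (r : ℝ) :
    1 - markCF P X μ r = ∫ ω, (1 - Real.cos (r * (mark P X 0 ω).re)) ∂μ := by
  rw [integral_sub (integrable_const _) (hX.integrable_cos r)]
  simp [markCF]

lemma IsNetwork.norm_one_sub_markCF_le (hX : IsNetwork μ P X) (r : ℝ) :
    ‖1 - markCF P X μ r‖ ≤ r ^ 2 / 2 * ∫ ω, (mark P X 0 ω).re ^ 2 ∂μ := by
  rw [hX.one_sub_markCF, ← integral_const_mul]
  refine norm_integral_le_of_norm_le ((hX.memLp_re_mark 0).integrable_sq.const_mul _)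
    (ae_of_all _ fun ω => ?_)
  rw [Real.norm_of_nonneg (by linarith [Real.cos_le_one (r * (mark P X 0 ω).re)])]
  have := Real.one_sub_sq_div_two_le_cos (x := r * (mark P X 0 ω).re)
  rw [mul_pow] at this
  linarith

lemma IsNetwork.integrable_abs_re_mark_rpow (hX : IsNetwork μ P X) {α : ℝ} (h0 : 0 < α)
    (h2 : α < 2) : Integrable (fun ω => |(mark P X 0 ω).re| ^ α) μ := by
  have hm0 := hX.measurable_mark 0
  refine ((integrable_const (1 : ℝ)).add (hX.memLp_re_mark 0).integrable_sq).mono'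
    (Measurable.aestronglyMeasurable (by fun_prop)) (ae_of_all _ fun ω => ?_)
  have ha := abs_nonneg (mark P X 0 ω).re
  rw [Real.norm_of_nonneg (by positivity), Pi.add_apply, ← sq_abs]
  rcases le_total |(mark P X 0 ω).re| 1 with h | h
  · have := Real.rpow_le_one ha h h0.le
    nlinarith
  · have := Real.rpow_le_rpow_of_exponent_le h h2.le
    rw [Real.rpow_two] at this
    linarith

lemma integral_rpow_mul_one_sub_cos_mul {α : ℝ} (h0 : 0 < α) (h2 : α < 2) (x : ℝ) :
    ∫ t in Set.Ioi (0 : ℝ), t ^ (-α - 1) * (1 - Real.cos (t * x)) =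
      |x| ^ α * ((stableConst α)⁻¹ / α) := by
  rcases eq_or_ne x 0 with rfl | hx
  · simp [Real.zero_rpow h0.ne']
  · have := integral_rpow_smul_comp_mul (fun t => 1 - Real.cos t) h0 (abs_pos.2 hx)
    simp only [smul_eq_mul] at this
    rw [integral_rpow_mul_one_sub_cos h0 h2] at this
    rw [← this]
    refine setIntegral_congr_fun measurableSet_Ioi fun t (ht : 0 < t) => ?_
    rw [← Real.cos_abs (t * x), abs_mul, abs_of_pos ht, mul_comm t]

/-- Fubini exchanges the mean with the radial integral, and the inner integral scales like `|Re|^α`: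
this is how the absolute moment enters `VG`. -/
lemma IsNetwork.integral_rpow_mul_one_sub_markCF (hX : IsNetwork μ P X) {α : ℝ} (h0 : 0 < α)
    (h2 : α < 2) :
    ∫ t in Set.Ioi (0 : ℝ), t ^ (-α - 1) * (1 - markCF P X μ t) =
      (∫ ω, |(mark P X 0 ω).re| ^ α ∂μ) * ((stableConst α)⁻¹ / α) := by
  have hm0 := hX.measurable_mark 0
  rw [← integral_mul_const]
  simp_rw [← integral_rpow_mul_one_sub_cos_mul h0 h2, hX.one_sub_markCF, ← integral_const_mul]
  symm
  refine integral_integral_swap ?_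
  have hmeas : AEStronglyMeasurable (Function.uncurry fun (ω : Ω) (t : ℝ) =>
      t ^ (-α - 1) * (1 - Real.cos (t * (mark P X 0 ω).re)))
      (μ.prod (volume.restrict (Set.Ioi 0))) := by
    apply Measurable.aestronglyMeasurable
    unfold Function.uncurry
    fun_prop
  have hcos : ∀ x, 0 ≤ 1 - Real.cos x ∧ ‖1 - Real.cos x‖ ≤ 2 ∧ ‖1 - Real.cos x‖ ≤ x ^ 2 :=
    fun x => by
      have h3 := Real.cos_le_one x
      have h4 := Real.neg_one_le_cos x
      have h5 := Real.one_sub_sq_div_two_le_cos (x := x)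
      rw [Real.norm_of_nonneg (by linarith)]
      refine ⟨?_, ?_, ?_⟩ <;> nlinarith [sq_nonneg x]
  rw [integrable_prod_iff hmeas]
  constructor
  · refine ae_of_all _ fun ω => ?_
    set x := (mark P X 0 ω).re
    refine integrableOn_rpow_smul (F := fun t => 1 - Real.cos (t * x)) (κ := 2) (C := 2 + x ^ 2)
      (by fun_prop) h0 h2 (fun t _ => ?_) (fun t ht => ?_)
    · have := (hcos (t * x)).2.1
      nlinarith [sq_nonneg x]
    · have := (hcos (t * x)).2.2
      rw [Real.rpow_two]
      nlinarith [sq_nonneg t]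
  · refine ((hX.integrable_abs_re_mark_rpow h0 h2).mul_const ((stableConst α)⁻¹ / α)).congr
      (ae_of_all _ fun ω => ?_)
    simp only [Function.uncurry]
    rw [← integral_rpow_mul_one_sub_cos_mul h0 h2]
    refine setIntegral_congr_fun measurableSet_Ioi fun t (ht : 0 < t) => ?_
    rw [Real.norm_of_nonneg (mul_nonneg (Real.rpow_nonneg ht.le _) (hcos _).1)]

end Moments

/-- The sources of the positions and of the interferers of index less than `n`. -/
def Source.past (n : ℕ) : Set Source := {x | x = .points ∨ ∃ i < n, x.index = some i}

/-! ### Almost sure convergence of the interference series. -/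

section Convergence

variable {Ω : Type*} {M L : ℕ} {P : Params M L} {X : Signals Ω M L}

lemma Source.past_mono : Monotone Source.past := fun _ _ h _ hx =>
  hx.imp_right fun ⟨i, hi, hxi⟩ => ⟨i, hi.trans_le h, hxi⟩

lemma Source.disjoint_index_past (n : ℕ) :
    Disjoint {x : Source | x.index = some n} (Source.past n) := by
  refine Set.disjoint_left.2 fun x (hx : x.index = some n) hx' => ?_
  rcases hx' with rfl | ⟨i, hi, hxi⟩
  · simp [Source.index] at hx
  · rw [hx] at hxi
    exact hi.ne' (Option.some_injective _ hxi)

lemma measurable_mark_past {i n : ℕ} (h : i < n) :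
    Measurable[X.sigmaOf (Source.past n)] (mark P X i) :=
  measurable_mark fun _ hx => Or.inr ⟨i, h, hx⟩

lemma measurable_points_past (i n : ℕ) :
    Measurable[X.sigmaOf (Source.past n)] (X.pt i) :=
  measurable_points (Or.inl rfl) i

variable (P X) in
/-- Path loss of an interferer, replaced by `0` near the receiver. -/
noncomputable def farLoss (i : ℕ) (ω : Ω) : ℝ :=
  if 1 < ‖X.pt i ω‖ then ‖X.pt i ω‖ ^ (-P.b) else 0

lemma farLoss_nonneg (i : ℕ) (ω : Ω) : 0 ≤ farLoss P X i ω := by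
  unfold farLoss
  split_ifs <;> positivity

lemma farLoss_le_one (i : ℕ) (ω : Ω) : farLoss P X i ω ≤ 1 := by
  unfold farLoss
  split_ifs with h
  · exact Real.rpow_le_one_of_one_le_of_nonpos h.le (by linarith [P.one_lt_b])
  · exact zero_le_one

lemma farLoss_sq (i : ℕ) (ω : Ω) :
    farLoss P X i ω ^ 2 = if 1 < ‖X.pt i ω‖ then ‖X.pt i ω‖ ^ (-(2 * P.b)) else 0 := by
  unfold farLoss
  split_ifs with h
  · rw [← Real.rpow_mul_natCast (norm_nonneg _)]
    congr 1; push_cast; ring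
  · simp

lemma measurable_farLoss (i : ℕ) {S : Set Source} (h : Source.points ∈ S) :
    Measurable[X.sigmaOf S] (farLoss P X i) := by
  have : Measurable fun x : Plane => if 1 < ‖x‖ then ‖x‖ ^ (-P.b) else (0 : ℝ) :=
    Measurable.ite (measurableSet_lt measurable_const measurable_norm)
      (measurable_norm.pow_const _) measurable_const
  exact this.comp (measurable_points h i)

variable (P X) in
/-- Partial sums of a component of the interference of the far interferers. -/
noncomputable def farSum (u : ℂ) (n : ℕ) (ω : Ω) : ℝ :=
  ∑ i ∈ Finset.range n, farLoss P X i ω * (u * mark P X i ω).re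

lemma measurable_farSum (u : ℂ) (n : ℕ) :
    Measurable[X.sigmaOf (Source.past n)] (farSum P X u n) :=
  Finset.measurable_sum _ fun i hi => (measurable_farLoss i (Or.inl rfl)).mul
    (Complex.measurable_re.comp
      ((measurable_mark_past (Finset.mem_range.1 hi)).const_mul u))

variable [MeasurableSpace Ω] {μ : Measure Ω}

/-- The positions are known from the start, then the interferers are revealed one by one. -/
noncomputable def IsNetwork.filtration (hX : IsNetwork μ P X) :
    Filtration ℕ ‹MeasurableSpace Ω› where
  seq n := X.sigmaOf (Source.past n)
  mono' _ _ h := X.sigmaOf_mono (Source.past_mono h)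
  le' _ := hX.sigmaOf_le _

lemma IsNetwork.memLp_farSum (hX : IsNetwork μ P X) (u : ℂ) (n : ℕ) :
    MemLp (farSum P X u n) 2 μ := by
  have h : ∀ i, MemLp (fun ω => farLoss P X i ω * (u * mark P X i ω).re) 2 μ := fun i => by
    have h1 : MemLp (fun ω => (u * mark P X i ω).re) 2 μ := ((hX.memLp_mark i).const_mul u).re
    have h2 : Measurable (farLoss P X i) :=
      (measurable_farLoss (S := Set.univ) i trivial).mono (hX.sigmaOf_le _) le_rfl
    refine h1.mono (h2.aestronglyMeasurable.mul h1.1) (ae_of_all _ fun ω => ?_)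
    rw [norm_mul, Real.norm_of_nonneg (farLoss_nonneg i ω)]
    exact mul_le_of_le_one_left (norm_nonneg _) (farLoss_le_one i ω)
  exact memLp_finsetSum _ fun i _ => h i

variable [IsProbabilityMeasure μ]

/-- All positions belong to the past, so the path loss is pulled out of the conditional expectation;
what remains is a mark that is independent of the past and centred. -/
lemma IsNetwork.martingale_farSum (hX : IsNetwork μ P X) {u : ℂ} (hu : ‖u‖ = 1) :
    Martingale (farSum P X u) hX.filtration μ := by
  refine martingale_of_condExp_sub_eq_zero_nat
    (fun n => (measurable_farSum u n).stronglyMeasurable)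
    (fun n => (hX.memLp_farSum u n).integrable one_le_two) fun n => ?_
  have h1 : farSum P X u (n + 1) - farSum P X u n =
      farLoss P X n * fun ω => (u * mark P X n ω).re := by
    ext ω
    simp [farSum, Finset.sum_range_succ]
  have h2 : Integrable (fun ω => (u * mark P X n ω).re) μ :=
    MemLp.integrable one_le_two ((hX.memLp_mark n).const_mul u).re
  have hms : Measurable[X.sigmaOf {x | x.index = some n}] fun ω => (u * mark P X n ω).re :=
    Complex.measurable_re.comp ((PoissonInterference.measurable_mark fun _ hx => hx).const_mul u)
  have h3 := condExp_indep_eq (hX.sigmaOf_le {x | x.index = some n})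
    (hX.sigmaOf_le (Source.past n)) hms.stronglyMeasurable
    (hX.indep_sigmaOf (Source.disjoint_index_past n))
  rw [h1]
  have h4 := condExp_stronglyMeasurable_mul_of_bound (hX.sigmaOf_le (Source.past n))
    (measurable_farLoss (P := P) n (Or.inl rfl)).stronglyMeasurable h2 1
    (ae_of_all _ fun ω => by
      rw [Real.norm_of_nonneg (farLoss_nonneg n ω)]; exact farLoss_le_one n ω)
  refine h4.trans ?_
  filter_upwards [h3] with ω hω
  rw [Pi.mul_apply, hω, hX.integral_re_mark n hu, mul_zero, Pi.zero_apply]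

/-- Orthogonality of martingale increments: in the cross term the new mark is independent of the
other factors and has mean `0`. -/
lemma IsNetwork.integral_farSum_sq_succ (hX : IsNetwork μ P X) {u : ℂ} (hu : ‖u‖ = 1) (n : ℕ) :
    ∫ ω, farSum P X u (n + 1) ω ^ 2 ∂μ = ∫ ω, farSum P X u n ω ^ 2 ∂μ +
      (∫ ω, farLoss P X n ω ^ 2 ∂μ) * ∫ ω, (mark P X 0 ω).re ^ 2 ∂μ := by
  have hle := hX.sigmaOf_le (Source.past n)
  have hm1 : Measurable[X.sigmaOf (Source.past n)] (farSum P X u n) := measurable_farSum u n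
  have hm2 : Measurable[X.sigmaOf (Source.past n)] (farLoss P X n) :=
    measurable_farLoss n (Or.inl rfl)
  have hm3 : Measurable[X.sigmaOf {x | x.index = some n}] fun ω => (u * mark P X n ω).re :=
    Complex.measurable_re.comp ((PoissonInterference.measurable_mark fun _ hx => hx).const_mul u)
  have hdis := (Source.disjoint_index_past n).symm
  have i1 : IndepFun (fun ω => farSum P X u n ω * farLoss P X n ω)
      (fun ω => (u * mark P X n ω).re) μ := hX.indepFun hdis (hm1.mul hm2) hm3
  have i2 : IndepFun (fun ω => farLoss P X n ω ^ 2)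
      (fun ω => (u * mark P X n ω).re ^ 2) μ := hX.indepFun hdis (hm2.pow_const 2) (hm3.pow_const 2)
  have hm1' := hm1.mono hle le_rfl
  have hm2' := hm2.mono hle le_rfl
  have hm3' := hm3.mono (hX.sigmaOf_le _) le_rfl
  have hL3 : MemLp (fun ω => (u * mark P X n ω).re) 2 μ := ((hX.memLp_mark n).const_mul u).re
  have hLs := hX.memLp_farSum u (n + 1)
  have hL1 := hX.memLp_farSum u n
  have hL2 : MemLp (fun ω => farLoss P X n ω * (u * mark P X n ω).re) 2 μ := by
    have := hLs.sub hL1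
    convert! this using 1
    ext ω
    simp [farSum, Finset.sum_range_succ]
  have e : ∀ ω, farSum P X u (n + 1) ω ^ 2 = (farSum P X u n ω ^ 2 +
      2 * ((farSum P X u n ω * farLoss P X n ω) * (u * mark P X n ω).re)) +
      farLoss P X n ω ^ 2 * (u * mark P X n ω).re ^ 2 := fun ω => by
    simp only [farSum, Finset.sum_range_succ]; ring
  simp_rw [e]
  have j1 : Integrable (fun ω => farSum P X u n ω ^ 2) μ := hL1.integrable_sq
  have j2 : Integrable (fun ω =>
      2 * ((farSum P X u n ω * farLoss P X n ω) * (u * mark P X n ω).re)) μ := by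
    have := (hL1.integrable_mul hL2).const_mul 2
    refine this.congr (ae_of_all _ fun ω => ?_)
    simp only [Pi.mul_apply]; ring
  have j3 : Integrable (fun ω => farLoss P X n ω ^ 2 * (u * mark P X n ω).re ^ 2) μ := by
    refine hL2.integrable_sq.congr (ae_of_all _ fun ω => ?_)
    simp only; ring
  have j12 : Integrable (fun ω => farSum P X u n ω ^ 2 +
      2 * ((farSum P X u n ω * farLoss P X n ω) * (u * mark P X n ω).re)) μ := j1.add j2
  rw [integral_add j12 j3, integral_add j1 j2, integral_const_mul,
    i1.integral_fun_mul_eq_mul_integral (hm1'.mul hm2').aestronglyMeasurable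
      hm3'.aestronglyMeasurable,
    i2.integral_fun_mul_eq_mul_integral (hm2'.pow_const 2).aestronglyMeasurable
      (hm3'.pow_const 2).aestronglyMeasurable, hX.integral_re_mark n hu,
    hX.integral_comp_mark n (F := fun z => z.re ^ 2) (by fun_prop) hu]
  ring

/-- The mean squared losses are summable by Campbell's theorem, as `‖x‖^(-2b)` is integrable outside
the unit disc. Here `b > 1` is needed. -/
lemma IsNetwork.exists_bound_farSum_sq (hX : IsNetwork μ P X) {u : ℂ} (hu : ‖u‖ = 1) :
    ∃ C : ℝ, ∀ n, ∫ ω, farSum P X u n ω ^ 2 ∂μ ≤ C := by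
  set s := ∫ ω, (mark P X 0 ω).re ^ 2 ∂μ with hs
  have hs0 : 0 ≤ s := integral_nonneg fun ω => sq_nonneg _
  set e : ℕ → ENNReal := fun i => ∫⁻ ω, ENNReal.ofReal (farLoss P X i ω ^ 2) ∂μ with he
  have hsum : ∑' i, e i < ⊤ := by
    have := hX.poisson.tsum_lintegral_rpow_lt_top P.lam_pos.le (q := 2 * P.b)
      (by linarith [P.one_lt_b])
    simpa only [he, farLoss_sq] using this
  have hei : ∀ i, ∫ ω, farLoss P X i ω ^ 2 ∂μ = (e i).toReal := fun i => by
    have h2 : Measurable (farLoss P X i) :=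
      (measurable_farLoss (S := Set.univ) i trivial).mono (hX.sigmaOf_le _) le_rfl
    rw [integral_eq_lintegral_of_nonneg_ae (ae_of_all _ fun ω => sq_nonneg _)
      (h2.pow_const 2).aestronglyMeasurable]
  have hfin : ∀ i, e i ≠ ⊤ := fun i => ((ENNReal.le_tsum i).trans_lt hsum).ne
  refine ⟨(∑' i, e i).toReal * s, fun n => ?_⟩
  have key : ∫ ω, farSum P X u n ω ^ 2 ∂μ = (∑ i ∈ Finset.range n, (e i).toReal) * s := by
    induction n with
    | zero => simp [farSum]
    | succ n ih =>
      rw [hX.integral_farSum_sq_succ hu, ih, hei, Finset.sum_range_succ]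
      ring
  rw [key, ← ENNReal.toReal_sum fun i _ => hfin i]
  exact mul_le_mul_of_nonneg_right
    (ENNReal.toReal_mono hsum.ne (ENNReal.sum_le_tsum _)) hs0

/-- Doob's convergence theorem; the bound in `L¹` follows from the one in `L²` by `|x| ≤ 1 + x²`. -/
lemma IsNetwork.ae_tendsto_farSum (hX : IsNetwork μ P X) {u : ℂ} (hu : ‖u‖ = 1) :
    ∀ᵐ ω ∂μ, ∃ l, Tendsto (fun n => farSum P X u n ω) atTop (𝓝 l) := by
  obtain ⟨C, hC⟩ := hX.exists_bound_farSum_sq hu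
  have hbdd : ∀ n, eLpNorm (farSum P X u n) 1 μ ≤ ((1 + C).toNNReal : ENNReal) := fun n => by
    have hL := hX.memLp_farSum u n
    have hi := hL.integrable one_le_two
    rw [eLpNorm_one_eq_lintegral_enorm, ← ofReal_integral_norm_eq_lintegral_enorm hi]
    refine ENNReal.ofReal_le_ofReal ?_
    calc ∫ ω, ‖farSum P X u n ω‖ ∂μ ≤ ∫ ω, (1 + farSum P X u n ω ^ 2) ∂μ := by
          refine integral_mono hi.norm ((integrable_const _).add hL.integrable_sq) fun ω => ?_
          simp only [Real.norm_eq_abs]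
          rw [← sq_abs]
          nlinarith [sq_nonneg (|farSum P X u n ω| - 1), abs_nonneg (farSum P X u n ω)]
      _ = 1 + ∫ ω, farSum P X u n ω ^ 2 ∂μ := by
          rw [integral_add (integrable_const _) hL.integrable_sq]; simp
      _ ≤ 1 + C := by linarith [hC n]
  exact (hX.martingale_farSum hu).submartingale.exists_ae_tendsto_of_bdd hbdd

/-- The series that defines the interference converges almost surely. -/
lemma IsNetwork.ae_tendsto_partialInterference (hX : IsNetwork μ P X) :
    ∀ᵐ ω ∂μ, Tendsto (fun n => partialInterference P X n ω) atTop
      (𝓝 (interference P X ω)) := by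
  -- The directions `1` and `-i` give the real and imaginary parts, since `Re(-iz) = Im z`.
  filter_upwards [hX.ae_tendsto_farSum (u := 1) (by simp),
    hX.ae_tendsto_farSum (u := -Complex.I) (by simp),
    hX.poisson.ae_tendsto_norm P.lam_pos.le] with ω ⟨x, hx⟩ ⟨y, hy⟩ hR
  refine tendsto_nhds_limUnder ?_
  have h1 : Tendsto (fun n => ((farSum P X 1 n ω : ℝ) : ℂ) +
      (farSum P X (-Complex.I) n ω : ℝ) * Complex.I) atTop (𝓝 ((x : ℂ) + y * Complex.I)) :=
    ((Complex.continuous_ofReal.tendsto x).comp hx).add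
      (((Complex.continuous_ofReal.tendsto y).comp hy).mul_const _)
  obtain ⟨N, hN⟩ := eventually_atTop.1 (hR.eventually_gt_atTop 1)
  have h2 : ∀ n, ((farSum P X 1 n ω : ℝ) : ℂ) + (farSum P X (-Complex.I) n ω : ℝ) * Complex.I =
      ∑ i ∈ Finset.range n, (farLoss P X i ω : ℂ) * mark P X i ω := fun n => by
    unfold farSum
    push_cast
    rw [Finset.sum_mul, ← Finset.sum_add_distrib]
    refine Finset.sum_congr rfl fun i _ => ?_
    apply Complex.ext <;> simp
  -- Beyond index `N` all points are outside the unit disc, so the true and truncated sums differ by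
  -- a fixed quantity.
  have h3 : ∀ n, N ≤ n → partialInterference P X n ω =
      ((farSum P X 1 n ω : ℝ) : ℂ) + (farSum P X (-Complex.I) n ω : ℝ) * Complex.I +
        (partialInterference P X N ω -
          ∑ i ∈ Finset.range N, (farLoss P X i ω : ℂ) * mark P X i ω) := fun n hn => by
    rw [h2]
    induction n, hn using Nat.le_induction with
    | base => ring
    | succ n hn ih =>
      rw [partialInterference_eq, Finset.sum_range_succ, ← partialInterference_eq, ih,
        Finset.sum_range_succ _ n, farLoss, if_pos (hN n hn)]
      ring
  refine ⟨_, (h1.add_const (partialInterference P X N ω -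
    ∑ i ∈ Finset.range N, (farLoss P X i ω : ℂ) * mark P X i ω)).congr' ?_⟩
  filter_upwards [eventually_ge_atTop N] with n hn using (h3 n hn).symm

end Convergence

/-- Integrating out a random vector that is independent of the rest. -/
lemma integral_mul_exp_inner_of_indepFun {Ω : Type*} [MeasurableSpace Ω] {μ : Measure Ω}
    [IsProbabilityMeasure μ] {D V : Ω → ℂ} {c : Ω → ℝ} (hD : Measurable D) (hV : Measurable V)
    (hc : Measurable c) (hD1 : ∀ ω, ‖D ω‖ ≤ 1) (hind : IndepFun (fun ω => (D ω, c ω)) V μ) (w : ℂ) :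
    ∫ ω, D ω * Complex.exp (inner ℝ (c ω * V ω) w * Complex.I) ∂μ =
      ∫ ω, D ω * charFun (μ.map V) (c ω * w) ∂μ := by
  have hDc : Measurable fun ω => (D ω, c ω) := hD.prodMk hc
  have hmap := (indepFun_iff_map_prod_eq_prod_map_map hDc.aemeasurable hV.aemeasurable).1 hind
  have h1 : IsProbabilityMeasure (μ.map V) := Measure.isProbabilityMeasure_map hV.aemeasurable
  have h2 : IsProbabilityMeasure (μ.map fun ω => (D ω, c ω)) :=
    Measure.isProbabilityMeasure_map hDc.aemeasurable
  have hF : Measurable fun q : (ℂ × ℝ) × ℂ =>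
      q.1.1 * Complex.exp (inner ℝ (q.1.2 * q.2) w * Complex.I) := by fun_prop
  have h3 := integral_map (μ := μ) (hDc.prodMk hV).aemeasurable hF.aestronglyMeasurable
  have hbd : ∀ᵐ q ∂(μ.map fun ω => (D ω, c ω)), ‖q.1‖ ≤ 1 :=
    (ae_map_iff hDc.aemeasurable (measurableSet_le measurable_fst.norm measurable_const)).2
      (ae_of_all _ hD1)
  have hint : Integrable (fun q : (ℂ × ℝ) × ℂ =>
      q.1.1 * Complex.exp (inner ℝ (q.1.2 * q.2) w * Complex.I))
      ((μ.map fun ω => (D ω, c ω)).prod (μ.map V)) := by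
    refine Integrable.of_bound hF.aestronglyMeasurable 1 ?_
    filter_upwards [Measure.quasiMeasurePreserving_fst.ae hbd] with q hq
    rw [norm_mul, Complex.norm_exp_ofReal_mul_I, mul_one]
    exact hq
  rw [hmap, integral_prod _ hint] at h3
  rw [← h3, ← integral_map (φ := fun ω => (D ω, c ω))
    (f := fun q : ℂ × ℝ => q.1 * charFun (μ.map V) (q.2 * w)) hDc.aemeasurable]
  · refine integral_congr_ae (ae_of_all _ fun q => ?_)
    simp only
    rw [integral_const_mul, charFun_apply]
    congr 2 with v
    congr 3
    simp only [Complex.inner, map_mul, Complex.conj_ofReal]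
    ring_nf
  · have hcf : Continuous (charFun (μ.map V)) := continuous_charFun
    apply Measurable.aestronglyMeasurable
    have := hcf.measurable
    fun_prop

/-! ### The characteristic function of the interference. -/

section InterferenceLaw

variable {Ω : Type*} {M L : ℕ} {P : Params M L} {X : Signals Ω M L}

variable (P X) in
/-- Path loss of an interferer, replaced by `0` at distance larger than `m`. -/
noncomputable def nearLoss (m : ℕ) (i : ℕ) (ω : Ω) : ℝ :=
  if ‖X.pt i ω‖ ≤ m then ‖X.pt i ω‖ ^ (-P.b) else 0

lemma measurable_nearLoss (m i : ℕ) {S : Set Source} (h : Source.points ∈ S) :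
    Measurable[X.sigmaOf S] (nearLoss P X m i) := by
  have : Measurable fun x : Plane => if ‖x‖ ≤ m then ‖x‖ ^ (-P.b) else (0 : ℝ) :=
    Measurable.ite (measurableSet_le measurable_norm measurable_const)
      (measurable_norm.pow_const _) measurable_const
  exact this.comp (measurable_points h i)

variable (P X) in
/-- Interference of those of the first `n` interferers that are at distance at most `m`. -/
noncomputable def nearSum (m n : ℕ) (ω : Ω) : ℂ :=
  ∑ i ∈ Finset.range n, (nearLoss P X m i ω : ℂ) * mark P X i ω

lemma measurable_nearSum (m n : ℕ) :
    Measurable[X.sigmaOf (Source.past n)] (nearSum P X m n) :=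
  Finset.measurable_sum _ fun i hi =>
    (Complex.measurable_ofReal.comp (measurable_nearLoss m i (Or.inl rfl))).mul
      (measurable_mark_past (Finset.mem_range.1 hi))

lemma measurable_exp_nearSum (m n : ℕ) (w : ℂ) : Measurable[X.sigmaOf (Source.past n)]
    fun ω => Complex.exp (inner ℝ (nearSum P X m n ω) w * Complex.I) :=
  (show Measurable fun z : ℂ => Complex.exp (inner ℝ z w * Complex.I) by fun_prop).comp
    (measurable_nearSum m n)

/-- The number of points at distance at most `m`. -/
noncomputable def ballCount (X : Signals Ω M L) (m : ℕ) (ω : Ω) : ℕ :=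
  sInf {i | (m : ℝ) < ‖X.pt i ω‖}

/-- Because the points are listed by increasing distance, those in a disc form an initial segment.
Sums over discs are therefore partial sums of the series. -/
lemma norm_le_iff_lt_ballCount {ω : Ω} (hmono : Monotone fun i => ‖X.pt i ω‖)
    (hR : Tendsto (fun i => ‖X.pt i ω‖) atTop atTop) (m i : ℕ) :
    ‖X.pt i ω‖ ≤ m ↔ i < ballCount X m ω := by
  have hne : {i | (m : ℝ) < ‖X.pt i ω‖}.Nonempty := (hR.eventually_gt_atTop (m : ℝ)).exists
  have hmem : (m : ℝ) < ‖X.pt (ballCount X m ω) ω‖ := Nat.sInf_mem hne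
  constructor
  · intro h
    by_contra hc
    exact absurd (hmono (not_lt.1 hc)) (not_le.2 (h.trans_lt hmem))
  · intro h
    by_contra hc
    exact Nat.notMem_of_lt_sInf h (not_le.1 hc)

lemma tendsto_ballCount {ω : Ω} (hmono : Monotone fun i => ‖X.pt i ω‖)
    (hR : Tendsto (fun i => ‖X.pt i ω‖) atTop atTop) :
    Tendsto (fun m => ballCount X m ω) atTop atTop := by
  refine tendsto_atTop.2 fun k => ?_
  obtain ⟨m, hm⟩ := exists_nat_ge ‖X.pt k ω‖
  filter_upwards [eventually_ge_atTop m] with n hn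
  exact ((norm_le_iff_lt_ballCount hmono hR n k).1
    (hm.trans (by exact_mod_cast hn))).le

lemma nearSum_eq_partialInterference {ω : Ω} (hmono : Monotone fun i => ‖X.pt i ω‖)
    (hR : Tendsto (fun i => ‖X.pt i ω‖) atTop atTop) {m n : ℕ} (hn : ballCount X m ω ≤ n) :
    nearSum P X m n ω = partialInterference P X (ballCount X m ω) ω := by
  rw [partialInterference_eq, nearSum]
  symm
  refine Finset.sum_subset_zero_on_sdiff (Finset.range_subset_range.2 hn) (fun i hi => ?_)
    fun i hi => ?_
  · rw [Finset.mem_sdiff, Finset.mem_range, Finset.mem_range,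
      ← norm_le_iff_lt_ballCount hmono hR] at hi
    simp [nearLoss, hi.2]
  · rw [Finset.mem_range, ← norm_le_iff_lt_ballCount hmono hR] at hi
    simp [nearLoss, hi]

lemma measurable_partialInterference (n : ℕ) :
    Measurable[X.sigmaOf (Source.past n)] (partialInterference P X n) := by
  have : partialInterference P X n = fun ω =>
    ∑ i ∈ Finset.range n, ((‖X.pt i ω‖ ^ (-P.b) : ℝ) : ℂ) * mark P X i ω :=
    funext (partialInterference_eq P X n)
  rw [this]
  have h : Measurable fun x : Plane => ((‖x‖ ^ (-P.b) : ℝ) : ℂ) := by fun_prop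
  exact Finset.measurable_sum _ fun i hi => (h.comp (measurable_points_past i n)).mul
    (measurable_mark_past (Finset.mem_range.1 hi))

lemma measurable_interference {S : Set Source} (h : ∀ n, Source.past n ⊆ S) :
    Measurable[X.sigmaOf S] (interference P X) := by
  have : ∀ n, StronglyMeasurable[X.sigmaOf S] (partialInterference P X n) := fun n =>
    ((measurable_partialInterference n).mono (X.sigmaOf_mono (h n)) le_rfl).stronglyMeasurable
  exact (@StronglyMeasurable.limUnder _ _ _ (X.sigmaOf S) _ _ _ _ _ _ _ this).measurable

variable [MeasurableSpace Ω] {μ : Measure Ω}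

lemma IsNetwork.measurable_interference (hX : IsNetwork μ P X) :
    Measurable (interference P X) :=
  (PoissonInterference.measurable_interference (S := Set.univ) fun _ _ _ => trivial).mono
    (hX.sigmaOf_le _) le_rfl

variable [IsProbabilityMeasure μ]

/-- Conditioning on the positions, without conditional expectations: the marks are integrated out
from the last to the first. The arbitrary factor `D`, a function of the positions, stores what has
already been integrated, and is what makes the induction close. -/
lemma IsNetwork.integral_exp_nearSum (hX : IsNetwork μ P X) (w : ℂ) (m n : ℕ) :
    ∀ D : Ω → ℂ, Measurable[X.sigmaOf {.points}] D → (∀ ω, ‖D ω‖ ≤ 1) →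
    ∫ ω, D ω * Complex.exp (inner ℝ (nearSum P X m n ω) w * Complex.I) ∂μ =
      ∫ ω, D ω * ∏ i ∈ Finset.range n, (markCF P X μ (‖w‖ * nearLoss P X m i ω) : ℂ) ∂μ := by
  induction n with
  | zero => intro D _ _; simp [nearSum]
  | succ n ih =>
    intro D hD hD1
    have hpts : ({Source.points} : Set Source) ⊆ Source.past n := fun x hx => Or.inl hx
    have hDp : Measurable[X.sigmaOf (Source.past n)] D := hD.mono (X.sigmaOf_mono hpts) le_rfl
    have hc : Measurable[X.sigmaOf (Source.past n)] (nearLoss P X m n) :=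
      measurable_nearLoss m n (Or.inl rfl)
    have hD' : Measurable[X.sigmaOf (Source.past n)] fun ω =>
        D ω * Complex.exp (inner ℝ (nearSum P X m n ω) w * Complex.I) :=
      hDp.mul (measurable_exp_nearSum (P := P) m n w)
    have hV : Measurable[X.sigmaOf {x | x.index = some n}] (mark P X n) :=
      PoissonInterference.measurable_mark fun _ hx => hx
    have hind := hX.indepFun (Source.disjoint_index_past n).symm (hD'.prodMk hc) hV
    have hle := hX.sigmaOf_le (Source.past n)
    have e1 : ∀ ω, D ω * Complex.exp (inner ℝ (nearSum P X m (n + 1) ω) w * Complex.I) =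
        (D ω * Complex.exp (inner ℝ (nearSum P X m n ω) w * Complex.I)) *
          Complex.exp (inner ℝ ((nearLoss P X m n ω : ℂ) * mark P X n ω) w * Complex.I) := by
      intro ω
      rw [nearSum, Finset.sum_range_succ, inner_add_left, mul_assoc, ← Complex.exp_add, nearSum]
      congr 2
      push_cast
      ring
    simp_rw [e1]
    rw [integral_mul_exp_inner_of_indepFun (hD'.mono hle le_rfl) (hX.measurable_mark n)
      (hc.mono hle le_rfl) (fun ω => ?_) hind w]
    · simp_rw [hX.charFun_map_mark]
      have hφ : Measurable fun r : ℝ => (markCF P X μ r : ℂ) :=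
        Complex.measurable_ofReal.comp hX.continuous_markCF.measurable
      have hN : Measurable[X.sigmaOf {.points}] (nearLoss P X m n) :=
        measurable_nearLoss m n (Set.mem_singleton _)
      have hφ' : Measurable fun r : ℝ => (markCF P X μ (‖w‖ * r) : ℂ) :=
        hφ.comp (measurable_id.const_mul ‖w‖)
      have hD2 : Measurable[X.sigmaOf {.points}] fun ω =>
          D ω * (markCF P X μ (‖w‖ * nearLoss P X m n ω) : ℂ) :=
        hD.mul (hφ'.comp hN)
      have := ih _ hD2 (fun ω => by
        rw [norm_mul, Complex.norm_real]
        exact mul_le_one₀ (hD1 ω) (norm_nonneg _) (norm_markCF_le _))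
      refine Eq.trans ?_ (this.trans ?_)
      · congr 1 with ω
        have h0 : 0 ≤ nearLoss P X m n ω := by unfold nearLoss; split_ifs <;> positivity
        rw [norm_mul, Complex.norm_real, Real.norm_of_nonneg h0, mul_comm (nearLoss P X m n ω)]
        ring
      · congr 1 with ω
        rw [Finset.prod_range_succ]
        ring
    · rw [norm_mul, Complex.norm_exp_ofReal_mul_I, mul_one]
      exact hD1 ω

/-- With `m` fixed, letting `n` tend to infinity exhausts the points of the disc on both sides of
`integral_exp_nearSum`; the generating functional then evaluates the mean of the product. -/
lemma IsNetwork.integral_exp_partialInterference_ballCount (hX : IsNetwork μ P X) (w : ℂ)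
    (m : ℕ) :
    ∫ ω, Complex.exp (inner ℝ (partialInterference P X (ballCount X m ω) ω) w * Complex.I) ∂μ =
      Complex.exp (-(P.lam * ∫ x in Metric.closedBall (0 : Plane) m,
        (1 - (markCF P X μ (‖w‖ * ‖x‖ ^ (-P.b)) : ℂ)))) := by
  have hφ : Measurable fun r : ℝ => (markCF P X μ r : ℂ) :=
    Complex.measurable_ofReal.comp hX.continuous_markCF.measurable
  have hf : Measurable fun x : Plane => (markCF P X μ (‖w‖ * ‖x‖ ^ (-P.b)) : ℂ) :=
    hφ.comp ((measurable_norm.pow_const _).const_mul _)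
  rw [← hX.poisson.integral_finprod P.lam_pos.le Metric.isClosed_closedBall.measurableSet
    measure_closedBall_lt_top.ne hf
    (fun x => by rw [Complex.norm_real]; exact norm_markCF_le _)]
  have hint : ∀ n, ∫ ω, Complex.exp (inner ℝ (nearSum P X m n ω) w * Complex.I) ∂μ =
      ∫ ω, ∏ i ∈ Finset.range n, (markCF P X μ (‖w‖ * nearLoss P X m i ω) : ℂ) ∂μ := fun n => by
    have := hX.integral_exp_nearSum w m n (fun _ => 1)
      measurable_const (fun _ => norm_one.le)
    simp only [one_mul] at this
    exact this
  have lim1 : Tendsto (fun n => ∫ ω, Complex.exp (inner ℝ (nearSum P X m n ω) w * Complex.I) ∂μ)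
      atTop (𝓝 (∫ ω, Complex.exp
        (inner ℝ (partialInterference P X (ballCount X m ω) ω) w * Complex.I) ∂μ)) := by
    refine tendsto_integral_of_dominated_convergence (fun _ => 1) (fun n =>
      ((measurable_exp_nearSum m n w).mono (hX.sigmaOf_le _) le_rfl).aestronglyMeasurable)
      (integrable_const _) (fun n => ae_of_all _ fun ω => ?_) ?_
    · rw [Complex.norm_exp_ofReal_mul_I]
    · filter_upwards [hX.poisson.ordered, hX.poisson.ae_tendsto_norm P.lam_pos.le] with ω h1 h2
      refine tendsto_const_nhds.congr' ?_
      filter_upwards [eventually_ge_atTop (ballCount X m ω)] with n hn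
      rw [nearSum_eq_partialInterference h1 h2 hn]
  have lim2 : Tendsto (fun n => ∫ ω, ∏ i ∈ Finset.range n,
      (markCF P X μ (‖w‖ * nearLoss P X m i ω) : ℂ) ∂μ) atTop
      (𝓝 (∫ ω, ∏ᶠ i, (1 - (Metric.closedBall (0 : Plane) m).indicator
        (fun x => 1 - (markCF P X μ (‖w‖ * ‖x‖ ^ (-P.b)) : ℂ)) (X.pt i ω)) ∂μ)) := by
    refine tendsto_integral_of_dominated_convergence (fun _ => 1) (fun n => ?_)
      (integrable_const _) (fun n => ae_of_all _ fun ω => ?_) ?_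
    · refine (Finset.measurable_prod _ fun i _ => ?_).aestronglyMeasurable
      exact hφ.comp (((measurable_nearLoss (S := Set.univ) m i trivial).mono
        (hX.sigmaOf_le _) le_rfl).const_mul _)
    · rw [norm_prod]
      refine Finset.prod_le_one (fun _ _ => norm_nonneg _) fun i _ => ?_
      rw [Complex.norm_real]
      exact norm_markCF_le _
    · filter_upwards [hX.poisson.ordered, hX.poisson.ae_tendsto_norm P.lam_pos.le] with ω h1 h2
      refine tendsto_const_nhds.congr' ?_
      -- Points outside the disc have loss `0`, hence factor `1`, which matches the indicator in the
      -- generating functional.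
      have h0 : markCF P X μ 0 = 1 := by simp [markCF]
      filter_upwards [eventually_ge_atTop (ballCount X m ω)] with n hn
      rw [finprod_eq_prod_of_mulSupport_subset (s := Finset.range n)]
      · refine Finset.prod_congr rfl fun i _ => ?_
        by_cases hi : ‖X.pt i ω‖ ≤ m
        · simp [nearLoss, hi]
        · simp [nearLoss, hi, h0]
      · intro i hi
        by_contra hc
        refine hi ?_
        have h3 : ¬ ‖X.pt i ω‖ ≤ m := fun h => hc (by
          simpa using ((norm_le_iff_lt_ballCount h1 h2 m i).1 h).trans_le hn)
        simp [h3]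
  refine tendsto_nhds_unique lim1 ?_
  simp_rw [hint]
  exact lim2

/-- The characteristic function of the interference. -/
lemma IsNetwork.charFun_map_interference (hX : IsNetwork μ P X) (w : ℂ) :
    charFun (μ.map (interference P X)) w =
      Complex.exp (-(P.lam * Real.pi * (stableConst (2 / P.b))⁻¹ *
        (∫ ω, |(mark P X 0 ω).re| ^ (2 / P.b) ∂μ) * ‖w‖ ^ (2 / P.b) : ℝ)) := by
  have hb := P.one_lt_b
  have hb0 : 0 < P.b := by linarith
  have hα0 : 0 < 2 / P.b := by positivity
  have hα2 : 2 / P.b < 2 := by rw [div_lt_iff₀ hb0]; linarith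
  set s := ∫ ω, (mark P X 0 ω).re ^ 2 ∂μ with hs
  have hs0 : 0 ≤ s := integral_nonneg fun _ => sq_nonneg _
  have hφ : Measurable fun r : ℝ => (markCF P X μ r : ℂ) :=
    Complex.measurable_ofReal.comp hX.continuous_markCF.measurable
  have hf : Measurable fun x : Plane => (markCF P X μ (‖w‖ * ‖x‖ ^ (-P.b)) : ℂ) :=
    hφ.comp ((measurable_norm.pow_const _).const_mul _)
  have hnorm1 : ∀ r : ℝ, ‖(1 - (markCF P X μ r : ℂ))‖ ≤ 2 := fun r => by
    refine (norm_sub_le _ _).trans ?_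
    rw [Complex.norm_real, norm_one]
    linarith [norm_markCF_le (P := P) (X := X) (μ := μ) r]
  have hnorm2 : ∀ r : ℝ, ‖(1 - (markCF P X μ r : ℂ))‖ ≤ r ^ 2 / 2 * s := fun r => by
    have := hX.norm_one_sub_markCF_le r
    rwa [← Complex.norm_real, Complex.ofReal_sub, Complex.ofReal_one] at this
  -- Bounded near the origin, and at infinity quadratic in the path loss, hence of order
  -- `‖x‖^(-2b)`.
  have hint : Integrable fun x : Plane => 1 - (markCF P X μ (‖w‖ * ‖x‖ ^ (-P.b)) : ℂ) := by
    refine integrable_plane_of_bound (q := 2 * P.b) (C := 2 + ‖w‖ ^ 2 / 2 * s)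
      (hf.const_sub 1).aestronglyMeasurable (by linarith) (fun x => ?_) (fun x => ?_)
    · refine (hnorm1 _).trans ?_
      have : 0 ≤ ‖w‖ ^ 2 / 2 * s := by positivity
      linarith
    · refine (hnorm2 _).trans ?_
      have h1 : (‖x‖ ^ (-P.b)) ^ 2 = ‖x‖ ^ (-(2 * P.b)) := by
        rw [← Real.rpow_mul_natCast (norm_nonneg _)]
        congr 1; push_cast; ring
      rw [mul_pow, h1]
      have : 0 ≤ ‖x‖ ^ (-(2 * P.b)) := by positivity
      nlinarith
  have hval : ∫ x : Plane, (1 - (markCF P X μ (‖w‖ * ‖x‖ ^ (-P.b)) : ℂ)) =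
      ((Real.pi * (stableConst (2 / P.b))⁻¹ *
        (∫ ω, |(mark P X 0 ω).re| ^ (2 / P.b) ∂μ) * ‖w‖ ^ (2 / P.b) : ℝ) : ℂ) := by
    have h1 := integral_norm_rpow_neg_plane (fun t => 1 - markCF P X μ (‖w‖ * t)) hb0
    have h2 : ∫ x : Plane, (1 - (markCF P X μ (‖w‖ * ‖x‖ ^ (-P.b)) : ℂ)) =
        ((∫ x : Plane, (1 - markCF P X μ (‖w‖ * ‖x‖ ^ (-P.b))) : ℝ) : ℂ) := by
      rw [← integral_complex_ofReal]
      push_cast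
      rfl
    rw [h2, h1]
    congr 1
    -- The scaling argument needs `‖w‖ > 0`.
    rcases eq_or_ne w 0 with rfl | hw
    · simp [markCF, Real.zero_rpow hα0.ne']
    · rw [integral_rpow_smul_comp_mul (fun t => 1 - markCF P X μ t) hα0 (norm_pos_iff.2 hw)]
      simp only [smul_eq_mul]
      rw [hX.integral_rpow_mul_one_sub_markCF hα0 hα2]
      field_simp
  have lim1 : Tendsto (fun m : ℕ => ∫ x in Metric.closedBall (0 : Plane) m,
      (1 - (markCF P X μ (‖w‖ * ‖x‖ ^ (-P.b)) : ℂ))) atTop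
      (𝓝 (∫ x : Plane, (1 - (markCF P X μ (‖w‖ * ‖x‖ ^ (-P.b)) : ℂ)))) := by
    have := tendsto_setIntegral_of_monotone (μ := (volume : Measure Plane))
      (s := fun m : ℕ => Metric.closedBall (0 : Plane) m)
      (f := fun x => 1 - (markCF P X μ (‖w‖ * ‖x‖ ^ (-P.b)) : ℂ))
      (fun m => Metric.isClosed_closedBall.measurableSet)
      (fun a b hab => Metric.closedBall_subset_closedBall (by exact_mod_cast hab)) hint.integrableOn
    rwa [Metric.iUnion_closedBall_nat, setIntegral_univ] at this
  -- The interference from growing discs is the series along the indices `ballCount X m`, which tend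
  -- to infinity.
  have lim2 : Tendsto (fun m : ℕ => ∫ ω, Complex.exp
      (inner ℝ (partialInterference P X (ballCount X m ω) ω) w * Complex.I) ∂μ) atTop
      (𝓝 (∫ ω, Complex.exp (inner ℝ (interference P X ω) w * Complex.I) ∂μ)) := by
    refine tendsto_integral_of_dominated_convergence (fun _ => 1) (fun m => ?_)
      (integrable_const _) (fun n => ae_of_all _ fun ω => ?_) ?_
    · refine aestronglyMeasurable_of_tendsto_ae atTop (f := fun n ω =>
        Complex.exp (inner ℝ (nearSum P X m n ω) w * Complex.I)) (fun n =>
        ((measurable_exp_nearSum m n w).mono (hX.sigmaOf_le _) le_rfl).aestronglyMeasurable) ?_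
      filter_upwards [hX.poisson.ordered, hX.poisson.ae_tendsto_norm P.lam_pos.le] with ω h1 h2
      refine tendsto_const_nhds.congr' ?_
      filter_upwards [eventually_ge_atTop (ballCount X m ω)] with n hn
      rw [nearSum_eq_partialInterference h1 h2 hn]
    · rw [Complex.norm_exp_ofReal_mul_I]
    · filter_upwards [hX.poisson.ordered, hX.poisson.ae_tendsto_norm P.lam_pos.le,
        hX.ae_tendsto_partialInterference] with ω h1 h2 h3
      have hc : Continuous fun z : ℂ => Complex.exp (inner ℝ z w * Complex.I) := by fun_prop
      exact (hc.tendsto _).comp (h3.comp (tendsto_ballCount h1 h2))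
  simp_rw [hX.integral_exp_partialInterference_ballCount] at lim2
  rw [charFun_apply, integral_map hX.measurable_interference.aemeasurable (by fun_prop)]
  refine tendsto_nhds_unique lim2 ?_
  have := (Complex.continuous_exp.tendsto _).comp ((lim1.const_mul (P.lam : ℂ)).neg)
  rw [hval] at this
  convert! this using 2
  congr 1
  push_cast
  ring

end InterferenceLaw

/-! ### The positive stable law: from Laplace transform to characteristic function, and its
construction. -/

section StableLaw

/-- Both sides are analytic in the left half-plane and agree on the negative reals, so the identity
theorem applies. -/
lemma complexMGF_eq_of_laplace {ν : Measure ℝ} [IsProbabilityMeasure ν] (hpos : ∀ᵐ x ∂ν, 0 < x)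
    {α : ℝ} (hL : ∀ r : ℝ, 0 < r → ∫ x, Real.exp (-(r * x)) ∂ν = Real.exp (-r ^ α))
    {z : ℂ} (hz : z.re < 0) : complexMGF id ν z = Complex.exp (-(-z) ^ (α : ℂ)) := by
  have hint : Set.Iic 0 ⊆ integrableExpSet id ν := fun t ht => by
    change Integrable (fun x => Real.exp (t * id x)) ν
    refine Integrable.of_bound (Measurable.aestronglyMeasurable (by fun_prop)) 1 ?_
    filter_upwards [hpos] with x hx
    rw [Real.norm_of_nonneg (Real.exp_pos _).le, Real.exp_le_one_iff]
    exact mul_nonpos_of_nonpos_of_nonneg ht hx.le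
  have hint' : Set.Iio 0 ⊆ interior (integrableExpSet id ν) := by
    rw [← interior_Iic]
    exact interior_mono hint
  have hUo : IsOpen {z : ℂ | z.re < 0} := isOpen_lt Complex.continuous_re continuous_const
  have hUc : IsPreconnected {z : ℂ | z.re < 0} := (convex_halfSpace_re_lt 0).isPreconnected
  have hf : AnalyticOnNhd ℂ (complexMGF id ν) {z : ℂ | z.re < 0} :=
    analyticOnNhd_complexMGF.mono fun z hz => hint' hz
  have hg : AnalyticOnNhd ℂ (fun z : ℂ => Complex.exp (-(-z) ^ (α : ℂ))) {z : ℂ | z.re < 0} := by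
    refine DifferentiableOn.analyticOnNhd (fun z (hz : z.re < 0) => ?_) hUo
    have h1 : -z ∈ Complex.slitPlane := Or.inl (by simpa using hz)
    exact (((differentiableAt_id.neg).cpow_const h1).neg.cexp).differentiableWithinAt
  have hreal : ∀ x : ℝ, x < 0 → complexMGF id ν x = Complex.exp (-(-(x : ℂ)) ^ (α : ℂ)) := by
    intro x hx
    have h1 := hL (-x) (by linarith)
    rw [complexMGF_ofReal, mgf]
    simp only [id, neg_mul, neg_neg] at h1 ⊢
    rw [h1, ← Complex.ofReal_neg, ← Complex.ofReal_cpow (by linarith), ← Complex.ofReal_neg,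
      Complex.ofReal_exp]
  refine hf.eqOn_of_preconnected_of_frequently_eq hg hUc (z₀ := ((-1 : ℝ) : ℂ)) (by simp) ?_ hz
  have ht : Tendsto (fun x : ℝ => (x : ℂ)) (𝓝[≠] (-1)) (𝓝[≠] ((-1 : ℝ) : ℂ)) :=
    tendsto_nhdsWithin_of_tendsto_nhds_of_eventually_within _
      ((Complex.continuous_ofReal.tendsto _).mono_left nhdsWithin_le_nhds)
      (by filter_upwards [self_mem_nhdsWithin] with x hx using by
            simpa using fun h => hx (Complex.ofReal_injective (by simpa using h)))
  refine ht.frequently (Eventually.frequently ?_)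
  filter_upwards [nhdsWithin_le_nhds (Iio_mem_nhds (show (-1 : ℝ) < 0 by norm_num))] with x hx
  exact hreal x hx

/-- Passage to the boundary of the half-plane: positivity of the variable dominates the integrand by
`1`, and for `w ≠ 0` the base `-iw` of the power stays off the branch cut. -/
lemma charFun_eq_of_laplace {ν : Measure ℝ} [IsProbabilityMeasure ν] (hpos : ∀ᵐ x ∂ν, 0 < x)
    {α : ℝ} (hL : ∀ r : ℝ, 0 < r → ∫ x, Real.exp (-(r * x)) ∂ν = Real.exp (-r ^ α))
    {w : ℝ} (hw : w ≠ 0) : charFun ν w = Complex.exp (-(-(w * Complex.I)) ^ (α : ℂ)) := by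
  rw [← complexMGF_id_mul_I]
  have hpath : Tendsto (fun ε : ℝ => -(ε : ℂ) + w * Complex.I) (𝓝[>] 0) (𝓝 (w * Complex.I)) := by
    have : Continuous fun ε : ℝ => -(ε : ℂ) + w * Complex.I := by fun_prop
    simpa using (this.tendsto 0).mono_left nhdsWithin_le_nhds
  have lim1 : Tendsto (fun ε : ℝ => complexMGF id ν (-(ε : ℂ) + w * Complex.I)) (𝓝[>] 0)
      (𝓝 (complexMGF id ν (w * Complex.I))) := by
    unfold complexMGF
    refine tendsto_integral_filter_of_dominated_convergence (fun _ => 1)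
      (Eventually.of_forall fun ε => Measurable.aestronglyMeasurable (by fun_prop)) ?_
      (integrable_const _) (ae_of_all _ fun x => ?_)
    · filter_upwards [self_mem_nhdsWithin] with ε (hε : 0 < ε)
      filter_upwards [hpos] with x hx
      rw [Complex.norm_exp, Real.exp_le_one_iff]
      simp
      positivity
    · have : Continuous fun z : ℂ => Complex.exp (z * (id x : ℝ)) := by fun_prop
      exact (this.tendsto _).comp hpath
  have lim2 : Tendsto (fun ε : ℝ => Complex.exp (-(-(-(ε : ℂ) + w * Complex.I)) ^ (α : ℂ)))
      (𝓝[>] 0) (𝓝 (Complex.exp (-(-(w * Complex.I)) ^ (α : ℂ)))) := by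
    have hs : -(w * Complex.I) ∈ Complex.slitPlane := Or.inr (by simpa using hw)
    have hc : ContinuousAt (fun z : ℂ => Complex.exp (-(-z) ^ (α : ℂ))) (w * Complex.I) :=
      ((continuousAt_neg.cpow continuousAt_const hs).neg).cexp
    exact hc.tendsto.comp hpath
  refine tendsto_nhds_unique lim1 (lim2.congr' ?_)
  filter_upwards [self_mem_nhdsWithin] with ε (hε : 0 < ε)
  rw [complexMGF_eq_of_laplace hpos hL (by simpa using hε)]

lemma ofReal_mul_cpow {r : ℝ} (hr : 0 < r) {x : ℂ} (hx : x ≠ 0) (a : ℂ) :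
    ((r : ℂ) * x) ^ a = (r : ℂ) ^ a * x ^ a := by
  have hr' : (r : ℂ) ≠ 0 := Complex.ofReal_ne_zero.2 hr.ne'
  rw [Complex.cpow_def_of_ne_zero (mul_ne_zero hr' hx), Complex.cpow_def_of_ne_zero hr',
    Complex.cpow_def_of_ne_zero hx, Complex.log_ofReal_mul hr hx, add_mul, Complex.exp_add,
    Complex.ofReal_log hr.le]

/-- The value `(-iw)^α` is `|w|^α` times `cos(πα/2) - i sign(w) sin(πα/2)`. Factoring out the cosine
gives the scale, and the remaining tangent shows that the skewness is `1`. -/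
lemma isStableLaw_of_laplace {ν : Measure ℝ} [IsProbabilityMeasure ν] (hpos : ∀ᵐ x ∂ν, 0 < x)
    {α : ℝ} (h0 : 0 < α) (h1 : α < 1)
    (hL : ∀ r : ℝ, 0 < r → ∫ x, Real.exp (-(r * x)) ∂ν = Real.exp (-r ^ α)) :
    IsStableLaw ν α 1 (Real.cos (Real.pi * α / 2)) := by
  intro w
  have hcos : Real.cos (Real.pi * α / 2) ≠ 0 :=
    (Real.cos_pos_of_mem_Ioo ⟨by nlinarith [Real.pi_pos], by nlinarith [Real.pi_pos]⟩).ne'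
  rw [if_pos h1.ne]
  rcases eq_or_ne w 0 with rfl | hw
  · simp [Real.zero_rpow h0.ne']
  rw [charFun_eq_of_laplace hpos hL hw, Real.tan_eq_sin_div_cos]
  congr 1
  have key : ∀ ε : ℝ, (ε = 1 ∨ ε = -1) → w = ε * |w| → Real.sign w = ε →
      -(-(w * Complex.I)) ^ (α : ℂ) =
        -((Real.cos (Real.pi * α / 2) * |w| ^ α : ℝ) : ℂ) *
          (1 - Complex.I * ((1 * Real.sign w * (Real.sin (Real.pi * α / 2) /
            Real.cos (Real.pi * α / 2)) : ℝ) : ℂ)) := by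
    intro ε hε hwε hs
    have e1 : -(w * Complex.I) = ((|w| : ℝ) : ℂ) * -(ε * Complex.I) := by
      nth_rewrite 1 [hwε]; push_cast; ring
    have e2 : (-(ε * Complex.I)) ^ (α : ℂ) =
        Complex.cos (Real.pi * α / 2 : ℝ) - ε * Complex.sin (Real.pi * α / 2 : ℝ) * Complex.I := by
      rcases hε with rfl | rfl
      · rw [Complex.cpow_def_of_ne_zero (by simp)]
        simp only [Complex.ofReal_one, one_mul, Complex.log_neg_I]
        rw [show -(Real.pi / 2 : ℂ) * Complex.I * α =
          ((-(Real.pi * α / 2) : ℝ) : ℂ) * Complex.I by push_cast; ring, Complex.exp_mul_I]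
        push_cast
        rw [Complex.cos_neg, Complex.sin_neg]
        ring
      · rw [Complex.cpow_def_of_ne_zero (by simp)]
        simp only [Complex.ofReal_neg, Complex.ofReal_one, neg_mul, one_mul, neg_neg, Complex.log_I]
        rw [show (Real.pi / 2 : ℂ) * Complex.I * α =
          ((Real.pi * α / 2 : ℝ) : ℂ) * Complex.I by push_cast; ring, Complex.exp_mul_I]
        push_cast
        ring
    have hne : -(ε * Complex.I) ≠ 0 := by rcases hε with rfl | rfl <;> simp
    rw [e1, ofReal_mul_cpow (abs_pos.2 hw) hne, e2, hs,
      ← Complex.ofReal_cpow (abs_nonneg w), ← Complex.ofReal_cos, ← Complex.ofReal_sin]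
    have hcos' : ((Real.cos (Real.pi * α / 2) : ℝ) : ℂ) ≠ 0 := Complex.ofReal_ne_zero.2 hcos
    generalize Real.cos (Real.pi * α / 2) = x at *
    generalize Real.sin (Real.pi * α / 2) = y at *
    push_cast
    field_simp
  rcases lt_or_gt_of_ne hw with h | h
  · exact key (-1) (Or.inr rfl) (by rw [abs_of_neg h]; ring) (Real.sign_of_neg h)
  · exact key 1 (Or.inl rfl) (by rw [abs_of_pos h]; ring) (Real.sign_of_pos h)

variable {Ω : Type*} {M L : ℕ} {P : Params M L} {X : Signals Ω M L}

variable (P X) in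
/-- A positive stable variable, built from the positions of the interferers. -/
noncomputable def stableVar (ω : Ω) : ℝ :=
  (P.lam * Real.pi * Real.Gamma (1 - 1 / P.b)) ^ (-P.b) * ∑' i, ‖X.pt i ω‖ ^ (-(2 * P.b))

variable [MeasurableSpace Ω] {μ : Measure Ω}

lemma IsNetwork.measurable_stableVar (hX : IsNetwork μ P X) : Measurable (stableVar P X) := by
  refine Measurable.const_mul ?_ _
  exact Measurable.tsum fun i => (hX.poisson.measurable i).norm.pow_const _

variable [IsProbabilityMeasure μ]

lemma Params.stable_scale_pos (P : Params M L) :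
    0 < P.lam * Real.pi * Real.Gamma (1 - 1 / P.b) := by
  have hb := P.one_lt_b
  have : 1 / P.b < 1 := by rw [div_lt_one (by linarith)]; exact hb
  have h1 := Real.Gamma_pos_of_pos (s := 1 - 1 / P.b) (by linarith)
  have h2 := P.lam_pos
  positivity

/-- Convergence of the series matters: a divergent `tsum` would have the value `0`. -/
lemma IsNetwork.ae_stableVar_pos (hX : IsNetwork μ P X) : ∀ᵐ ω ∂μ, 0 < stableVar P X ω := by
  filter_upwards [hX.poisson.ae_summable_rpow P.lam_pos.le (q := 2 * P.b)
    (by linarith [P.one_lt_b]), hX.poisson.ae_ne_zero] with ω h1 h2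
  refine mul_pos (Real.rpow_pos_of_pos P.stable_scale_pos _) ?_
  exact h1.tsum_pos (fun i => by positivity) 0
    (Real.rpow_pos_of_pos (norm_pos_iff.2 (h2 0)) _)

/-- The Laplace transform of the positive stable law. -/
lemma IsNetwork.integral_exp_neg_stableVar (hX : IsNetwork μ P X) {r : ℝ} (hr : 0 < r) :
    ∫ ω, Real.exp (-(r * stableVar P X ω)) ∂μ = Real.exp (-r ^ (1 / P.b)) := by
  have hb := P.one_lt_b
  have hb0 : 0 < P.b := by linarith
  have hα0 : 0 < 1 / P.b := by positivity
  have hα1 : 1 / P.b < 1 := by rw [div_lt_one hb0]; exact hb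
  have hscale := P.stable_scale_pos
  set c := (P.lam * Real.pi * Real.Gamma (1 - 1 / P.b)) ^ (-P.b) with hc
  have hc0 : 0 < c := Real.rpow_pos_of_pos hscale _
  -- The product of `f` over the points of a disc is the exponential of the corresponding partial
  -- sum, so the generating functional yields the Laplace transform.
  set f : Plane → ℂ := fun x => Real.exp (-(r * c * ‖x‖ ^ (-(2 * P.b)))) with hf
  have hfm : Measurable f := by fun_prop
  have hexp : ∀ x : Plane, Real.exp (-(r * c * ‖x‖ ^ (-(2 * P.b)))) ≤ 1 := fun x => by
    rw [Real.exp_le_one_iff, neg_nonpos]; positivity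
  have hf1 : ∀ x, ‖f x‖ ≤ 1 := fun x => by
    simp only [hf, Complex.norm_real, Real.norm_of_nonneg (Real.exp_pos _).le]
    exact hexp x
  have key := fun m : ℕ => hX.poisson.integral_finprod P.lam_pos.le
    (Metric.isClosed_closedBall (x := (0 : Plane)) (ε := (m : ℝ))).measurableSet
    measure_closedBall_lt_top.ne hfm hf1
  have hint : Integrable fun x => 1 - f x := by
    refine integrable_plane_of_bound (q := 2 * P.b) (C := 1 + r * c)
      (hfm.const_sub 1).aestronglyMeasurable (by linarith) (fun x => ?_) (fun x => ?_)
    all_goals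
      have h1 : 0 ≤ ‖x‖ ^ (-(2 * P.b)) := by positivity
      have h2 : ‖1 - f x‖ = 1 - Real.exp (-(r * c * ‖x‖ ^ (-(2 * P.b)))) := by
        simp only [hf]
        rw [← Complex.ofReal_one, ← Complex.ofReal_sub, Complex.norm_real,
          Real.norm_of_nonneg (sub_nonneg.2 (hexp x))]
      have h3 := Real.exp_pos (-(r * c * ‖x‖ ^ (-(2 * P.b))))
      have h4 := Real.add_one_le_exp (-(r * c * ‖x‖ ^ (-(2 * P.b))))
      have h5 : 0 < r * c := by positivity
      rw [h2]
    · linarith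
    · linarith
  have hval : P.lam * ∫ x, (1 - f x) = ((r ^ (1 / P.b) : ℝ) : ℂ) := by
    have h1 := integral_norm_rpow_neg_plane (fun t => 1 - Real.exp (-(r * c * t)))
      (q := 2 * P.b) (by linarith)
    have h2 : ∫ x, (1 - f x) =
        ((∫ x : Plane, (1 - Real.exp (-(r * c * ‖x‖ ^ (-(2 * P.b))))) : ℝ) : ℂ) := by
      rw [← integral_complex_ofReal]
      push_cast
      simp [hf]
    have h3 := integral_rpow_smul_comp_mul (fun t => 1 - Real.exp (-t)) hα0
      (show 0 < r * c by positivity)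
    simp only [smul_eq_mul] at h3
    rw [integral_rpow_mul_one_sub_exp_neg hα0 hα1] at h3
    have h4 : 2 / (2 * P.b) = 1 / P.b := by field_simp
    rw [h2, h1, h4]
    simp only [smul_eq_mul]
    rw [h3, ← Complex.ofReal_mul]
    congr 1
    -- The normalising constant of `stableVar` is chosen for this cancellation.
    have h5 : c ^ (1 / P.b) * (P.lam * Real.pi * Real.Gamma (1 - 1 / P.b)) = 1 := by
      rw [hc, ← Real.rpow_mul hscale.le, show -P.b * (1 / P.b) = -1 by field_simp,
        Real.rpow_neg_one, inv_mul_cancel₀ hscale.ne']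
    rw [Real.mul_rpow hr.le hc0.le]
    calc _ = r ^ (1 / P.b) * (c ^ (1 / P.b) * (P.lam * Real.pi * Real.Gamma (1 - 1 / P.b))) *
          ((1 / P.b) / (1 / P.b)) := by ring
      _ = _ := by rw [h5, div_self hα0.ne']; ring
  have lim1 : Tendsto (fun m : ℕ => ∫ x in Metric.closedBall (0 : Plane) m, (1 - f x)) atTop
      (𝓝 (∫ x, (1 - f x))) := by
    have := tendsto_setIntegral_of_monotone (μ := (volume : Measure Plane))
      (s := fun m : ℕ => Metric.closedBall (0 : Plane) m) (f := fun x => 1 - f x)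
      (fun m => Metric.isClosed_closedBall.measurableSet)
      (fun a b hab => Metric.closedBall_subset_closedBall (by exact_mod_cast hab)) hint.integrableOn
    rwa [Metric.iUnion_closedBall_nat, setIntegral_univ] at this
  have hprod : ∀ᵐ ω ∂μ, ∀ m n : ℕ, ballCount X m ω ≤ n → ∏ᶠ i,
      (1 - (Metric.closedBall (0 : Plane) m).indicator (fun x => 1 - f x) (X.pt i ω)) =
      ∏ i ∈ Finset.range n, (if ‖X.pt i ω‖ ≤ m then f (X.pt i ω) else 1) := by
    filter_upwards [hX.poisson.ordered, hX.poisson.ae_tendsto_norm P.lam_pos.le] with ω h1 h2 m n hn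
    rw [finprod_eq_prod_of_mulSupport_subset (s := Finset.range n)]
    · refine Finset.prod_congr rfl fun i _ => ?_
      by_cases hi : ‖X.pt i ω‖ ≤ m <;> simp [hi]
    · intro i hi
      by_contra hc
      refine hi ?_
      have h3 : ¬ ‖X.pt i ω‖ ≤ m := fun h => hc (by
        simpa using ((norm_le_iff_lt_ballCount h1 h2 m i).1 h).trans_le hn)
      simp [h3]
  have lim2 : Tendsto (fun m : ℕ => ∫ ω, ∏ᶠ i,
      (1 - (Metric.closedBall (0 : Plane) m).indicator (fun x => 1 - f x) (X.pt i ω)) ∂μ) atTop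
      (𝓝 (∫ ω, ((Real.exp (-(r * stableVar P X ω)) : ℝ) : ℂ) ∂μ)) := by
    refine tendsto_integral_of_dominated_convergence (fun _ => 1) (fun m => ?_)
      (integrable_const _) (fun m => ?_) ?_
    · refine aestronglyMeasurable_of_tendsto_ae atTop (f := fun n ω =>
        ∏ i ∈ Finset.range n, (if ‖X.pt i ω‖ ≤ m then f (X.pt i ω) else 1)) (fun n => ?_) ?_
      · refine (Finset.measurable_prod _ fun i _ => ?_).aestronglyMeasurable
        exact Measurable.ite (measurableSet_le (hX.poisson.measurable i).norm measurable_const)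
          (hfm.comp (hX.poisson.measurable i)) measurable_const
      · filter_upwards [hprod] with ω h1
        refine tendsto_const_nhds.congr' ?_
        filter_upwards [eventually_ge_atTop (ballCount X m ω)] with n hn using h1 m n hn
    · filter_upwards [hprod] with ω h1
      rw [h1 m _ le_rfl, norm_prod]
      refine Finset.prod_le_one (fun _ _ => norm_nonneg _) fun i _ => ?_
      split_ifs
      · exact hf1 _
      · simp
    · filter_upwards [hprod, hX.poisson.ordered, hX.poisson.ae_tendsto_norm P.lam_pos.le,
        hX.poisson.ae_summable_rpow P.lam_pos.le (q := 2 * P.b) (by linarith)] with ω h1 h2 h3 h4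
      have h5 : ∀ m : ℕ, ∏ᶠ i, (1 - (Metric.closedBall (0 : Plane) m).indicator
          (fun x => 1 - f x) (X.pt i ω)) = ((Real.exp (-(r * (c *
            ∑ i ∈ Finset.range (ballCount X m ω), ‖X.pt i ω‖ ^ (-(2 * P.b))))) : ℝ) : ℂ) := by
        intro m
        rw [h1 m _ le_rfl, ← mul_assoc, Finset.mul_sum, ← Finset.sum_neg_distrib, Real.exp_sum,
          Complex.ofReal_prod]
        refine Finset.prod_congr rfl fun i hi => ?_
        rw [if_pos ((norm_le_iff_lt_ballCount h2 h3 m i).2 (Finset.mem_range.1 hi))]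
      simp_rw [h5]
      have hcont : Continuous fun t : ℝ => ((Real.exp (-(r * (c * t))) : ℝ) : ℂ) := by fun_prop
      exact (hcont.tendsto _).comp (h4.hasSum.tendsto_sum_nat.comp (tendsto_ballCount h2 h3))
  simp_rw [key] at lim2
  have lim3 := (Complex.continuous_exp.tendsto _).comp ((lim1.const_mul (P.lam : ℂ)).neg)
  rw [hval] at lim3
  have := tendsto_nhds_unique lim2 lim3
  rw [integral_complex_ofReal] at this
  rw [← Complex.ofReal_neg, ← Complex.ofReal_exp] at this
  exact Complex.ofReal_injective this

end StableLaw

/-! ### The interference as a Gaussian variable with stable random variance. -/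

section GaussianMixture

lemma measurable_ofReal_add_mul_I :
    Measurable fun q : ℝ × ℝ => (q.1 : ℂ) + q.2 * Complex.I := by fun_prop

instance isProbabilityMeasure_complexGaussian (v : ℝ) :
    IsProbabilityMeasure (complexGaussian v) :=
  Measure.isProbabilityMeasure_map measurable_ofReal_add_mul_I.aemeasurable

lemma charFun_complexGaussian {v : ℝ} (hv : 0 ≤ v) (w : ℂ) :
    charFun (complexGaussian v) w = Complex.exp (-(v * ‖w‖ ^ 2 / 4 : ℝ)) := by
  rw [charFun_apply, complexGaussian, integral_map measurable_ofReal_add_mul_I.aemeasurable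
    (by fun_prop)]
  have h1 : ∀ q : ℝ × ℝ, Complex.exp (inner ℝ ((q.1 : ℂ) + q.2 * Complex.I) w * Complex.I) =
      Complex.exp ((inner ℝ q.1 w.re : ℝ) * Complex.I) *
        Complex.exp ((inner ℝ q.2 w.im : ℝ) * Complex.I) := fun q => by
    rw [← Complex.exp_add]
    congr 1
    rw [← add_mul]
    congr 1
    rw [Complex.inner]
    simp [Complex.mul_re]
  simp_rw [h1]
  rw [integral_prod_mul (fun x : ℝ => Complex.exp ((inner ℝ x w.re : ℝ) * Complex.I))
    (fun x : ℝ => Complex.exp ((inner ℝ x w.im : ℝ) * Complex.I)), ← charFun_apply,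
    ← charFun_apply, charFun_gaussianReal, charFun_gaussianReal, ← Complex.exp_add]
  congr 1
  rw [Complex.sq_norm, Complex.normSq_apply, Real.coe_toNNReal _ (by positivity)]
  push_cast
  ring

lemma charFun_gaussian_mixture (ν : Measure ℝ) [IsProbabilityMeasure ν] {v : ℝ} (hv : 0 ≤ v)
    {g : ℝ → ℝ} (hg : Measurable g) (w : ℂ) :
    charFun ((ν.prod (complexGaussian v)).map fun y : ℝ × ℂ => (g y.1 : ℂ) * y.2) w =
      ∫ B, Complex.exp (-(v * g B ^ 2 * ‖w‖ ^ 2 / 4 : ℝ)) ∂ν := by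
  have hm : Measurable fun y : ℝ × ℂ => (g y.1 : ℂ) * y.2 := by fun_prop
  rw [charFun_apply, integral_map hm.aemeasurable (by fun_prop), integral_prod]
  · congr 1 with B
    have h1 : ∀ z : ℂ, Complex.exp (inner ℝ ((g B : ℂ) * z) w * Complex.I) =
        Complex.exp (inner ℝ z ((g B : ℂ) * w) * Complex.I) := fun z => by
      congr 3
      simp only [Complex.inner, map_mul, Complex.conj_ofReal]
      ring_nf
    simp_rw [h1]
    rw [← charFun_apply, charFun_complexGaussian hv, norm_mul, Complex.norm_real, mul_pow,
      Real.norm_eq_abs, sq_abs]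
    congr 3
    ring
  · refine Integrable.of_bound (Measurable.aestronglyMeasurable (by fun_prop)) 1
      (ae_of_all _ fun y => ?_)
    rw [Complex.norm_exp_ofReal_mul_I]

variable {Ω : Type*} {M L : ℕ} {P : Params M L} {X : Signals Ω M L} [MeasurableSpace Ω]
  {μ : Measure Ω}

variable (P X μ) in
/-- The law of the stable variable `B`. -/
noncomputable def stableLaw : Measure ℝ := μ.map (stableVar P X)

/-- The sign is read off the integral representation, whose integrand is nonnegative, rather than
from those of the Gamma and cosine factors. -/
lemma stableConst_inv_nonneg {α : ℝ} (h0 : 0 < α) (h2 : α < 2) : 0 ≤ (stableConst α)⁻¹ := by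
  have h := integral_rpow_mul_one_sub_cos h0 h2
  have h1 : 0 ≤ ∫ t in Set.Ioi (0 : ℝ), t ^ (-α - 1) * (1 - Real.cos t) :=
    setIntegral_nonneg measurableSet_Ioi fun t (ht : 0 < t) =>
      mul_nonneg (Real.rpow_nonneg ht.le _) (by linarith [Real.cos_le_one t])
  rw [h] at h1
  have h3 := mul_nonneg h1 h0.le
  rwa [div_mul_cancel₀ _ h0.ne'] at h3

lemma Params.two_div_b_mem (P : Params M L) : 0 < 2 / P.b ∧ 2 / P.b < 2 := by
  have hb := P.one_lt_b
  exact ⟨by positivity, by rw [div_lt_iff₀ (by linarith)]; linarith⟩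

variable (P X μ) in
lemma VG_base_nonneg : 0 ≤ P.lam * Real.pi * (stableConst (2 / P.b))⁻¹ *
    ∫ ω, |(contribution P X 0 ω).re| ^ (2 / P.b) ∂μ := by
  have h1 := stableConst_inv_nonneg P.two_div_b_mem.1 P.two_div_b_mem.2
  have h2 := P.lam_pos
  have h3 : 0 ≤ ∫ ω, |(contribution P X 0 ω).re| ^ (2 / P.b) ∂μ :=
    integral_nonneg fun ω => by positivity
  positivity

variable (P X μ) in
lemma VG_nonneg : 0 ≤ VG P X μ := by
  have := VG_base_nonneg P X μ
  unfold VG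
  positivity

variable [IsProbabilityMeasure μ]

lemma IsNetwork.isProbabilityMeasure_stableLaw (hX : IsNetwork μ P X) :
    IsProbabilityMeasure (stableLaw P X μ) :=
  Measure.isProbabilityMeasure_map hX.measurable_stableVar.aemeasurable

lemma IsNetwork.ae_stableLaw_pos (hX : IsNetwork μ P X) : ∀ᵐ x ∂(stableLaw P X μ), 0 < x :=
  (ae_map_iff hX.measurable_stableVar.aemeasurable measurableSet_Ioi).2 hX.ae_stableVar_pos

lemma IsNetwork.integral_exp_neg_stableLaw (hX : IsNetwork μ P X) {r : ℝ} (hr : 0 < r) :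
    ∫ x, Real.exp (-(r * x)) ∂(stableLaw P X μ) = Real.exp (-r ^ (1 / P.b)) := by
  rw [stableLaw, integral_map hX.measurable_stableVar.aemeasurable
    (Measurable.aestronglyMeasurable (by fun_prop))]
  exact hX.integral_exp_neg_stableVar hr

lemma IsNetwork.isStableLaw_stableLaw (hX : IsNetwork μ P X) :
    IsStableLaw (stableLaw P X μ) (1 / P.b) 1 (Real.cos (Real.pi / (2 * P.b))) := by
  have := hX.isProbabilityMeasure_stableLaw
  have hb := P.one_lt_b
  have h := isStableLaw_of_laplace hX.ae_stableLaw_pos (α := 1 / P.b) (by positivity)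
    (by rw [div_lt_one (by linarith)]; exact hb) fun r hr => hX.integral_exp_neg_stableLaw hr
  rwa [show Real.pi * (1 / P.b) / 2 = Real.pi / (2 * P.b) by field_simp] at h

/-- The stable characteristic function is the Laplace transform of `B` at `r = V_G ‖w‖²/2`: the
power `b` in `VG` is undone by the exponent `1/b`. The case `r = 0` is separate, the Laplace formula
being known for `r > 0`. -/
lemma IsNetwork.charFun_interference_eq_integral (hX : IsNetwork μ P X) (w : ℂ) :
    charFun (μ.map (interference P X)) w =
      ((∫ B, Real.exp (-(VG P X μ * ‖w‖ ^ 2 / 2 * B)) ∂(stableLaw P X μ) : ℝ) : ℂ) := by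
  have hprob := hX.isProbabilityMeasure_stableLaw
  have hb := P.one_lt_b
  have hb0 : 0 < P.b := by linarith
  have hK := VG_base_nonneg P X μ
  have hV := VG_nonneg P X μ
  have hr : 0 ≤ VG P X μ * ‖w‖ ^ 2 / 2 := by positivity
  have hL : ∫ B, Real.exp (-(VG P X μ * ‖w‖ ^ 2 / 2 * B)) ∂(stableLaw P X μ) =
      Real.exp (-(VG P X μ * ‖w‖ ^ 2 / 2) ^ (1 / P.b)) := by
    rcases hr.eq_or_lt with h | h
    · rw [← h, Real.zero_rpow (by positivity)]; simp
    · exact hX.integral_exp_neg_stableLaw h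
  rw [hL, hX.charFun_map_interference, hX.integral_abs_re_mark_rpow, Complex.ofReal_exp]
  congr 2
  rw [← Complex.ofReal_neg]
  congr 2
  rw [VG]
  set I := ∫ ω, |(contribution P X 0 ω).re| ^ (2 / P.b) ∂μ
  set K := P.lam * Real.pi * (stableConst (2 / P.b))⁻¹ * I with hKdef
  rw [show 2 * Real.exp (2 * P.sigma ^ 2 / P.b) * K ^ P.b * ‖w‖ ^ 2 / 2 =
    Real.exp (2 * P.sigma ^ 2 / P.b) * K ^ P.b * ‖w‖ ^ 2 by ring,
    Real.mul_rpow (by positivity) (by positivity), Real.mul_rpow (by positivity) (by positivity),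
    ← Real.exp_mul, ← Real.rpow_mul hK, ← Real.rpow_natCast_mul (norm_nonneg w),
    mul_one_div_cancel hb0.ne', Real.rpow_one, hKdef]
  rw [show ((2 : ℕ) : ℝ) * (1 / P.b) = 2 / P.b by push_cast; ring,
    show (2 / P.b) ^ 2 * P.sigma ^ 2 / 2 = 2 * P.sigma ^ 2 / P.b * (1 / P.b) by field_simp]
  ring

/-- The interference is a Gaussian variable with a stable random variance. -/
lemma IsNetwork.map_interference (hX : IsNetwork μ P X) :
    μ.map (interference P X) = ((stableLaw P X μ).prod (complexGaussian (2 * VG P X μ))).map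
      (fun y : ℝ × ℂ => (Real.sqrt y.1 : ℂ) * y.2) := by
  have hprob := hX.isProbabilityMeasure_stableLaw
  have hV := VG_nonneg P X μ
  have hm : Measurable fun y : ℝ × ℂ => (Real.sqrt y.1 : ℂ) * y.2 := by fun_prop
  have h1 : IsProbabilityMeasure (μ.map (interference P X)) :=
    Measure.isProbabilityMeasure_map hX.measurable_interference.aemeasurable
  have h2 : IsProbabilityMeasure (((stableLaw P X μ).prod (complexGaussian (2 * VG P X μ))).map
      (fun y : ℝ × ℂ => (Real.sqrt y.1 : ℂ) * y.2)) := Measure.isProbabilityMeasure_map hm.aemeasurable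
  refine Measure.ext_of_charFun ?_
  ext w
  rw [charFun_gaussian_mixture _ (by positivity) (by fun_prop),
    hX.charFun_interference_eq_integral, ← integral_complex_ofReal]
  refine integral_congr_ae ?_
  filter_upwards [hX.ae_stableLaw_pos] with B hB
  rw [Real.sq_sqrt hB.le, ← Complex.ofReal_neg, Complex.ofReal_exp]
  congr 3
  ring

/-- The law of interference plus noise. -/
lemma IsNetwork.map_interference_add_noise (hX : IsNetwork μ P X) :
    μ.map (fun ω => interference P X ω + X.noise ω) =
      ((stableLaw P X μ).prod (complexGaussian 1)).map
        (fun y : ℝ × ℂ => (Real.sqrt (2 * y.1 * VG P X μ + P.N0) : ℂ) * y.2) := by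
  have hprob := hX.isProbabilityMeasure_stableLaw
  have hV := VG_nonneg P X μ
  have hN := P.N0_pos
  have hm : Measurable fun y : ℝ × ℂ =>
    (Real.sqrt (2 * y.1 * VG P X μ + P.N0) : ℂ) * y.2 := by fun_prop
  have hY := hX.measurable_interference
  have hW := hX.noise_meas
  have h1 : IsProbabilityMeasure (μ.map (fun ω => interference P X ω + X.noise ω)) :=
    Measure.isProbabilityMeasure_map (hY.add hW).aemeasurable
  have h2 : IsProbabilityMeasure (((stableLaw P X μ).prod (complexGaussian 1)).map
      (fun y : ℝ × ℂ => (Real.sqrt (2 * y.1 * VG P X μ + P.N0) : ℂ) * y.2)) :=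
    Measure.isProbabilityMeasure_map hm.aemeasurable
  have hind : IndepFun (interference P X) X.noise μ := by
    refine hX.indepFun (S := {.noise}ᶜ) (T := {.noise}) disjoint_compl_left
      (PoissonInterference.measurable_interference fun n x hx => ?_) (measurable_noise rfl)
    rintro rfl
    rcases hx with h | ⟨i, _, h⟩ <;> simp [Source.index] at h
  refine Measure.ext_of_charFun ?_
  have hadd := hind.charFun_map_fun_add_eq_mul hY.aemeasurable hW.aemeasurable
  rw [hadd]
  ext w
  have hmix := charFun_gaussian_mixture (stableLaw P X μ) zero_le_one
    (g := fun B => Real.sqrt (2 * B * VG P X μ + P.N0)) (by fun_prop) w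
  -- For fixed `B` the exponents, hence the variances `2 B V_G` and `N_0`, add up.
  rw [Pi.mul_apply, hX.noise_law, charFun_complexGaussian hN.le, hmix,
    hX.charFun_interference_eq_integral, ← integral_complex_ofReal, ← integral_mul_const]
  refine integral_congr_ae ?_
  filter_upwards [hX.ae_stableLaw_pos] with B hB
  rw [Real.sq_sqrt (by positivity), Complex.ofReal_exp, ← Complex.exp_add]
  congr 1
  push_cast
  ring

end GaussianMixture

/-! ### The standard complex Gaussian law in polar coordinates. -/

section PolarGaussian

lemma complexGaussian_one_apply {A : Set ℂ} (hA : MeasurableSet A) :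
    complexGaussian 1 A =
      ∫⁻ z, A.indicator (fun z => ENNReal.ofReal (Real.pi⁻¹ * Real.exp (-‖z‖ ^ 2))) z := by
  have hv : ((1 : ℝ) / 2).toNNReal ≠ 0 := by simp
  have hm : MeasurableSet ((fun q : ℝ × ℝ => (q.1 : ℂ) + q.2 * Complex.I) ⁻¹' A) :=
    measurable_ofReal_add_mul_I hA
  rw [complexGaussian, Measure.map_apply measurable_ofReal_add_mul_I hA,
    gaussianReal_of_var_ne_zero _ hv,
    prod_withDensity (measurable_gaussianPDF _ _) (measurable_gaussianPDF _ _),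
    withDensity_apply _ hm, ← lintegral_indicator hm,
    ← (Complex.volume_preserving_equiv_real_prod.symm).lintegral_comp_emb
      Complex.measurableEquivRealProd.symm.measurableEmbedding]
  refine lintegral_congr fun q => ?_
  have hq : Complex.measurableEquivRealProd.symm q = (q.1 : ℂ) + q.2 * Complex.I := by
    apply Complex.ext <;> simp [Complex.measurableEquivRealProd]
  rw [hq]
  by_cases h : (q.1 : ℂ) + q.2 * Complex.I ∈ A
  · rw [Set.indicator_of_mem h, Set.indicator_of_mem (by exact h)]
    rw [gaussianPDF, gaussianPDF, ← ENNReal.ofReal_mul (gaussianPDFReal_nonneg _ _ _)]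
    congr 1
    simp only [gaussianPDFReal, sub_zero, Real.coe_toNNReal _ (by norm_num : (0 : ℝ) ≤ 1 / 2)]
    have h1 : ‖(q.1 : ℂ) + q.2 * Complex.I‖ ^ 2 = q.1 ^ 2 + q.2 ^ 2 := by
      rw [Complex.sq_norm, Complex.normSq_add_mul_I]
    have h2 : (√(2 * Real.pi * (1 / 2)))⁻¹ * (√(2 * Real.pi * (1 / 2)))⁻¹ = Real.pi⁻¹ := by
      rw [← mul_inv, Real.mul_self_sqrt (by positivity)]
      congr 1; ring
    rw [h1, ← h2, mul_mul_mul_comm, ← Real.exp_add]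
    congr 2
    ring
  · rw [Set.indicator_of_notMem h, Set.indicator_of_notMem (by exact h)]

lemma lintegral_Ioi_gaussian_polar {c : ℝ} (hc : 0 ≤ c) :
    ∫⁻ r in Set.Ioi c, ENNReal.ofReal (r * (Real.pi⁻¹ * Real.exp (-r ^ 2))) =
      ENNReal.ofReal ((2 * Real.pi)⁻¹ * Real.exp (-c ^ 2)) := by
  have hd : ∀ x ∈ Set.Ici c, HasDerivAt (fun r : ℝ => -((2 * Real.pi)⁻¹ * Real.exp (-r ^ 2)))
      (x * (Real.pi⁻¹ * Real.exp (-x ^ 2))) x := fun x _ => by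
    have h := (((hasDerivAt_pow 2 x).neg.exp).const_mul (2 * Real.pi)⁻¹).neg
    convert! h using 1
    simp
    field_simp
  have hpos : ∀ x ∈ Set.Ioi c, 0 ≤ x * (Real.pi⁻¹ * Real.exp (-x ^ 2)) := fun x hx => by
    have : 0 ≤ x := hc.trans (Set.mem_Ioi.1 hx).le
    positivity
  have hlim : Tendsto (fun r : ℝ => -((2 * Real.pi)⁻¹ * Real.exp (-r ^ 2))) atTop (𝓝 0) := by
    have h1 : Tendsto (fun r : ℝ => Real.exp (-r ^ 2)) atTop (𝓝 0) :=
      Real.tendsto_exp_atBot.comp (tendsto_neg_atTop_atBot.comp (tendsto_pow_atTop two_ne_zero))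
    simpa using (h1.const_mul (2 * Real.pi)⁻¹).neg
  rw [← ofReal_integral_eq_lintegral_ofReal
    (integrableOn_Ioi_deriv_of_nonneg' hd hpos hlim)
    (ae_restrict_of_forall_mem measurableSet_Ioi hpos),
    integral_Ioi_of_hasDerivAt_of_nonneg' hd hpos hlim]
  simp

/-- The standard complex Gaussian measure of a set which every ray from the origin, of direction
`θ ∈ S`, enters at distance `ρ θ`. -/
lemma complexGaussian_real_of_rays {A : Set ℂ} (hA : MeasurableSet A) {S : Set ℝ}
    (hS : MeasurableSet S) (hSπ : S ⊆ Set.Ioo (-Real.pi) Real.pi) {ρ : ℝ → ℝ} (hρ : Measurable ρ)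
    (hρ0 : ∀ θ ∈ S, 0 ≤ ρ θ)
    (h : ∀ r : ℝ, 0 < r → ∀ θ ∈ Set.Ioo (-Real.pi) Real.pi,
      (r : ℂ) * (Real.cos θ + Real.sin θ * Complex.I) ∈ A ↔ θ ∈ S ∧ ρ θ < r) :
    (complexGaussian 1).real A = (2 * Real.pi)⁻¹ * ∫ θ in S, Real.exp (-ρ θ ^ 2) := by
  have hnn : ∀ θ, 0 ≤ (2 * Real.pi)⁻¹ * Real.exp (-ρ θ ^ 2) := fun θ => by positivity
  have key : complexGaussian 1 A =
      ∫⁻ θ in S, ENNReal.ofReal ((2 * Real.pi)⁻¹ * Real.exp (-ρ θ ^ 2)) := by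
    rw [complexGaussian_one_apply hA, ← Complex.lintegral_comp_polarCoord_symm,
      show polarCoord.target = Set.Ioi (0 : ℝ) ×ˢ Set.Ioo (-Real.pi) Real.pi from rfl,
      ← lintegral_indicator (measurableSet_Ioi.prod measurableSet_Ioo)]
    have hT : MeasurableSet {p : ℝ × ℝ | p.2 ∈ S ∧ ρ p.2 < p.1} :=
      (measurable_snd hS).inter (measurableSet_lt (hρ.comp measurable_snd) measurable_fst)
    have hcong : ∀ p : ℝ × ℝ, (Set.Ioi (0 : ℝ) ×ˢ Set.Ioo (-Real.pi) Real.pi).indicator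
        (fun p => ENNReal.ofReal p.1 • A.indicator
          (fun z => ENNReal.ofReal (Real.pi⁻¹ * Real.exp (-‖z‖ ^ 2)))
          (Complex.polarCoord.symm p)) p =
        {p : ℝ × ℝ | p.2 ∈ S ∧ ρ p.2 < p.1}.indicator
          (fun p => ENNReal.ofReal (p.1 * (Real.pi⁻¹ * Real.exp (-p.1 ^ 2)))) p := by
      rintro ⟨r, θ⟩
      by_cases hp : (r, θ) ∈ Set.Ioi (0 : ℝ) ×ˢ Set.Ioo (-Real.pi) Real.pi
      · rw [Set.indicator_of_mem hp]
        have hr : 0 < r := hp.1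
        have hiff := h r hp.1 θ hp.2
        simp only [Complex.polarCoord_symm_apply]
        by_cases hmem : θ ∈ S ∧ ρ θ < r
        · rw [Set.indicator_of_mem (hiff.2 hmem), Set.indicator_of_mem (by exact hmem), smul_eq_mul,
            ← ENNReal.ofReal_mul hr.le]
          congr 4
          rw [norm_mul, Complex.norm_real, Complex.norm_def, Complex.normSq_add_mul_I,
            Real.cos_sq_add_sin_sq, Real.sqrt_one, mul_one, Real.norm_eq_abs, sq_abs]
        · rw [Set.indicator_of_notMem (fun hh => hmem (hiff.1 hh)),
            Set.indicator_of_notMem (by exact hmem), smul_zero]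
      · rw [Set.indicator_of_notMem hp, Set.indicator_of_notMem]
        rintro ⟨h1, h2⟩
        exact hp ⟨(hρ0 _ h1).trans_lt h2, hSπ h1⟩
    simp_rw [hcong]
    -- Integrating over the radius first: on the ray of direction `θ ∈ S` the part beyond `ρ θ` has
    -- mass `exp(-ρ²)/(2π)`.
    rw [Measure.volume_eq_prod, lintegral_prod_symm' _ ((by fun_prop : Measurable _).indicator hT),
      ← lintegral_indicator hS]
    refine lintegral_congr fun θ => ?_
    by_cases hθ : θ ∈ S
    · rw [Set.indicator_of_mem hθ, ← lintegral_Ioi_gaussian_polar (hρ0 θ hθ),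
        ← lintegral_indicator measurableSet_Ioi]
      refine lintegral_congr fun r => ?_
      simp [Set.indicator, hθ]
    · rw [Set.indicator_of_notMem hθ]
      simp [Set.indicator, hθ]
  have hint : ∫ θ in S, (2 * Real.pi)⁻¹ * Real.exp (-ρ θ ^ 2) =
      (∫⁻ θ in S, ENNReal.ofReal ((2 * Real.pi)⁻¹ * Real.exp (-ρ θ ^ 2))).toReal :=
    integral_eq_lintegral_of_nonneg_ae (ae_of_all _ hnn)
      (Measurable.aestronglyMeasurable (by fun_prop))
  rw [← integral_const_mul, hint, ← key, Measure.real]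

lemma map_const_mul_complexGaussian {v : ℝ} (hv : 0 ≤ v) {c : ℂ} (hc : ‖c‖ = 1) :
    (complexGaussian v).map (fun z => c * z) = complexGaussian v := by
  have : IsProbabilityMeasure ((complexGaussian v).map (fun z => c * z)) :=
    Measure.isProbabilityMeasure_map (by fun_prop)
  refine Measure.ext_of_charFun (funext fun w => ?_)
  rw [charFun_complexGaussian hv, charFun_apply, integral_map (by fun_prop) (by fun_prop)]
  have h1 : ∀ z : ℂ, inner ℝ (c * z) w = inner ℝ z ((starRingEnd ℂ) c * w) := fun z => by
    simp only [Complex.inner, map_mul]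
    ring_nf
  simp_rw [h1]
  rw [← charFun_apply, charFun_complexGaussian hv, norm_mul, RCLike.norm_conj, hc, one_mul]

lemma complexGaussian_real_preimage_mul {c : ℂ} (hc : ‖c‖ = 1) {A : Set ℂ}
    (hA : MeasurableSet A) :
    (complexGaussian 1).real ((fun z => c * z) ⁻¹' A) = (complexGaussian 1).real A := by
  conv_rhs => rw [← map_const_mul_complexGaussian zero_le_one hc]
  rw [map_measureReal_apply (by fun_prop) hA]

lemma complexGaussian_re_eq (c : ℝ) : complexGaussian 1 {z | z.re = c} = 0 := by
  have hm : MeasurableSet {z : ℂ | z.re = c} :=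
    Complex.measurable_re (measurableSet_singleton c)
  rw [complexGaussian, Measure.map_apply measurable_ofReal_add_mul_I hm]
  have : (fun q : ℝ × ℝ => (q.1 : ℂ) + q.2 * Complex.I) ⁻¹' {z | z.re = c} =
      {c} ×ˢ Set.univ := by
    ext q; simp
  have hv : ((1 : ℝ) / 2).toNNReal ≠ 0 := by simp
  have := nullSingletonClass_gaussianReal (μ := 0) hv
  rw [‹_ ⁻¹' _ = _›, Measure.prod_prod, measure_singleton, zero_mul]

/-- A rotation makes the line vertical, and a real Gaussian has no atoms. This disposes of ties and
of overlaps between neighbouring sectors. -/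
lemma complexGaussian_line {a : ℂ} (ha : a ≠ 0) (c : ℝ) :
    complexGaussian 1 {z | (z * (starRingEnd ℂ) a).re = c} = 0 := by
  have hn : ‖a‖ ≠ 0 := norm_ne_zero_iff.2 ha
  have hu : ‖(starRingEnd ℂ) a / ‖a‖‖ = 1 := by
    rw [norm_div, RCLike.norm_conj, Complex.norm_real, norm_norm, div_self hn]
  have h : {z : ℂ | (z * (starRingEnd ℂ) a).re = c} =
      (fun z => ((starRingEnd ℂ) a / ‖a‖) * z) ⁻¹' {z | z.re = c / ‖a‖} := by
    ext z
    have : ((starRingEnd ℂ) a / ‖a‖ * z).re = (z * (starRingEnd ℂ) a).re / ‖a‖ := by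
      rw [← Complex.div_ofReal_re]; congr 1; ring
    simp only [Set.mem_preimage, Set.mem_ofPred_eq, this]
    rw [div_left_inj' hn]
  have hm : MeasurableSet {z : ℂ | z.re = c / ‖a‖} :=
    Complex.measurable_re (measurableSet_singleton _)
  rw [h, ← Measure.map_apply (by fun_prop) hm,
    map_const_mul_complexGaussian zero_le_one hu, complexGaussian_re_eq]

end PolarGaussian

/-! ### Decision regions: which edge a ray crosses, and the resulting error probability. -/

section Geometry

variable {M : ℕ} {s : Fin M → ℂ}

/-- Dividing by `d` moves the second point to `1`, and the bisector of `0` and `1` is the line of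
real part `1/2`. -/
lemma norm_le_norm_sub_iff {y d : ℂ} (hd : d ≠ 0) : ‖y‖ ≤ ‖y - d‖ ↔ (y / d).re ≤ 1 / 2 := by
  have hn : 0 < Complex.normSq d := Complex.normSq_pos.2 hd
  rw [← sq_le_sq₀ (norm_nonneg _) (norm_nonneg _), Complex.sq_norm, Complex.sq_norm,
    Complex.normSq_sub, Complex.div_re, ← add_div, div_le_iff₀ hn]
  simp only [Complex.mul_re, Complex.conj_re, Complex.conj_im]
  constructor <;> intro h <;> linarith

lemma norm_sub_le_norm_iff {y d : ℂ} (hd : d ≠ 0) : ‖y - d‖ ≤ ‖y‖ ↔ 1 / 2 ≤ (y / d).re := by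
  have hn : 0 < Complex.normSq d := Complex.normSq_pos.2 hd
  rw [← sq_le_sq₀ (norm_nonneg _) (norm_nonneg _), Complex.sq_norm, Complex.sq_norm,
    Complex.normSq_sub, Complex.div_re, ← add_div, le_div_iff₀ hn]
  simp only [Complex.mul_re, Complex.conj_re, Complex.conj_im]
  constructor <;> intro h <;> linarith

lemma sub_ne_zero_of_injective (hs : Function.Injective s) {j k : Fin M} (h : j ≠ k) :
    s j - s k ≠ 0 := sub_ne_zero.2 fun h' => h (hs h')

lemma mem_decisionRegion_iff (hs : Function.Injective s) (k : Fin M) (y : ℂ) :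
    s k + y ∈ decisionRegion s k ↔ ∀ j ≠ k, (y / (s j - s k)).re ≤ 1 / 2 := by
  simp only [decisionRegion, Set.mem_ofPred_eq]
  refine forall_congr' fun j => ?_
  rcases eq_or_ne j k with rfl | hj
  · simp
  · rw [← norm_le_norm_sub_iff (sub_ne_zero_of_injective hs hj)]
    simp [hj, show s k + y - s j = y - (s j - s k) by ring]

lemma mem_commonEdge_iff (hs : Function.Injective s) {k l : Fin M} (hl : l ≠ k) (y : ℂ) :
    s k + y ∈ commonEdge s k l ↔
      (y / (s l - s k)).re = 1 / 2 ∧ ∀ j ≠ k, (y / (s j - s k)).re ≤ 1 / 2 := by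
  have hd := sub_ne_zero_of_injective hs hl
  rw [commonEdge, Set.mem_inter_iff, mem_decisionRegion_iff hs]
  constructor
  · rintro ⟨h1, h2⟩
    refine ⟨le_antisymm (h1 l hl) ?_, h1⟩
    rw [← norm_sub_le_norm_iff hd]
    simpa [show s k + y - s l = y - (s l - s k) by ring] using h2 k
  · rintro ⟨h1, h2⟩
    refine ⟨h2, fun j => ?_⟩
    have h3 : ‖s k + y - s l‖ ≤ ‖s k + y - s k‖ := by
      rw [show s k + y - s l = y - (s l - s k) by ring, add_sub_cancel_left,
        norm_sub_le_norm_iff hd, h1]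
    exact h3.trans ((mem_decisionRegion_iff hs k y).2 h2 j)

variable (s) in
/-- Directions, seen from `s k` and measured from the direction of `s l`, in which a ray leaves the
decision region of `s k` through its common edge with that of `s l`. -/
def exitAngles (k l : Fin M) : Set ℝ :=
  {θ | θ ∈ Set.Ioo (-(Real.pi / 2)) (Real.pi / 2) ∧ ∀ j ≠ k,
    Real.cos θ * ((s l - s k) / (s j - s k)).re - Real.sin θ * ((s l - s k) / (s j - s k)).im ≤
      Real.cos θ}

variable (s) in
-- Each condition is linear in `(cos θ, sin θ)`, so the directions form a convex cone. Two of them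
-- differ by less than `π`, and an intermediate direction is a nonnegative combination of both, with
-- weights `sin(y-θ)` and `sin(θ-x)`.
lemma exitAngles_ordConnected (k l : Fin M) : (exitAngles s k l).OrdConnected := by
  refine ⟨fun x hx y hy θ hθ => ⟨⟨hx.1.1.trans_le hθ.1, hθ.2.trans_lt hy.1.2⟩, fun j hj => ?_⟩⟩
  rcases (hθ.1.trans hθ.2).eq_or_lt with hxy | hxy
  · rw [le_antisymm (hxy ▸ hθ.2) hθ.1]
    exact hx.2 j hj
  have h1 := hx.2 j hj
  have h2 := hy.2 j hj
  set a := ((s l - s k) / (s j - s k)).re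
  set b := ((s l - s k) / (s j - s k)).im
  have hlt : y - x < Real.pi := by linarith [hx.1.1, hy.1.2]
  have p0 : 0 < Real.sin (y - x) := Real.sin_pos_of_pos_of_lt_pi (by linarith) hlt
  have p1 : 0 ≤ Real.sin (y - θ) := Real.sin_nonneg_of_nonneg_of_le_pi (by linarith [hθ.2])
    (by linarith [hθ.1])
  have p2 : 0 ≤ Real.sin (θ - x) := Real.sin_nonneg_of_nonneg_of_le_pi (by linarith [hθ.1])
    (by linarith [hθ.2])
  have key : Real.sin (y - x) * (Real.cos θ - (Real.cos θ * a - Real.sin θ * b)) =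
      Real.sin (y - θ) * (Real.cos x - (Real.cos x * a - Real.sin x * b)) +
      Real.sin (θ - x) * (Real.cos y - (Real.cos y * a - Real.sin y * b)) := by
    simp only [Real.sin_sub]
    ring
  have h3 : 0 ≤ Real.sin (y - x) * (Real.cos θ - (Real.cos θ * a - Real.sin θ * b)) := by
    rw [key]
    exact add_nonneg (mul_nonneg p1 (by linarith)) (mul_nonneg p2 (by linarith))
  linarith [nonneg_of_mul_nonneg_right h3 p0]

/-- In the coordinate `(z - s_k)/(s_l - s_k)` the edge lies on the line of real part `1/2`, whose
point of argument `θ` is `e^(iθ)/(2 cos θ)`. For that point, the conditions of belonging to the edge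
become those of `exitAngles`. -/
lemma edgeAngles_eq_image (hs : Function.Injective s) {k l : Fin M} (hl : l ≠ k) :
    edgeAngles s k l = (fun θ => θ + Real.pi / 2) '' exitAngles s k l := by
  have hd := sub_ne_zero_of_injective hs hl
  have hquot : ∀ (j : Fin M) (x : ℂ), (x * (s l - s k) / (s j - s k)).re =
      x.re * ((s l - s k) / (s j - s k)).re - x.im * ((s l - s k) / (s j - s k)).im := fun j x => by
    rw [mul_div_assoc, Complex.mul_re]
  apply Set.Subset.antisymm
  · rintro _ ⟨z, hz, rfl⟩
    refine ⟨_, ?_, rfl⟩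
    rw [show z = s k + (z - s k) by ring, mem_commonEdge_iff hs hl] at hz
    obtain ⟨h1, h2⟩ := hz
    set x := (z - s k) / (s l - s k) with hx
    have hzx : z - s k = x * (s l - s k) := by rw [hx, div_mul_cancel₀ _ hd]
    have hx0 : 0 < ‖x‖ := norm_pos_iff.2 fun h => by rw [h] at h1; norm_num at h1
    have hre : Real.cos x.arg * ‖x‖ = 1 / 2 := by rw [mul_comm, Complex.norm_mul_cos_arg, h1]
    have him : Real.sin x.arg * ‖x‖ = x.im := by rw [mul_comm, Complex.norm_mul_sin_arg]
    refine ⟨?_, fun j hj => ?_⟩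
    · rw [Set.mem_Ioo, ← abs_lt, Complex.abs_arg_lt_pi_div_two_iff, h1]
      left; norm_num
    · have h3 := h2 j hj
      rw [hzx, hquot, h1, ← hre, ← him] at h3
      refine le_of_mul_le_mul_right ?_ hx0
      linarith
  · rintro _ ⟨θ, hθ, rfl⟩
    have hc : 0 < Real.cos θ := Real.cos_pos_of_mem_Ioo hθ.1
    set x : ℂ := (((2 * Real.cos θ)⁻¹ : ℝ) : ℂ) * (Complex.cos θ + Complex.sin θ * Complex.I)
      with hx
    have hre : x.re = 1 / 2 := by
      rw [hx, Complex.re_ofReal_mul, Complex.add_re, Complex.mul_I_re, ← Complex.ofReal_sin,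
        ← Complex.ofReal_cos, Complex.ofReal_re, Complex.ofReal_im]
      field_simp
      ring
    have him : x.im = (2 * Real.cos θ)⁻¹ * Real.sin θ := by
      rw [hx, Complex.im_ofReal_mul, Complex.add_im, Complex.mul_I_im, ← Complex.ofReal_sin,
        ← Complex.ofReal_cos, Complex.ofReal_re, Complex.ofReal_im, zero_add]
    refine ⟨s k + x * (s l - s k), (mem_commonEdge_iff hs hl _).2 ⟨?_, fun j hj => ?_⟩, ?_⟩
    · rw [mul_div_cancel_right₀ _ hd, hre]
    · rw [hquot, hre, him]
      have h3 := hθ.2 j hj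
      have h4 : (2 * Real.cos θ)⁻¹ * Real.cos θ = 1 / 2 := by field_simp
      have h5 := mul_le_mul_of_nonneg_left h3 (inv_nonneg.2 (by positivity : 0 ≤ 2 * Real.cos θ))
      rw [mul_sub, ← mul_assoc, h4] at h5
      linarith
    · simp only [add_sub_cancel_left]
      rw [mul_div_cancel_right₀ _ hd, hx, Complex.arg_mul_cos_add_sin_mul_I (by positivity)]
      exact ⟨by linarith [hθ.1.1, Real.pi_pos], by linarith [hθ.1.2, Real.pi_pos]⟩

/-- The shift by `π/2` turns the cosine into a sine; an order-connected bounded set differs from the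
interval between its infimum and supremum by at most the end points. -/
lemma setIntegral_exitAngles (hs : Function.Injective s) {k l : Fin M} (hl : l ≠ k) (f : ℝ → ℝ) :
    ∫ θ in exitAngles s k l, f (Real.cos θ) =
      ∫ τ in (0 : ℝ)..phiPar s k l, f (Real.sin (τ + psiPar s k l)) := by
  have h1 := (measurePreserving_add_right volume (Real.pi / 2)).setIntegral_image_emb
    (measurableEmbedding_addRight _) (fun τ => f (Real.sin τ)) (exitAngles s k l)
  simp_rw [Real.sin_add_pi_div_two] at h1
  rw [← h1, ← edgeAngles_eq_image hs hl, intervalIntegral.integral_comp_add_right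
    (fun τ => f (Real.sin τ)), zero_add, phiPar, psiPar, sub_add_cancel]
  have hoc : (edgeAngles s k l).OrdConnected := by
    rw [edgeAngles_eq_image hs hl]
    have := exitAngles_ordConnected s k l
    exact ((this.isPreconnected).image _ (by fun_prop)).ordConnected
  have hsub : edgeAngles s k l ⊆ Set.Ioo 0 Real.pi := by
    rw [edgeAngles_eq_image hs hl]
    rintro _ ⟨θ, hθ, rfl⟩
    exact ⟨by simp only; linarith [hθ.1.1], by simp only; linarith [hθ.1.2]⟩
  generalize edgeAngles s k l = E at hoc hsub
  rcases E.eq_empty_or_nonempty with rfl | hne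
  · simp
  have hb : BddBelow E := bddBelow_Ioo.mono hsub
  have ha : BddAbove E := bddAbove_Ioo.mono hsub
  have hle : sInf E ≤ sSup E := csInf_le_csSup hne hb ha
  rw [intervalIntegral.integral_of_le hle]
  refine setIntegral_congr_set ?_
  have hc : IsConnected E := ⟨hne, hoc.isPreconnected⟩
  have h2 : Set.Ioo (sInf E) (sSup E) ≤ᵐ[volume] E :=
    (hc.Ioo_csInf_csSup_subset hb ha).eventuallyLE
  have h3 : E ≤ᵐ[volume] Set.Icc (sInf E) (sSup E) := (subset_Icc_csInf_csSup hb ha).eventuallyLE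
  exact (h3.trans Ioc_ae_eq_Icc.symm.le).antisymm (Ioo_ae_eq_Ioc.symm.le.trans h2)

/-- An edge reduced to at most one point is seen under at most one angle. -/
lemma setIntegral_exitAngles_of_notMem_neighbors (hs : Function.Injective s) {k l : Fin M}
    (hl : l ≠ k) (h : l ∉ neighbors s k) (f : ℝ → ℝ) :
    ∫ θ in exitAngles s k l, f θ = 0 := by
  have h1 : (commonEdge s k l).Subsingleton := by
    rw [← Set.not_nontrivial_iff]
    simpa [neighbors, hl] using h
  have h2 : ((fun θ => θ + Real.pi / 2) '' exitAngles s k l).Subsingleton := by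
    rw [← edgeAngles_eq_image hs hl]
    exact h1.image _
  have h3 : (exitAngles s k l).Subsingleton :=
    Set.subsingleton_of_image (add_left_injective _) _ h2
  exact setIntegral_measure_zero _ (h3.measure_zero volume)

variable (s) in
/-- Error probability when `s k` is sent and received in standard Gaussian noise of amplitude `t`. -/
noncomputable def symbolError (k : Fin M) (t : ℝ) : ℝ :=
  (complexGaussian 1).real {z | s k + t * z ∉ decisionRegion s k}

/-- Points that leave the decision region of `s k` through the edge shared with `s l`. -/
def exitSet (s : Fin M → ℂ) (k l : Fin M) (t : ℝ) : Set ℂ :=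
  {z | 1 < 2 * t * (z / (s l - s k)).re ∧
    ∀ j ≠ k, 2 * t * (z / (s j - s k)).re ≤ 2 * t * (z / (s l - s k)).re}

lemma measurableSet_exitSet (k l : Fin M) (t : ℝ) : MeasurableSet (exitSet s k l t) := by
  have h : exitSet s k l t = {z | 1 < 2 * t * (z / (s l - s k)).re} ∩ ⋂ j, ⋂ (_ : j ≠ k),
      {z | 2 * t * (z / (s j - s k)).re ≤ 2 * t * (z / (s l - s k)).re} := by
    ext z; simp [exitSet]
  rw [h]
  exact (measurableSet_lt (by fun_prop) (by fun_prop)).inter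
    (MeasurableSet.iInter fun j => MeasurableSet.iInter fun _ =>
      measurableSet_le (by fun_prop) (by fun_prop))

/-- Rotate so that `s_l` is seen in the direction of the positive reals. A ray crosses the bisector
of `s_l` at distance `‖s_k - s_l‖/(2 t cos θ)`, and whether it crosses that bisector first depends
on the direction alone. -/
lemma real_exitSet (hs : Function.Injective s) {k l : Fin M} (hl : l ≠ k) {t : ℝ} (ht : 0 < t) :
    (complexGaussian 1).real (exitSet s k l t) = (2 * Real.pi)⁻¹ *
      ∫ θ in exitAngles s k l, Real.exp (-(‖s k - s l‖ / (2 * t * Real.cos θ)) ^ 2) := by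
  have hd := sub_ne_zero_of_injective hs hl
  have hn : 0 < ‖s l - s k‖ := norm_pos_iff.2 hd
  have hu : ‖(s l - s k) / ‖s l - s k‖‖ = 1 := by
    rw [norm_div, Complex.norm_real, norm_norm, div_self hn.ne']
  rw [← complexGaussian_real_preimage_mul hu (measurableSet_exitSet k l t), norm_sub_rev (s k)]
  refine complexGaussian_real_of_rays ((measurableSet_exitSet k l t).preimage (by fun_prop))
    (exitAngles_ordConnected s k l).measurableSet
    (fun θ hθ => ⟨by linarith [hθ.1.1, Real.pi_pos], by linarith [hθ.1.2, Real.pi_pos]⟩)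
    (by fun_prop) (fun θ hθ => ?_) fun r hr θ hθ => ?_
  · have := Real.cos_pos_of_mem_Ioo hθ.1
    positivity
  have hquot : ∀ j : Fin M, ((s l - s k) / ‖s l - s k‖ *
      (r * (Real.cos θ + Real.sin θ * Complex.I)) / (s j - s k)).re = r / ‖s l - s k‖ *
      (Real.cos θ * ((s l - s k) / (s j - s k)).re -
        Real.sin θ * ((s l - s k) / (s j - s k)).im) := fun j => by
    rw [show (s l - s k) / ‖s l - s k‖ * (r * (Real.cos θ + Real.sin θ * Complex.I)) /
      (s j - s k) = ((r / ‖s l - s k‖ : ℝ) : ℂ) *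
        ((Real.cos θ + Real.sin θ * Complex.I) * ((s l - s k) / (s j - s k))) by
        push_cast; ring, Complex.re_ofReal_mul, Complex.mul_re]
    simp only [Complex.add_re, Complex.add_im, Complex.mul_I_re, Complex.mul_I_im,
      Complex.ofReal_re, Complex.ofReal_im, neg_zero, add_zero, zero_add]
  have hl1 : Real.cos θ * ((s l - s k) / (s l - s k)).re -
      Real.sin θ * ((s l - s k) / (s l - s k)).im = Real.cos θ := by
    rw [div_self hd]; simp
  simp only [Set.mem_preimage, exitSet, exitAngles, Set.mem_ofPred_eq, hquot, hl1]
  have hpos : 0 < 2 * t * (r / ‖s l - s k‖) := by positivity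
  have h2 : (∀ j ≠ k, 2 * t * (r / ‖s l - s k‖ * (Real.cos θ * ((s l - s k) / (s j - s k)).re -
        Real.sin θ * ((s l - s k) / (s j - s k)).im)) ≤
        2 * t * (r / ‖s l - s k‖ * Real.cos θ)) ↔
      ∀ j ≠ k, Real.cos θ * ((s l - s k) / (s j - s k)).re -
        Real.sin θ * ((s l - s k) / (s j - s k)).im ≤ Real.cos θ := by
    refine forall₂_congr fun j hj => ?_
    rw [← mul_assoc, ← mul_assoc (2 * t), mul_le_mul_iff_right₀ hpos]
  rw [h2]
  have h3 : 1 < 2 * t * (r / ‖s l - s k‖ * Real.cos θ) ↔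
      θ ∈ Set.Ioo (-(Real.pi / 2)) (Real.pi / 2) ∧ ‖s l - s k‖ / (2 * t * Real.cos θ) < r := by
    constructor
    · intro h
      have hc : 0 < Real.cos θ := by
        by_contra! hc
        have : 2 * t * (r / ‖s l - s k‖ * Real.cos θ) ≤ 0 := by
          rw [← mul_assoc]
          exact mul_nonpos_of_nonneg_of_nonpos hpos.le hc
        linarith
      refine ⟨?_, ?_⟩
      · by_contra hout
        rw [Set.mem_Ioo, not_and_or, not_lt, not_lt] at hout
        rcases hout with hout | hout
        · have := Real.cos_nonpos_of_pi_div_two_le_of_le (x := -θ) (by linarith)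
            (by linarith [hθ.1, Real.pi_pos])
          rw [Real.cos_neg] at this
          linarith
        · have := Real.cos_nonpos_of_pi_div_two_le_of_le hout (by linarith [hθ.2, Real.pi_pos])
          linarith
      · rw [div_lt_iff₀ (by positivity)]
        rw [show 2 * t * (r / ‖s l - s k‖ * Real.cos θ) = r * (2 * t * Real.cos θ) / ‖s l - s k‖ by
          ring, lt_div_iff₀ hn] at h
        linarith
    · rintro ⟨h, h'⟩
      have hc := Real.cos_pos_of_mem_Ioo h
      rw [div_lt_iff₀ (by positivity)] at h'
      rw [show 2 * t * (r / ‖s l - s k‖ * Real.cos θ) = r * (2 * t * Real.cos θ) / ‖s l - s k‖ by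
          ring, lt_div_iff₀ hn]
      linarith
  rw [h3]
  tauto

/-- The symbol error probability in Gaussian noise, as a sum over the edges of the decision
region. -/
lemma symbolError_eq_sum (hs : Function.Injective s) (k : Fin M) {t : ℝ} (ht : 0 < t) :
    symbolError s k t = ∑ l ∈ neighbors s k, 1 / (2 * Real.pi) *
      ∫ τ in (0 : ℝ)..phiPar s k l,
        Real.exp (-(‖s k - s l‖ / (2 * t * Real.sin (τ + psiPar s k l))) ^ 2) := by
  classical
  -- A point outside the region is assigned to an `l` that maximises `Re(z/(s_l - s_k))`: the
  -- bisector which the ray through `z` meets first.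
  have hunion : {z : ℂ | s k + t * z ∉ decisionRegion s k} =
      ⋃ l ∈ Finset.univ.filter (· ≠ k), exitSet s k l t := by
    ext z
    have hre : ∀ j : Fin M, (t * z / (s j - s k)).re = t * (z / (s j - s k)).re := fun j => by
      rw [mul_div_assoc, Complex.re_ofReal_mul]
    simp only [Set.mem_ofPred_eq, mem_decisionRegion_iff hs, Set.mem_iUnion, Finset.mem_filter,
      Finset.mem_univ, true_and, exists_prop, hre, exitSet]
    push Not
    constructor
    · rintro ⟨j, hj, h⟩
      obtain ⟨l, hl, hmax⟩ := (Finset.univ.filter (· ≠ k)).exists_max_image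
        (fun j => 2 * t * (z / (s j - s k)).re) ⟨j, by simpa using hj⟩
      refine ⟨l, by simpa using hl, ?_, fun i hi => hmax i (by simpa using hi)⟩
      have := hmax j (by simpa using hj)
      linarith
    · rintro ⟨l, hl, h, _⟩
      exact ⟨l, hl, by linarith⟩
  -- On an overlap two such real parts coincide, which confines `z` to a line.
  have hdisj : ((Finset.univ.filter (· ≠ k) : Finset (Fin M)) : Set (Fin M)).Pairwise
      (Function.onFun (AEDisjoint (complexGaussian 1)) fun l => exitSet s k l t) := by
    intro l hl l' hl' hne
    simp only [Finset.coe_filter, Finset.mem_univ, true_and, Set.mem_ofPred_eq] at hl hl'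
    have hd := sub_ne_zero_of_injective hs hl
    have hd' := sub_ne_zero_of_injective hs hl'
    have ha : (starRingEnd ℂ) ((s l - s k)⁻¹ - (s l' - s k)⁻¹) ≠ 0 := by
      rw [map_ne_zero, sub_ne_zero]
      intro h
      exact hne (hs (sub_left_injective (inv_injective h)))
    refine measure_mono_null ?_ (complexGaussian_line ha 0)
    rintro z ⟨⟨_, h1⟩, ⟨_, h2⟩⟩
    have h3 := le_antisymm (h1 l' hl') (h2 l hl)
    have h4 := mul_left_cancel₀ (by positivity : 2 * t ≠ 0) h3
    simp only [Complex.conj_conj, Set.mem_ofPred_eq, mul_sub, Complex.sub_re, ← div_eq_mul_inv]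
    linarith
  rw [symbolError, hunion, measureReal_biUnion_finset₀ hdisj fun l _ =>
    (measurableSet_exitSet k l t).nullMeasurableSet]
  have hsub : neighbors s k ⊆ Finset.univ.filter (· ≠ k) := fun l hl => by
    simp only [neighbors, Finset.mem_filter] at hl
    simpa using hl.2.1
  rw [← Finset.sum_subset hsub]
  · refine Finset.sum_congr rfl fun l hl => ?_
    have hlk : l ≠ k := by simpa using hsub hl
    rw [real_exitSet hs hlk ht, one_div, setIntegral_exitAngles hs hlk
      fun c => Real.exp (-(‖s k - s l‖ / (2 * t * c)) ^ 2)]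
  · intro l hl hl'
    have hlk : l ≠ k := by simpa using hl
    rw [real_exitSet hs hlk ht, setIntegral_exitAngles_of_notMem_neighbors hs hlk hl', mul_zero]

/-- Law of cosines. A symbol at `0` is no exception: its arbitrary argument is multiplied by its
modulus. -/
lemma wPar_mul_avgEnergy {p : Fin M → ℝ} (hE : 0 < avgEnergy s p) (k l : Fin M) :
    wPar s p k l * avgEnergy s p = ‖s k - s l‖ ^ 2 := by
  have h1 : Real.sqrt (zeta s p k * zeta s p l) = ‖s k‖ * ‖s l‖ / avgEnergy s p := by
    rw [zeta, zeta, div_mul_div_comm, ← mul_pow, ← sq, ← div_pow]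
    exact Real.sqrt_sq (by positivity)
  rw [wPar, h1, zeta, zeta, Real.cos_sub]
  have h2 : ‖s k - s l‖ ^ 2 = ‖s k‖ ^ 2 + ‖s l‖ ^ 2 -
      2 * ((s k).re * (s l).re + (s k).im * (s l).im) := by
    rw [Complex.sq_norm, Complex.sq_norm, Complex.sq_norm, Complex.normSq_sub]
    simp [Complex.mul_re]
  rw [h2, ← Complex.norm_mul_cos_arg (s k), ← Complex.norm_mul_cos_arg (s l),
    ← Complex.norm_mul_sin_arg (s k), ← Complex.norm_mul_sin_arg (s l)]
  field_simp

end Geometry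

/-! ### Averaging over Rayleigh fading. -/

section Rayleigh

lemma measurable_unitRayleigh_density : Measurable
    (fun x : ℝ => ENNReal.ofReal (if 0 ≤ x then 2 * x * Real.exp (-x ^ 2) else 0)) :=
  ENNReal.measurable_ofReal.comp (Measurable.ite measurableSet_Ici (by fun_prop) measurable_const)

lemma ae_unitRayleigh_pos : ∀ᵐ x ∂unitRayleigh, 0 < x := by
  rw [unitRayleigh, ae_withDensity_iff measurable_unitRayleigh_density]
  refine ae_of_all _ fun x hx => ?_
  by_contra! h
  apply hx
  rcases h.eq_or_lt with rfl | h
  · simp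
  · simp [h.not_ge]

lemma lintegral_exp_neg_unitRayleigh {C : ℝ} (hC : 0 ≤ C) :
    ∫⁻ x, ENNReal.ofReal (Real.exp (-(C * x ^ 2))) ∂unitRayleigh = ENNReal.ofReal (1 + C)⁻¹ := by
  have hC1 : 0 < 1 + C := by linarith
  rw [unitRayleigh, lintegral_withDensity_eq_lintegral_mul _ measurable_unitRayleigh_density
    (by fun_prop)]
  have h1 : ∀ x : ℝ, ((fun x : ℝ => ENNReal.ofReal
      (if 0 ≤ x then 2 * x * Real.exp (-x ^ 2) else 0)) *
      fun x => ENNReal.ofReal (Real.exp (-(C * x ^ 2)))) x = (Set.Ioi (0 : ℝ)).indicator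
        (fun x => ENNReal.ofReal (2 * x * Real.exp (-((1 + C) * x ^ 2)))) x := fun x => by
    rw [Pi.mul_apply]
    rcases lt_trichotomy x 0 with h | rfl | h
    · rw [Set.indicator_of_notMem (by simpa using h.le), if_neg (by simpa using h)]
      simp
    · simp
    · rw [Set.indicator_of_mem (by simpa using h), if_pos h.le,
        ← ENNReal.ofReal_mul (by positivity), mul_assoc, ← Real.exp_add]
      congr 3
      ring
  simp_rw [h1]
  rw [lintegral_indicator measurableSet_Ioi]
  have hd : ∀ x ∈ Set.Ici (0 : ℝ), HasDerivAt
      (fun r : ℝ => -((1 + C)⁻¹ * Real.exp (-((1 + C) * r ^ 2))))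
      (2 * x * Real.exp (-((1 + C) * x ^ 2))) x := fun x _ => by
    have h := ((((hasDerivAt_pow 2 x).const_mul (1 + C)).neg.exp).const_mul (1 + C)⁻¹).neg
    convert! h using 1
    simp
    field_simp
  have hpos : ∀ x ∈ Set.Ioi (0 : ℝ), 0 ≤ 2 * x * Real.exp (-((1 + C) * x ^ 2)) := fun x hx => by
    have : 0 < x := hx
    positivity
  have hlim : Tendsto (fun r : ℝ => -((1 + C)⁻¹ * Real.exp (-((1 + C) * r ^ 2)))) atTop
      (𝓝 0) := by
    have h1 : Tendsto (fun r : ℝ => Real.exp (-((1 + C) * r ^ 2))) atTop (𝓝 0) :=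
      Real.tendsto_exp_atBot.comp (tendsto_neg_atTop_atBot.comp
        ((tendsto_pow_atTop two_ne_zero).const_mul_atTop hC1))
    simpa using (h1.const_mul (1 + C)⁻¹).neg
  rw [← ofReal_integral_eq_lintegral_ofReal
    (integrableOn_Ioi_deriv_of_nonneg' hd hpos hlim)
    (ae_restrict_of_forall_mem measurableSet_Ioi hpos),
    integral_Ioi_of_hasDerivAt_of_nonneg' hd hpos hlim]
  simp

instance isProbabilityMeasure_unitRayleigh : IsProbabilityMeasure unitRayleigh :=
  ⟨by simpa using lintegral_exp_neg_unitRayleigh le_rfl⟩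

lemma integral_exp_neg_unitRayleigh {C : ℝ} (hC : 0 ≤ C) :
    ∫ x, Real.exp (-(C * x ^ 2)) ∂unitRayleigh = (1 + C)⁻¹ := by
  rw [integral_eq_lintegral_of_nonneg_ae (ae_of_all _ fun x => (Real.exp_pos _).le)
    (Measurable.aestronglyMeasurable (by fun_prop)), lintegral_exp_neg_unitRayleigh hC,
    ENNReal.toReal_ofReal (by positivity)]

/-- Averaging of a Gaussian tail over Rayleigh fading and a random noise level. -/
lemma integral_fading_average {ν : Measure ℝ} [IsProbabilityMeasure ν] {v : ℝ → ℝ}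
    (hv : Measurable v) (hv0 : ∀ᵐ B ∂ν, 0 ≤ v B) {f : ℝ → ℝ} (hf : Measurable f) (a κ : ℝ) {φ : ℝ}
    (hφ : 0 ≤ φ) :
    ∫ y : ℝ × ℝ, (∫ τ in (0 : ℝ)..φ,
        Real.exp (-(a / (Real.sqrt (v y.2) / (κ * y.1) * f τ)) ^ 2)) ∂(unitRayleigh.prod ν) =
      ∫ τ in (0 : ℝ)..φ, ∫ B, (1 + a ^ 2 / f τ ^ 2 * (κ ^ 2 / v B))⁻¹ ∂ν := by
  simp_rw [intervalIntegral.integral_of_le hφ]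
  rw [integral_integral_swap]
  · refine integral_congr_ae (ae_of_all _ fun τ => ?_)
    simp only
    rw [integral_prod_symm]
    · refine integral_congr_ae ?_
      filter_upwards [hv0] with B hB
      rw [← integral_exp_neg_unitRayleigh (by positivity)]
      refine integral_congr_ae (ae_of_all _ fun α => ?_)
      simp only
      congr 2
      -- Zero denominators need no separate treatment: with `x/0 = 0`, this identity of exponents
      -- holds there too.
      rw [div_mul_eq_mul_div, div_div_eq_mul_div, div_pow, mul_pow, mul_pow, mul_pow, Real.sq_sqrt hB,
        div_mul_div_comm, div_mul_eq_mul_div, mul_comm (v B)]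
      ring
    · refine Integrable.of_bound (Measurable.aestronglyMeasurable (by fun_prop)) 1
        (ae_of_all _ fun y => ?_)
      rw [Real.norm_eq_abs, Real.abs_exp, Real.exp_le_one_iff]
      simp only [Left.neg_nonpos_iff]
      positivity
  · refine Integrable.of_bound (Measurable.aestronglyMeasurable ?_) 1
        (ae_of_all _ fun y => ?_)
    · unfold Function.uncurry
      fun_prop
    · rw [Function.uncurry, Real.norm_eq_abs, Real.abs_exp, Real.exp_le_one_iff]
      simp only [Left.neg_nonpos_iff]
      positivity

end Rayleigh

/-! ### Conditioning on an independent variable, and the effect of ties. -/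

section ConditionalProbability

/-- By independence the conditional distribution of `U` given `G` is the constant kernel, so `G` can
be frozen. -/
lemma condExp_of_indepFun {Ω α β : Type*} [MeasurableSpace Ω] [MeasurableSpace α]
    [MeasurableSpace β] [StandardBorelSpace β] [Nonempty β] {μ : Measure Ω} [IsProbabilityMeasure μ]
    {G : Ω → α} {U : Ω → β} (hG : Measurable G) (hU : Measurable U) (hind : IndepFun G U μ)
    {E : Set (α × β)} (hE : MeasurableSet E) :
    μ⟦{ω | (G ω, U ω) ∈ E} | MeasurableSpace.comap G inferInstance⟧ =ᵐ[μ]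
      fun ω => (μ.map U).real {u | (G ω, u) ∈ E} := by
  have hpU : IsProbabilityMeasure (μ.map U) := Measure.isProbabilityMeasure_map hU.aemeasurable
  have hpG : IsProbabilityMeasure (μ.map G) := Measure.isProbabilityMeasure_map hG.aemeasurable
  have h1 := condDistrib_ae_eq_of_measure_eq_compProd (μ := μ) (Y := U) G hU.aemeasurable
    (κ := Kernel.const α (μ.map U)) (by
      rw [Measure.compProd_const]
      exact (indepFun_iff_map_prod_eq_prod_map_map hG.aemeasurable hU.aemeasurable).1 hind)
  have h2 := condExp_prod_ae_eq_integral_condDistrib (μ := μ) hG hU.aemeasurable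
    (f := E.indicator fun _ => (1 : ℝ)) (stronglyMeasurable_const.indicator hE)
    (Integrable.of_bound (Measurable.aestronglyMeasurable
      ((measurable_const.indicator hE).comp (hG.prodMk hU))) 1
      (ae_of_all _ fun ω => by
        by_cases h : (G ω, U ω) ∈ E <;> simp [h]))
  filter_upwards [h2, ae_of_ae_map hG.aemeasurable h1] with ω hω hω'
  refine hω.trans ?_
  rw [hω', Kernel.const_apply]
  have hm : MeasurableSet {u | (G ω, u) ∈ E} := measurable_prodMk_left hE
  exact integral_indicator_one hm

variable {M : ℕ} {s : Fin M → ℂ}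

lemma measurableSet_decisionRegion (k : Fin M) : MeasurableSet (decisionRegion s k) := by
  have h : decisionRegion s k = ⋂ j, {z | ‖z - s k‖ ≤ ‖z - s j‖} := by
    ext z; simp [decisionRegion]
  rw [h]
  exact MeasurableSet.iInter fun j => measurableSet_le (by fun_prop) (by fun_prop)

variable (s) in
lemma measurable_symbolError (k : Fin M) : Measurable (symbolError s k) := by
  have hm : MeasurableSet {p : ℝ × ℂ | s k + p.1 * p.2 ∉ decisionRegion s k} :=
    (show Measurable fun p : ℝ × ℂ => s k + p.1 * p.2 by fun_prop)
      (measurableSet_decisionRegion k).compl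
  exact (measurable_measure_prodMk_left (ν := complexGaussian 1) hm).ennreal_toReal

lemma symbolError_mem_Icc (k : Fin M) (t : ℝ) : symbolError s k t ∈ Set.Icc (0 : ℝ) 1 :=
  ⟨measureReal_nonneg, measureReal_le_one⟩

/-- Whatever the rule for ties, the detector errs with the probability of the complement of the
decision region. -/
lemma IsMinDistDetector.real_error (hs : Function.Injective s) {det : ℝ → ℂ → Fin M}
    (hdet : IsMinDistDetector s det) {h a : ℝ} (hh : 0 < h) (ha : 0 < a) (k : Fin M) :
    (complexGaussian 1).real {z | det h (h * s k + a * z) ≠ k} = symbolError s k (a / h) := by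
  have hhC : (h : ℂ) ≠ 0 := by exact_mod_cast hh.ne'
  have hnorm : ∀ (j : Fin M) (z : ℂ), ‖h * s k + a * z - h * s j‖ =
      h * ‖s k + (a / h : ℝ) * z - s j‖ := fun j z => by
    rw [show (h : ℂ) * s k + a * z - h * s j = h * (s k + (a / h : ℝ) * z - s j) by
      push_cast; field_simp, norm_mul, Complex.norm_real, Real.norm_of_nonneg hh.le]
  have hnear : ∀ z l, ‖s k + (a / h : ℝ) * z - s (det h (h * s k + a * z))‖ ≤
      ‖s k + (a / h : ℝ) * z - s l‖ := fun z l => by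
    have := hdet.nearest h (h * s k + a * z) l
    rwa [hnorm, hnorm, mul_le_mul_iff_right₀ hh] at this
  refine measureReal_congr ?_
  -- Rescaled by the gain, the detector chooses a nearest symbol. It can disagree with the decision
  -- region only on the finitely many bisectors of `s_k`, which are null.
  have hnull : ∀ᵐ z ∂(complexGaussian 1), ∀ l, l ≠ k →
      (z * (starRingEnd ℂ) ((starRingEnd ℂ) (s l - s k)⁻¹)).re ≠ 1 / (2 * (a / h)) := by
    rw [ae_all_iff]
    intro l
    by_cases hl : l = k
    · simp [hl]
    have hne : (starRingEnd ℂ) (s l - s k)⁻¹ ≠ 0 := by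
      rw [map_ne_zero]
      exact inv_ne_zero (sub_ne_zero_of_injective hs hl)
    refine (measure_eq_zero_iff_ae_notMem.1 (complexGaussian_line hne (1 / (2 * (a / h))))).mono
      fun z hz _ => hz
  filter_upwards [hnull] with z hz
  refine propext ⟨fun hne hmem => ?_, fun hmem heq => ?_⟩
  · have hne' : det h (h * s k + a * z) ≠ k := hne
    refine hz _ hne' ?_
    have hd := sub_ne_zero_of_injective hs hne'
    have h1 := hmem (det h (h * s k + a * z))
    have h2 := hnear z k
    rw [add_sub_cancel_left] at h1 h2
    rw [show ∀ j, s k + (a / h : ℝ) * z - s j = (a / h : ℝ) * z - (s j - s k) from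
      fun j => by ring] at h1 h2
    rw [norm_le_norm_sub_iff hd] at h1
    rw [norm_sub_le_norm_iff hd] at h2
    have h3 := le_antisymm h1 h2
    rw [mul_div_assoc, Complex.re_ofReal_mul] at h3
    rw [Complex.conj_conj, ← div_eq_mul_inv, eq_div_iff (by positivity)]
    linarith
  · have heq' : det h (h * s k + a * z) = k := heq
    refine hmem fun l => ?_
    have := hnear z l
    rwa [heq'] at this

end ConditionalProbability

/-! ### The conditional error probability as an average over fading and the stable variable. -/

section ErrorProbability

variable {Ω : Type*} {M L : ℕ} {P : Params M L} {X : Signals Ω M L} {det : ℝ → ℂ → Fin M}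

variable (P) in
/-- Gain of the probe link without fading, when the shadowing variable is `g`. -/
noncomputable def linkGain (g : ℝ) : ℝ := P.k * Real.exp (P.sigma * g) / P.r0 ^ P.b

variable (P) in
lemma linkGain_pos (g : ℝ) : 0 < linkGain P g :=
  div_pos (mul_pos P.k_pos (Real.exp_pos _)) (Real.rpow_pos_of_pos P.r0_pos _)

variable (P) in
lemma measurable_linkGain : Measurable (linkGain P) := by
  unfold linkGain; fun_prop

variable (P det) in
/-- Shadowing, symbol, fading amplitude, and interference plus noise that lead to an error. -/
def errorSet : Set (ℝ × Fin M × ℝ × ℂ) :=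
  {x | det (linkGain P x.1 * x.2.2.1) (↑(linkGain P x.1 * x.2.2.1) * P.s x.2.1 + x.2.2.2) ≠ x.2.1}

lemma measurableSet_errorSet (hdet : IsMinDistDetector P.s det) :
    MeasurableSet (errorSet P det) := by
  have hs : Measurable fun x : ℝ × Fin M × ℝ × ℂ => P.s x.2.1 :=
    (measurable_of_finite P.s).comp (by fun_prop)
  have hg : Measurable fun x : ℝ × Fin M × ℝ × ℂ => linkGain P x.1 * x.2.2.1 :=
    ((measurable_linkGain P).comp measurable_fst).mul (by fun_prop)
  have hz : Measurable fun x : ℝ × Fin M × ℝ × ℂ =>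
      (↑(linkGain P x.1 * x.2.2.1) * P.s x.2.1 + x.2.2.2 : ℂ) :=
    ((Complex.measurable_ofReal.comp hg).mul hs).add (by fun_prop)
  have hd := hdet.measurable.comp (hg.prodMk hz)
  exact (measurableSet_eq_fun hd (show Measurable fun x : ℝ × Fin M × ℝ × ℂ => x.2.1 by
    fun_prop)).compl

variable (P X) in
/-- Interference plus noise. -/
noncomputable def disturbance (ω : Ω) : ℂ := interference P X ω + X.noise ω

lemma errorEvent_eq (ω : Ω) : ω ∈ errorEvent P X det ↔
    (X.shadow0 ω, X.sym0 ω, X.fade0 ω, disturbance P X ω) ∈ errorSet P det := by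
  have h : gain P X ω = linkGain P (X.shadow0 ω) * X.fade0 ω := by
    rw [gain, linkGain]; ring
  simp only [errorEvent, errorSet, Set.mem_ofPred_eq, received, disturbance, h, add_assoc]

/-- Meant for the three sources of the probe link: interference and noise together use no such
source. -/
lemma measurable_disturbance {x : Source} (h1 : x.index = none) (h2 : x ≠ .points)
    (h3 : x ≠ .noise) : Measurable[X.sigmaOf {x}ᶜ] (disturbance P X) := by
  have hY : Measurable[X.sigmaOf {x}ᶜ] (interference P X) := by
    refine measurable_interference ?_
    rintro n y (hy | ⟨i, _, hy⟩) rfl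
    · exact h2 hy
    · simp [h1] at hy
  have hW : Measurable[X.sigmaOf {x}ᶜ] X.noise := measurable_noise (by simpa using h3.symm)
  exact hY.add hW

variable [MeasurableSpace Ω] {μ : Measure Ω}

lemma IsNetwork.indepFun_shadow0 (hX : IsNetwork μ P X) :
    IndepFun X.shadow0 (fun ω => (X.sym0 ω, X.fade0 ω, disturbance P X ω)) μ := by
  refine hX.indepFun (S := {.shadow0}) (T := {.shadow0}ᶜ) disjoint_compl_right
    (measurable_shadow0 rfl) ?_
  have h1 : Measurable[X.sigmaOf {.shadow0}ᶜ] X.sym0 := measurable_sym0 (by simp)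
  have h2 : Measurable[X.sigmaOf {.shadow0}ᶜ] X.fade0 := measurable_fade0 (by simp)
  have h3 : Measurable[X.sigmaOf {.shadow0}ᶜ] (disturbance P X) :=
    measurable_disturbance rfl (by simp) (by simp)
  exact h1.prodMk (h2.prodMk h3)

lemma IsNetwork.indepFun_sym0 (hX : IsNetwork μ P X) :
    IndepFun X.sym0 (fun ω => (X.fade0 ω, disturbance P X ω)) μ := by
  refine hX.indepFun (S := {.sym0}) (T := {.sym0}ᶜ) disjoint_compl_right (measurable_sym0 rfl) ?_
  have h2 : Measurable[X.sigmaOf {.sym0}ᶜ] X.fade0 := measurable_fade0 (by simp)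
  have h3 : Measurable[X.sigmaOf {.sym0}ᶜ] (disturbance P X) :=
    measurable_disturbance rfl (by simp) (by simp)
  exact h2.prodMk h3

lemma IsNetwork.indepFun_fade0 (hX : IsNetwork μ P X) :
    IndepFun X.fade0 (disturbance P X) μ :=
  hX.indepFun (S := {.fade0}) (T := {.fade0}ᶜ) disjoint_compl_right (measurable_fade0 rfl)
    (measurable_disturbance rfl (by simp) (by simp))

lemma IsNetwork.measurable_disturbance (hX : IsNetwork μ P X) : Measurable (disturbance P X) :=
  Measurable.add hX.measurable_interference hX.noise_meas

variable [IsProbabilityMeasure μ]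

lemma IsNetwork.map_sym_fade_disturbance (hX : IsNetwork μ P X) :
    μ.map (fun ω => (X.sym0 ω, X.fade0 ω, disturbance P X ω)) =
      (μ.map X.sym0).prod (unitRayleigh.prod (μ.map (disturbance P X))) := by
  have hN := hX.measurable_disturbance
  rw [← hX.fade0_law, ← (indepFun_iff_map_prod_eq_prod_map_map hX.fade0_meas.aemeasurable
    hN.aemeasurable).1 hX.indepFun_fade0]
  exact (indepFun_iff_map_prod_eq_prod_map_map hX.sym0_meas.aemeasurable
    (hX.fade0_meas.prodMk hN).aemeasurable).1 hX.indepFun_sym0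

/-- Error probability for given shadowing, as an average over the fading and the stable variable. -/
lemma IsNetwork.real_errorSet (hX : IsNetwork μ P X) (hdet : IsMinDistDetector P.s det) (g : ℝ) :
    (μ.map (fun ω => (X.sym0 ω, X.fade0 ω, disturbance P X ω))).real
        {u | (g, u) ∈ errorSet P det} =
      ∫ y, ∑ k, P.p k * symbolError P.s k (Real.sqrt (2 * y.2 * VG P X μ + P.N0) /
        (linkGain P g * y.1)) ∂(unitRayleigh.prod (stableLaw P X μ)) := by
  have hν := hX.isProbabilityMeasure_stableLaw
  have hV := VG_nonneg P X μ
  have hN0 := P.N0_pos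
  have hN := hX.measurable_disturbance
  have hpN : IsProbabilityMeasure (μ.map (disturbance P X)) :=
    Measure.isProbabilityMeasure_map hN.aemeasurable
  have hpS : IsProbabilityMeasure (μ.map X.sym0) :=
    Measure.isProbabilityMeasure_map hX.sym0_meas.aemeasurable
  have hm : MeasurableSet {u | (g, u) ∈ errorSet P det} :=
    measurable_prodMk_left (measurableSet_errorSet hdet)
  have hmk : ∀ k, MeasurableSet {u | (g, k, u) ∈ errorSet P det} := fun k =>
    measurable_prodMk_left hm
  have hmka : ∀ k α, MeasurableSet {n | (g, k, α, n) ∈ errorSet P det} := fun k α =>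
    measurable_prodMk_left (hmk k)
  have hint : ∀ (γ : Type) [MeasurableSpace γ] (ρ : Measure γ) [IsFiniteMeasure ρ] (A : Set γ),
      MeasurableSet A → Integrable (A.indicator (1 : γ → ℝ)) ρ := fun γ _ ρ _ A hA =>
    (integrable_const (1 : ℝ)).indicator hA
  have hprod : ∀ (γ δ : Type) [MeasurableSpace γ] [MeasurableSpace δ] (ρ : Measure γ)
      (ρ' : Measure δ) [IsFiniteMeasure ρ] [IsFiniteMeasure ρ'] (A : Set (γ × δ)),
      MeasurableSet A → (ρ.prod ρ').real A = ∫ x, ρ'.real {y | (x, y) ∈ A} ∂ρ := by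
    intro γ δ _ _ ρ ρ' _ _ A hA
    rw [← integral_indicator_one hA, integral_prod _ (hint _ _ _ hA)]
    refine integral_congr_ae (ae_of_all _ fun x => ?_)
    exact integral_indicator_one (measurable_prodMk_left hA)
  have hmeas : ∀ k, Measurable fun y : ℝ × ℝ => symbolError P.s k
      (Real.sqrt (2 * y.2 * VG P X μ + P.N0) / (linkGain P g * y.1)) := fun k =>
    (measurable_symbolError P.s k).comp (by fun_prop)
  have hinteg : ∀ k, Integrable (fun y : ℝ × ℝ => symbolError P.s k
      (Real.sqrt (2 * y.2 * VG P X μ + P.N0) / (linkGain P g * y.1)))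
      (unitRayleigh.prod (stableLaw P X μ)) := fun k =>
    Integrable.of_bound (hmeas k).aestronglyMeasurable 1 (ae_of_all _ fun y => by
      rw [Real.norm_of_nonneg (symbolError_mem_Icc k _).1]
      exact (symbolError_mem_Icc k _).2)
  rw [hX.map_sym_fade_disturbance, hprod _ _ _ _ _ hm, integral_fintype (Integrable.of_finite),
    integral_finsetSum _ fun k _ => (hinteg k).const_mul _]
  refine Finset.sum_congr rfl fun k _ => ?_
  rw [integral_const_mul, smul_eq_mul]
  congr 1
  · rw [map_measureReal_apply hX.sym0_meas (measurableSet_singleton k), Measure.real,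
      show X.sym0 ⁻¹' {k} = {ω | X.sym0 ω = k} from rfl, hX.sym0_law,
      ENNReal.toReal_ofReal (P.p_nonneg k)]
  · have hk := hprod _ _ unitRayleigh (μ.map (disturbance P X)) _ (hmk k)
    simp only [Set.mem_ofPred_eq] at hk ⊢
    rw [hk, integral_prod _ (hinteg k)]
    refine integral_congr_ae ?_
    filter_upwards [ae_unitRayleigh_pos] with α hα
    have hmap : Measurable fun y : ℝ × ℂ =>
      (Real.sqrt (2 * y.1 * VG P X μ + P.N0) : ℂ) * y.2 := by fun_prop
    -- The mixture representation fixes `B`, and leaves a Gaussian noise of amplitude `√(2 B V_G +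
    -- N_0)` against the gain `linkGain P g * α`.
    rw [show μ.map (disturbance P X) = _ from hX.map_interference_add_noise]
    rw [map_measureReal_apply hmap (hmka k α), hprod _ _ _ _ _ (hmap (hmka k α))]
    refine integral_congr_ae ?_
    filter_upwards [hX.ae_stableLaw_pos] with B hB
    have hv : 0 < 2 * B * VG P X μ + P.N0 := by positivity
    exact hdet.real_error P.s_injective (mul_pos (linkGain_pos P g) hα) (Real.sqrt_pos.2 hv) k

/-- The conditional error probability given the shadowing of the probe link. -/
lemma IsNetwork.condExp_errorEvent (hX : IsNetwork μ P X) (hdet : IsMinDistDetector P.s det) :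
    μ⟦errorEvent P X det | MeasurableSpace.comap X.shadow0 inferInstance⟧ =ᵐ[μ]
      fun ω => ∫ y, ∑ k, P.p k * symbolError P.s k (Real.sqrt (2 * y.2 * VG P X μ + P.N0) /
        (linkGain P (X.shadow0 ω) * y.1)) ∂(unitRayleigh.prod (stableLaw P X μ)) := by
  have hne : Nonempty (Fin M) := by
    by_contra h
    rw [not_nonempty_iff] at h
    simpa using P.p_sum
  have hU := hX.sym0_meas.prodMk
    (hX.fade0_meas.prodMk hX.measurable_disturbance)
  have h := condExp_of_indepFun hX.shadow0_meas hU hX.indepFun_shadow0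
    (measurableSet_errorSet hdet)
  have hset : {ω | (X.shadow0 ω, X.sym0 ω, X.fade0 ω, disturbance P X ω) ∈
      errorSet P det} = errorEvent P X det := Set.ext fun ω => (errorEvent_eq ω).symm
  rw [← hset]
  refine h.trans (ae_of_all _ fun ω => hX.real_errorSet hdet (X.shadow0 ω))

variable (P X μ) in
-- Identifies the constants: with `a² = w` times the mean energy, squared gain over noise level
-- times `a²` is `w` times `eta`.
lemma average_term (hX : IsNetwork μ P X) {w : ℝ} {f : ℝ → ℝ} (hf : Measurable f) {φ : ℝ}
    (hφ : 0 ≤ φ) {a : ℝ} (ha : a ^ 2 = w * avgEnergy P.s P.p) (g : ℝ) :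
    ∫ y : ℝ × ℝ, (∫ τ in (0 : ℝ)..φ, Real.exp (-(a / (Real.sqrt (2 * y.2 * VG P X μ + P.N0) /
        (linkGain P g * y.1) * f τ)) ^ 2)) ∂(unitRayleigh.prod (stableLaw P X μ)) =
      ∫ τ in (0 : ℝ)..φ, ∫ B, (1 + w / f τ ^ 2 * eta P (VG P X μ) g B)⁻¹
        ∂(stableLaw P X μ) := by
  have hν := hX.isProbabilityMeasure_stableLaw
  have hV := VG_nonneg P X μ
  have hN0 := P.N0_pos
  rw [integral_fading_average (v := fun B => 2 * B * VG P X μ + P.N0) (by fun_prop) ?_ hf _ _ hφ]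
  · refine intervalIntegral.integral_congr fun τ _ => integral_congr_ae (ae_of_all _ fun B => ?_)
    simp only
    congr 2
    rw [eta, E0, linkGain, ha, div_pow, mul_pow, ← Real.exp_nat_mul, ← Real.rpow_mul_natCast P.r0_pos.le,
      div_div, div_mul_div_comm, div_mul_div_comm]
    congr 1
    · push_cast; ring_nf
    · push_cast; ring_nf
  · filter_upwards [hX.ae_stableLaw_pos] with B hB
    positivity

end ErrorProbability

/-! ### Transfer from Gaussian noise to the network, and the general constellation. -/

section ErrorFormula

variable {Ω : Type*} {M L : ℕ} {P : Params M L} {X : Signals Ω M L} {det : ℝ → ℂ → Fin M}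
  [MeasurableSpace Ω] {μ : Measure Ω} [IsProbabilityMeasure μ]

lemma integrable_intervalIntegral_exp_neg_sq {ρ : Measure (ℝ × ℝ)} [IsFiniteMeasure ρ]
    {h : ℝ × ℝ → ℝ} (hh : Measurable h) {f : ℝ → ℝ} (hf : Measurable f) (a : ℝ) {φ : ℝ}
    (hφ : 0 ≤ φ) :
    Integrable (fun y => ∫ τ in (0 : ℝ)..φ, Real.exp (-(a / (h y * f τ)) ^ 2)) ρ := by
  simp_rw [intervalIntegral.integral_of_le hφ]
  refine Integrable.integral_prod_left
    (f := fun z : (ℝ × ℝ) × ℝ => Real.exp (-(a / (h z.1 * f z.2)) ^ 2)) ?_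
  refine Integrable.of_bound (Measurable.aestronglyMeasurable (by fun_prop)) 1
    (ae_of_all _ fun y => ?_)
  rw [Real.norm_eq_abs, Real.abs_exp, Real.exp_le_one_iff]
  simp only [Left.neg_nonpos_iff]
  positivity

/-- A formula for the average symbol error probability in Gaussian noise gives one for the
conditional error probability in the network. -/
lemma IsNetwork.condExp_errorEvent_of_sum_eq (hX : IsNetwork μ P X)
    (hdet : IsMinDistDetector P.s det) {ι : Type*} {I : Finset ι} {c φ a w : ι → ℝ}
    {f : ι → ℝ → ℝ} (hφ : ∀ i, 0 ≤ φ i) (hf : ∀ i, Measurable (f i))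
    (ha : ∀ i, a i ^ 2 = w i * avgEnergy P.s P.p)
    (h : ∀ t : ℝ, 0 < t → ∑ k, P.p k * symbolError P.s k t =
      ∑ i ∈ I, c i * ∫ τ in (0 : ℝ)..φ i, Real.exp (-(a i / (t * f i τ)) ^ 2)) :
    μ⟦errorEvent P X det | MeasurableSpace.comap X.shadow0 inferInstance⟧ =ᵐ[μ]
      fun ω => ∑ i ∈ I, c i * ∫ τ in (0 : ℝ)..φ i, ∫ B, (1 + w i / f i τ ^ 2 *
        eta P (VG P X μ) (X.shadow0 ω) B)⁻¹ ∂(stableLaw P X μ) := by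
  have hν := hX.isProbabilityMeasure_stableLaw
  have hV := VG_nonneg P X μ
  have hN0 := P.N0_pos
  refine (hX.condExp_errorEvent hdet).trans (ae_of_all _ fun ω => ?_)
  simp only
  have hpos : ∀ᵐ y ∂(unitRayleigh.prod (stableLaw P X μ)), 0 < y.1 ∧ 0 < y.2 :=
    (Measure.quasiMeasurePreserving_fst.ae ae_unitRayleigh_pos).and
      (Measure.quasiMeasurePreserving_snd.ae hX.ae_stableLaw_pos)
  rw [integral_congr_ae (g := fun y => ∑ i ∈ I, c i * ∫ τ in (0 : ℝ)..φ i,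
    Real.exp (-(a i / (Real.sqrt (2 * y.2 * VG P X μ + P.N0) /
      (linkGain P (X.shadow0 ω) * y.1) * f i τ)) ^ 2)), integral_finsetSum]
  · refine Finset.sum_congr rfl fun i _ => ?_
    rw [integral_const_mul, average_term P X μ hX (hf i) (hφ i) (ha i)]
  · intro i _
    exact (integrable_intervalIntegral_exp_neg_sq (by fun_prop) (hf i) _ (hφ i)).const_mul _
  · filter_upwards [hpos] with y hy
    have h1 := linkGain_pos P (X.shadow0 ω)
    have h2 := hy.1
    have h3 := hy.2
    have hv : 0 < 2 * y.2 * VG P X μ + P.N0 := by positivity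
    exact h _ (div_pos (Real.sqrt_pos.2 hv) (mul_pos h1 h2))

/-- An empty edge is included: its infimum and supremum both default to `0`. -/
lemma phiPar_nonneg (s : Fin M → ℂ) (k l : Fin M) : 0 ≤ phiPar s k l := by
  have hb : edgeAngles s k l ⊆ Set.Icc (-(2 * Real.pi)) (2 * Real.pi) := by
    rintro _ ⟨z, _, rfl⟩
    have h1 := Complex.neg_pi_lt_arg ((z - s k) / (s l - s k))
    have h2 := Complex.arg_le_pi ((z - s k) / (s l - s k))
    have := Real.pi_pos
    constructor <;> simp only <;> linarith
  exact sub_nonneg.2 (Real.sInf_le_sSup _ (bddBelow_Icc.mono hb) (bddAbove_Icc.mono hb))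

/-- The conditional error probability of a general constellation. -/
lemma IsNetwork.condExp_errorEvent_eq_errorFormula (hX : IsNetwork μ P X)
    (hdet : IsMinDistDetector P.s det) :
    μ⟦errorEvent P X det | MeasurableSpace.comap X.shadow0 inferInstance⟧ =ᵐ[μ]
      fun ω => errorFormula P (stableLaw P X μ) (VG P X μ) (X.shadow0 ω) := by
  have h := hX.condExp_errorEvent_of_sum_eq hdet
    -- One term per symbol and edge; `a` is half the distance between the two symbols, whence the
    -- `4` under `w`.
    (I := Finset.univ.sigma fun k => neighbors P.s k)
    (c := fun i => P.p i.1 * (1 / (2 * Real.pi))) (φ := fun i => phiPar P.s i.1 i.2)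
    (a := fun i => ‖P.s i.1 - P.s i.2‖ / 2) (w := fun i => wPar P.s P.p i.1 i.2 / 4)
    (f := fun i τ => Real.sin (τ + psiPar P.s i.1 i.2)) (fun i => phiPar_nonneg _ _ _)
    (fun i => by fun_prop)
    (fun i => by
      rw [div_pow, ← wPar_mul_avgEnergy P.energy_pos]; ring)
    (fun t ht => by
      rw [Finset.sum_sigma]
      refine Finset.sum_congr rfl fun k _ => ?_
      rw [symbolError_eq_sum P.s_injective k ht, Finset.mul_sum]
      refine Finset.sum_congr rfl fun l _ => ?_
      rw [mul_assoc]
      congr 3 with τ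
      congr 3
      rw [div_div, mul_assoc])
  refine h.trans (ae_of_all _ fun ω => ?_)
  simp only
  rw [errorFormula, Finset.sum_sigma]
  refine Finset.sum_congr rfl fun k _ => ?_
  rw [Finset.mul_sum]
  refine Finset.sum_congr rfl fun l _ => ?_
  simp only [mul_assoc, div_div]

end ErrorFormula

/-! ### Phase shift keying. -/

section PSK

variable {M : ℕ} {s : Fin M → ℂ}

/-- Integer indices can be shifted, so any symbol may serve as the reference vertex. -/
lemma range_psk_eq (hM : M ≠ 0) (a t : ℝ) :
    {z : ℂ | ∃ j < M, z = a * Complex.exp (Complex.I * (t + 2 * Real.pi * j / M : ℝ))} =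
      Set.range fun m : ℤ => (a * Complex.exp (Complex.I * (t + 2 * Real.pi * m / M : ℝ)) : ℂ) := by
  have hM' : (M : ℂ) ≠ 0 := by exact_mod_cast hM
  ext z
  constructor
  · rintro ⟨j, _, rfl⟩
    exact ⟨j, by simp⟩
  · rintro ⟨m, rfl⟩
    have hpos : (0 : ℤ) < M := by exact_mod_cast Nat.pos_of_ne_zero hM
    refine ⟨(m % M).toNat, ?_, ?_⟩
    · have := Int.emod_lt_of_pos m hpos
      omega
    · have h1 : (((m % M).toNat : ℕ) : ℝ) = ((m % M : ℤ) : ℝ) := by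
        exact_mod_cast Int.toNat_of_nonneg (Int.emod_nonneg m hpos.ne')
      have h2 : (m : ℝ) = ((m % M : ℤ) : ℝ) + M * ((m / M : ℤ) : ℝ) := by
        exact_mod_cast (Int.emod_add_mul_ediv m M).symm
      simp only
      rw [h1, h2]
      congr 1
      rw [Complex.exp_eq_exp_iff_exists_int]
      refine ⟨m / M, ?_⟩
      push_cast
      field_simp
      ring

/-- If a ray from a point of a circle crosses the bisector with any other vertex of a regular
polygon, then it crosses that of an adjacent vertex no later. -/
lemma sin_lt_mul_sin_sub_of_lt {M : ℕ} {β x : ℝ} (hβ : β ∈ Set.Ico 0 Real.pi)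
    {m : ℕ} (hm : 0 < m) (hmM : m < M)
    (h : Real.sin (m * (Real.pi / M)) < x * Real.sin (β - m * (Real.pi / M))) (hx : 0 < x) :
    Real.sin (Real.pi / M) < x * Real.sin (β - Real.pi / M) := by
  have hM : (0 : ℝ) < M := by exact_mod_cast (by omega : 0 < M)
  have hM1 : (1 : ℝ) < M := by exact_mod_cast (by omega : 1 < M)
  have hm1 : (1 : ℝ) ≤ m := by exact_mod_cast hm
  have hmM' : (m : ℝ) < M := by exact_mod_cast hmM
  have hδ : 0 < Real.pi / M := div_pos Real.pi_pos hM
  have hMδ : M * (Real.pi / M) = Real.pi := mul_div_cancel₀ _ hM.ne'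
  set δ := Real.pi / M
  have h1 : 0 < Real.sin δ := Real.sin_pos_of_pos_of_lt_pi hδ (by nlinarith)
  have h2 : 0 < Real.sin (m * δ) := Real.sin_pos_of_pos_of_lt_pi (by positivity) (by nlinarith)
  have h3 : 0 ≤ Real.sin (m * δ - δ) :=
    Real.sin_nonneg_of_nonneg_of_le_pi (by nlinarith) (by nlinarith)
  have h4 : 0 ≤ Real.sin β := Real.sin_nonneg_of_nonneg_of_le_pi hβ.1 hβ.2.le
  -- Comparison of the adjacent vertex with the `m`-th: the surplus `sin β sin((m-1)δ)` is
  -- nonnegative.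
  have key : Real.sin (β - δ) * Real.sin (m * δ) =
      Real.sin δ * Real.sin (β - m * δ) + Real.sin β * Real.sin (m * δ - δ) := by
    simp only [Real.sin_sub]
    ring
  refine lt_of_mul_lt_mul_right ?_ h2.le
  calc Real.sin δ * Real.sin (m * δ) < Real.sin δ * (x * Real.sin (β - m * δ)) :=
        mul_lt_mul_of_pos_left h h1
    _ ≤ Real.sin δ * (x * Real.sin (β - m * δ)) + x * (Real.sin β * Real.sin (m * δ - δ)) :=
        le_add_of_nonneg_right (by positivity)
    _ = x * Real.sin (β - δ) * Real.sin (m * δ) := by rw [mul_assoc, key]; ring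

/-- Exit of a ray through the edges of a regular polygon's decision region. -/
lemma exists_lt_mul_sin_iff (hM : 2 ≤ M) {θ x : ℝ} (hθ : θ ∈ Set.Ioo (-Real.pi) Real.pi)
    (hx : 0 < x) :
    (∃ m : ℕ, 0 < m ∧ m < M ∧
      Real.sin (m * (Real.pi / M)) < x * Real.sin (θ - m * (Real.pi / M))) ↔
      Real.pi / M < |θ| ∧ Real.sin (Real.pi / M) / Real.sin (|θ| - Real.pi / M) < x := by
  have hM0 : (0 : ℝ) < M := by exact_mod_cast (by omega : 0 < M)
  have hM2 : (2 : ℝ) ≤ M := by exact_mod_cast hM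
  have hδ : 0 < Real.pi / M := div_pos Real.pi_pos hM0
  have hMδ : M * (Real.pi / M) = Real.pi := mul_div_cancel₀ _ hM0.ne'
  have hδ2 : Real.pi / M ≤ Real.pi / 2 := by gcongr
  have hsin : 0 < Real.sin (Real.pi / M) :=
    Real.sin_pos_of_pos_of_lt_pi hδ (by linarith [Real.pi_pos])
  have habs : |θ| < Real.pi := abs_lt.2 hθ
  -- The reflection that exchanges vertices `m` and `M - m` reverses `θ`, so only `|θ|` matters.
  have hrefl : ∀ m : ℕ, m < M → Real.sin ((M - m : ℕ) * (Real.pi / M)) =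
      Real.sin (m * (Real.pi / M)) ∧ Real.sin (-|θ| - (M - m : ℕ) * (Real.pi / M)) =
        Real.sin (|θ| - m * (Real.pi / M)) := fun m hm => by
    rw [Nat.cast_sub hm.le, sub_mul, hMδ, Real.sin_pi_sub]
    refine ⟨rfl, ?_⟩
    rw [show -|θ| - (Real.pi - m * (Real.pi / M)) = -(|θ| - m * (Real.pi / M) + Real.pi) by ring,
      Real.sin_neg, Real.sin_add_pi, neg_neg]
  have hsymm : (∃ m : ℕ, 0 < m ∧ m < M ∧
      Real.sin (m * (Real.pi / M)) < x * Real.sin (θ - m * (Real.pi / M))) ↔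
      ∃ m : ℕ, 0 < m ∧ m < M ∧
      Real.sin (m * (Real.pi / M)) < x * Real.sin (|θ| - m * (Real.pi / M)) := by
    rcases le_total 0 θ with h | h
    · rw [abs_of_nonneg h]
    · have hθ' : θ = -|θ| := by rw [abs_of_nonpos h, neg_neg]
      constructor
      · rintro ⟨m, h0, h1, h2⟩
        refine ⟨M - m, by omega, by omega, ?_⟩
        have h3 := hrefl (M - m) (by omega)
        rw [Nat.sub_sub_self h1.le] at h3
        rwa [← h3.1, ← h3.2, ← hθ']
      · rintro ⟨m, h0, h1, h2⟩
        refine ⟨M - m, by omega, by omega, ?_⟩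
        have h3 := hrefl m h1
        rwa [hθ', h3.1, h3.2]
  have hone : Real.sin (Real.pi / M) < x * Real.sin (|θ| - Real.pi / M) ↔
      Real.pi / M < |θ| ∧ Real.sin (Real.pi / M) / Real.sin (|θ| - Real.pi / M) < x := by
    constructor
    · intro h
      have hs : 0 < Real.sin (|θ| - Real.pi / M) := by
        by_contra! hs
        have := mul_nonpos_of_nonneg_of_nonpos hx.le hs
        linarith
      refine ⟨?_, by rwa [div_lt_iff₀ hs]⟩
      by_contra! hle
      have := Real.sin_nonpos_of_nonpos_of_neg_pi_le (x := |θ| - Real.pi / M) (by linarith)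
        (by linarith [abs_nonneg θ, Real.pi_pos])
      linarith
    · rintro ⟨h1, h2⟩
      have hs : 0 < Real.sin (|θ| - Real.pi / M) :=
        Real.sin_pos_of_pos_of_lt_pi (by linarith) (by linarith)
      rwa [div_lt_iff₀ hs] at h2
  rw [hsymm, ← hone]
  constructor
  · rintro ⟨m, h0, h1, h2⟩
    exact sin_lt_mul_sin_sub_of_lt ⟨abs_nonneg θ, habs⟩ h0 h1 h2 hx
  · intro h
    exact ⟨1, one_pos, by omega, by simpa using h⟩

lemma one_sub_exp_mul_I (β : ℝ) : Complex.exp (Complex.I * (2 * β : ℝ)) - 1 =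
    (2 * Real.sin β : ℝ) * (Complex.I * Complex.exp (Complex.I * β)) := by
  have h : Complex.exp (Complex.I * (2 * β : ℝ)) =
      Complex.exp (Complex.I * β) * Complex.exp (Complex.I * β) := by
    rw [← Complex.exp_add]; congr 1; push_cast; ring
  rw [h, mul_comm Complex.I, Complex.exp_mul_I]
  push_cast
  linear_combination Complex.sin_sq_add_cos_sq (β : ℂ) - (Complex.sin β ^ 2) * Complex.I_sq

lemma setIntegral_comp_abs_Ioo (f : ℝ → ℝ) {δ : ℝ} (hδ : 0 ≤ δ) (hδπ : δ ≤ Real.pi) :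
    ∫ θ in {θ | δ < |θ| ∧ |θ| < Real.pi}, f |θ| = 2 * ∫ θ in δ..Real.pi, f θ := by
  have hm : MeasurableSet {θ : ℝ | δ < |θ| ∧ |θ| < Real.pi} :=
    (by fun_prop : Measurable fun θ : ℝ => |θ|) measurableSet_Ioo
  have h1 : ∀ θ : ℝ, {θ : ℝ | δ < |θ| ∧ |θ| < Real.pi}.indicator (fun θ => f |θ|) θ =
      (Set.Ioo δ Real.pi).indicator f |θ| := fun θ => by
    by_cases h : δ < |θ| ∧ |θ| < Real.pi
    · rw [Set.indicator_of_mem (by exact h), Set.indicator_of_mem (by exact h)]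
    · rw [Set.indicator_of_notMem (by exact h), Set.indicator_of_notMem (by exact h)]
  rw [← integral_indicator hm]
  simp_rw [h1]
  rw [integral_comp_abs, setIntegral_indicator measurableSet_Ioo,
    intervalIntegral.integral_of_le hδπ]
  have : Set.Ioi 0 ∩ Set.Ioo δ Real.pi = Set.Ioo δ Real.pi :=
    Set.inter_eq_right.2 fun x hx => hδ.trans_lt hx.1
  rw [this, integral_Ioc_eq_integral_Ioo]

/-- Symbol error probability of `M`-PSK in Gaussian noise. -/
lemma symbolError_psk (hM : 2 ≤ M) {a t₀ : ℝ} (ha : 0 < a)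
    (hrange : Set.range s =
      {z | ∃ j < M, z = a * Complex.exp (Complex.I * (t₀ + 2 * Real.pi * j / M : ℝ))})
    (k : Fin M) {t : ℝ} (ht : 0 < t) :
    symbolError s k t = 1 / Real.pi * ∫ θ in (0 : ℝ)..((M - 1) / M * Real.pi),
      Real.exp (-(a * Real.sin (Real.pi / M) / (t * Real.sin θ)) ^ 2) := by
  have hM0 : (0 : ℝ) < M := by exact_mod_cast (by omega : 0 < M)
  have hM2 : (2 : ℝ) ≤ M := by exact_mod_cast hM
  have hδ : 0 < Real.pi / M := div_pos Real.pi_pos hM0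
  have hMδ : M * (Real.pi / M) = Real.pi := mul_div_cancel₀ _ hM0.ne'
  have hδ2 : Real.pi / M ≤ Real.pi / 2 := by gcongr
  have hsin : 0 < Real.sin (Real.pi / M) :=
    Real.sin_pos_of_pos_of_lt_pi hδ (by linarith [Real.pi_pos])
  rw [range_psk_eq (by omega)] at hrange
  obtain ⟨m₀, hm₀⟩ : s k ∈ Set.range fun m : ℤ =>
    (a * Complex.exp (Complex.I * (t₀ + 2 * Real.pi * m / M : ℝ)) : ℂ) := hrange ▸ ⟨k, rfl⟩
  simp only at hm₀
  set u : ℂ := Complex.exp (Complex.I * (t₀ + 2 * Real.pi * m₀ / M : ℝ)) with hu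
  have hu1 : ‖u‖ = 1 := by rw [hu, mul_comm, Complex.norm_exp_ofReal_mul_I]
  have hu0 : u ≠ 0 := Complex.exp_ne_zero _
  -- position of the other points
  have hpt : ∀ m : ℤ, a * Complex.exp (Complex.I * (t₀ + 2 * Real.pi * (m₀ + m : ℤ) / M : ℝ)) -
      s k = a * u * ((2 * Real.sin (m * (Real.pi / M)) : ℝ) *
        (Complex.I * Complex.exp (Complex.I * (m * (Real.pi / M) : ℝ)))) := fun m => by
    rw [← one_sub_exp_mul_I, ← hm₀, mul_assoc (a : ℂ), mul_sub u, hu, ← Complex.exp_add, mul_one,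
      ← mul_sub]
    congr 4
    push_cast
    ring
  -- The angle `θ` is measured from the outward radius at `s_k`. The `m`-th vertex is seen from
  -- there at angle `mπ/M + π/2` and at distance `2a sin(mπ/M)`.
  have hray : ∀ r : ℝ, ∀ θ : ℝ, s k + t * (u * (r * (Real.cos θ + Real.sin θ * Complex.I))) ∉
      decisionRegion s k ↔ ∃ m : ℕ, 0 < m ∧ m < M ∧
        Real.sin (m * (Real.pi / M)) < t * r / a * Real.sin (θ - m * (Real.pi / M)) := by
    intro r θ
    set y : ℂ := t * (u * (r * (Real.cos θ + Real.sin θ * Complex.I))) with hy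
    have hmem : s k + y ∈ decisionRegion s k ↔ ∀ m : ℕ, 0 < m → m < M →
        ‖y‖ ≤ ‖y - (a * Complex.exp (Complex.I * (t₀ + 2 * Real.pi * (m₀ + m : ℤ) / M : ℝ)) -
          s k)‖ := by
      constructor
      · intro h m _ _
        obtain ⟨j, hj⟩ : (a * Complex.exp (Complex.I * (t₀ + 2 * Real.pi * (m₀ + m : ℤ) / M : ℝ)) :
          ℂ) ∈ Set.range s := hrange ▸ ⟨m₀ + m, rfl⟩
        have := h j
        rw [add_sub_cancel_left, hj] at this
        convert this using 2
        ring
      · intro h j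
        obtain ⟨m, hm, hjm⟩ : ∃ m : ℕ, m < M ∧
            s j = a * Complex.exp (Complex.I * (t₀ + 2 * Real.pi * (m₀ + m : ℤ) / M : ℝ)) := by
          have h1 : s j ∈ Set.range s := ⟨j, rfl⟩
          rw [hrange] at h1
          obtain ⟨n, hn⟩ := h1
          have h2 : s j ∈ Set.range fun m : ℤ => (a * Complex.exp (Complex.I *
            (t₀ + 2 * Real.pi * m₀ / M + 2 * Real.pi * m / M : ℝ)) : ℂ) := by
            refine ⟨n - m₀, ?_⟩
            rw [← hn]
            simp only
            congr 4
            push_cast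
            ring
          rw [← range_psk_eq (by omega)] at h2
          obtain ⟨m, hm, hjm⟩ := h2
          refine ⟨m, hm, hjm.trans ?_⟩
          congr 4
          push_cast
          ring
        rw [add_sub_cancel_left]
        rcases Nat.eq_zero_or_pos m with rfl | h0
        · have : s j = s k := by rw [hjm, ← hm₀, hu, Nat.cast_zero, add_zero]
          rw [this, add_sub_cancel_left]
        · have := h m h0 hm
          rw [← hjm] at this
          convert this using 2
          ring
    rw [hmem]
    push Not
    refine exists_congr fun m => and_congr_right fun h0 => and_congr_right fun hm => ?_
    have h0' : (0 : ℝ) < m := by exact_mod_cast h0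
    have hm' : (m : ℝ) < M := by exact_mod_cast hm
    have hsm : 0 < Real.sin (m * (Real.pi / M)) :=
      Real.sin_pos_of_pos_of_lt_pi (by positivity) (by nlinarith)
    have hpm := hpt m
    rw [Int.cast_natCast] at hpm
    set v : ℂ := Complex.exp (Complex.I * (m * (Real.pi / M) : ℝ)) with hv
    have hv0 : v ≠ 0 := Complex.exp_ne_zero _
    have hne : (a * u * ((2 * Real.sin (m * (Real.pi / M)) : ℝ) * (Complex.I * v)) : ℂ) ≠ 0 := by
      have h1 : (a : ℂ) ≠ 0 := by exact_mod_cast ha.ne'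
      have h2 : ((2 * Real.sin (m * (Real.pi / M)) : ℝ) : ℂ) ≠ 0 := by
        exact_mod_cast (by positivity)
      exact mul_ne_zero (mul_ne_zero h1 hu0) (mul_ne_zero h2 (mul_ne_zero Complex.I_ne_zero hv0))
    rw [hpm, ← not_le, norm_le_norm_sub_iff hne, not_le]
    have hquot : (y / (a * u * ((2 * Real.sin (m * (Real.pi / M)) : ℝ) * (Complex.I * v)))).re =
        t * r / (a * (2 * Real.sin (m * (Real.pi / M)))) *
          Real.sin (θ - m * (Real.pi / M)) := by
      have h1 : (Real.cos θ + Real.sin θ * Complex.I : ℂ) =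
          v * Complex.exp ((θ - m * (Real.pi / M) : ℝ) * Complex.I) := by
        rw [hv, ← Complex.exp_add, Complex.ofReal_cos, Complex.ofReal_sin, ← Complex.exp_mul_I]
        congr 1
        push_cast
        ring
      have h2 : y / (a * u * ((2 * Real.sin (m * (Real.pi / M)) : ℝ) * (Complex.I * v))) =
          ((t * r / (a * (2 * Real.sin (m * (Real.pi / M)))) : ℝ) : ℂ) *
            (-Complex.I * Complex.exp ((θ - m * (Real.pi / M) : ℝ) * Complex.I)) := by
        rw [hy, h1, div_eq_iff hne]
        have h3 : (a : ℂ) ≠ 0 := by exact_mod_cast ha.ne'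
        have h4 : ((Real.sin (m * (Real.pi / M)) : ℝ) : ℂ) ≠ 0 := by exact_mod_cast hsm.ne'
        rw [Complex.ofReal_div, Complex.ofReal_mul a, Complex.ofReal_mul 2]
        have h5 : (a * (((2 : ℝ) : ℂ) * (Real.sin (m * (Real.pi / M)) : ℝ)) : ℂ) ≠ 0 :=
          mul_ne_zero h3 (mul_ne_zero (by norm_num) h4)
        rw [div_mul_eq_mul_div, div_mul_eq_mul_div, eq_div_iff h5, Complex.ofReal_mul]
        linear_combination ((t * r * u * v * a * ((2 : ℝ) : ℂ) *
          (Real.sin (m * (Real.pi / M)) : ℝ) *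
          Complex.exp ((θ - m * (Real.pi / M) : ℝ) * Complex.I) : ℂ)) * Complex.I_sq
      rw [h2, Complex.re_ofReal_mul, neg_mul, Complex.neg_re, mul_comm Complex.I,
        Complex.mul_I_re, Complex.exp_ofReal_mul_I_im, neg_neg]
    rw [hquot, div_mul_eq_mul_div, lt_div_iff₀ (by positivity),
      div_mul_eq_mul_div (t * r) a, lt_div_iff₀ ha]
    constructor <;> intro h <;> linarith
  have hA : MeasurableSet {z : ℂ | s k + t * z ∉ decisionRegion s k} :=
    (show Measurable fun z : ℂ => s k + t * z by fun_prop) (measurableSet_decisionRegion k).compl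
  have hS : MeasurableSet {θ : ℝ | Real.pi / M < |θ| ∧ |θ| < Real.pi} :=
    (by fun_prop : Measurable fun θ : ℝ => |θ|) measurableSet_Ioo
  rw [symbolError, ← complexGaussian_real_preimage_mul hu1 hA,
    complexGaussian_real_of_rays (hA.preimage (by fun_prop)) hS (fun θ hθ => abs_lt.1 hθ.2)
      -- Rays with `|θ| ≤ π/M` never leave the region. Shifting the angle by `π/M` below gives the
      -- upper limit `π - π/M`.
      (ρ := fun θ => a * Real.sin (Real.pi / M) / (t * Real.sin (|θ| - Real.pi / M)))
      (by fun_prop) ?_ ?_,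
    setIntegral_comp_abs_Ioo (fun θ =>
      Real.exp (-(a * Real.sin (Real.pi / M) / (t * Real.sin (θ - Real.pi / M))) ^ 2)) hδ.le
      (by linarith [Real.pi_pos]),
    intervalIntegral.integral_comp_sub_right (fun θ =>
      Real.exp (-(a * Real.sin (Real.pi / M) / (t * Real.sin θ)) ^ 2)), sub_self,
    show Real.pi - Real.pi / M = (M - 1) / M * Real.pi by field_simp, ← mul_assoc]
  · congr 1
    field_simp
  · intro θ hθ
    have := Real.sin_pos_of_pos_of_lt_pi (x := |θ| - Real.pi / M) (by linarith [hθ.1])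
      (by linarith [hθ.2])
    positivity
  · intro r hr θ hθ
    have habs : |θ| < Real.pi := abs_lt.2 hθ
    simp only [Set.mem_preimage, Set.mem_ofPred_eq]
    rw [hray, exists_lt_mul_sin_iff hM hθ (by positivity)]
    simp only [habs, and_true]
    refine and_congr_right fun h => ?_
    have := Real.sin_pos_of_pos_of_lt_pi (x := |θ| - Real.pi / M) (by linarith) (by linarith)
    rw [div_lt_div_iff₀ this ha, div_lt_iff₀ (by positivity)]
    constructor <;> intro h <;> linarith

variable {Ω : Type*} {L : ℕ} {P : Params M L} {X : Signals Ω M L} {det : ℝ → ℂ → Fin M}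
  [MeasurableSpace Ω] {μ : Measure Ω} [IsProbabilityMeasure μ]

/-- The conditional error probability of equiprobable `M`-PSK. -/
lemma IsNetwork.condExp_errorEvent_psk (hX : IsNetwork μ P X)
    (hdet : IsMinDistDetector P.s det) (hpsk : IsPSK P.s) (hp : ∀ k, P.p k = 1 / M) :
    μ⟦errorEvent P X det | MeasurableSpace.comap X.shadow0 inferInstance⟧ =ᵐ[μ]
      fun ω => craigIntegral P (stableLaw P X μ) (VG P X μ) (X.shadow0 ω)
        ((M - 1) / M * Real.pi) (Real.sin (Real.pi / M) ^ 2) := by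
  obtain ⟨hM, a, t₀, ha, hrange⟩ := hpsk
  have hM0 : (0 : ℝ) < M := by exact_mod_cast (by omega : 0 < M)
  have hM1 : (1 : ℝ) ≤ M := by exact_mod_cast (by omega : 1 ≤ M)
  have hnorm : ∀ k, ‖P.s k‖ = a := fun k => by
    obtain ⟨j, _, hj⟩ : P.s k ∈ {z : ℂ | ∃ j < M,
      z = a * Complex.exp (Complex.I * (t₀ + 2 * Real.pi * j / M : ℝ))} := hrange ▸ ⟨k, rfl⟩
    rw [hj, norm_mul, mul_comm Complex.I, Complex.norm_exp_ofReal_mul_I, mul_one,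
      Complex.norm_real, Real.norm_of_nonneg ha.le]
  have hE : avgEnergy P.s P.p = a ^ 2 := by
    simp only [avgEnergy, hp, hnorm, Finset.sum_const, Finset.card_univ, Fintype.card_fin,
      nsmul_eq_mul]
    field_simp
  have h := hX.condExp_errorEvent_of_sum_eq hdet (I := {()}) (c := fun _ => 1 / Real.pi)
    (φ := fun _ => (M - 1) / M * Real.pi) (a := fun _ => a * Real.sin (Real.pi / M))
    (w := fun _ => Real.sin (Real.pi / M) ^ 2) (f := fun _ => Real.sin)
    (fun _ => mul_nonneg (div_nonneg (by linarith) hM0.le) Real.pi_pos.le)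
    (fun _ => by fun_prop) (fun _ => by rw [hE]; ring)
    (fun t ht => by
      simp only [symbolError_psk hM ha hrange _ ht, hp, Finset.sum_const,
        Finset.card_univ, Fintype.card_fin, nsmul_eq_mul, Finset.card_singleton, Nat.cast_one]
      rw [← mul_assoc, mul_one_div_cancel hM0.ne', one_mul])
  simp only [Finset.sum_singleton] at h
  exact h

end PSK

/-! ### Square quadrature amplitude modulation. -/

section QAM

/-- Tail of the normal law of variance `1/2`. -/
noncomputable def gaussianTail (c : ℝ) : ℝ :=
  (gaussianReal 0 ((1 : ℝ) / 2).toNNReal).real (Set.Ioi c)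

lemma complexGaussian_real_re_im {A B : Set ℝ} (hA : MeasurableSet A) (hB : MeasurableSet B) :
    (complexGaussian 1).real {z | z.re ∈ A ∧ z.im ∈ B} =
      (gaussianReal 0 ((1 : ℝ) / 2).toNNReal).real A *
        (gaussianReal 0 ((1 : ℝ) / 2).toNNReal).real B := by
  have hm : MeasurableSet {z : ℂ | z.re ∈ A ∧ z.im ∈ B} :=
    (Complex.measurable_re hA).inter (Complex.measurable_im hB)
  rw [complexGaussian, map_measureReal_apply measurable_ofReal_add_mul_I hm]
  have h : (fun q : ℝ × ℝ => (q.1 : ℂ) + q.2 * Complex.I) ⁻¹' {z | z.re ∈ A ∧ z.im ∈ B} =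
      A ×ˢ B := by
    ext q; simp
  rw [h, measureReal_prod_prod]

/-- Craig's formula: the tail is the Gaussian mass of the half-plane `Re z > c`, which a ray enters
at `c/cos θ`; the symmetry in `θ` halves the range. -/
lemma gaussianTail_eq {c : ℝ} (hc : 0 < c) : gaussianTail c =
    1 / Real.pi * ∫ θ in (0 : ℝ)..(Real.pi / 2), Real.exp (-(c / Real.sin θ) ^ 2) := by
  have hm : MeasurableSet {z : ℂ | z.re ∈ Set.Ioi c ∧ z.im ∈ Set.univ} :=
    (Complex.measurable_re measurableSet_Ioi).inter (Complex.measurable_im MeasurableSet.univ)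
  have h1 := complexGaussian_real_re_im (measurableSet_Ioi (a := c)) MeasurableSet.univ
  rw [probReal_univ, mul_one] at h1
  have h2 : ∫ θ in Set.Ioo (-(Real.pi / 2)) (Real.pi / 2), Real.exp (-(c / Real.cos θ) ^ 2) =
      2 * ∫ θ in (0 : ℝ)..(Real.pi / 2), Real.exp (-(c / Real.sin θ) ^ 2) := by
    have hpi := Real.pi_pos
    have h3 : ∀ θ : ℝ, (Set.Ioo (-(Real.pi / 2)) (Real.pi / 2)).indicator
        (fun θ => Real.exp (-(c / Real.cos θ) ^ 2)) θ =
        (Set.Iio (Real.pi / 2)).indicator (fun θ => Real.exp (-(c / Real.cos θ) ^ 2)) |θ| :=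
      fun θ => by
        have h4 : θ ∈ Set.Ioo (-(Real.pi / 2)) (Real.pi / 2) ↔ |θ| ∈ Set.Iio (Real.pi / 2) :=
          abs_lt.symm
        by_cases h : |θ| ∈ Set.Iio (Real.pi / 2)
        · rw [Set.indicator_of_mem h, Set.indicator_of_mem (h4.2 h), Real.cos_abs]
        · rw [Set.indicator_of_notMem h, Set.indicator_of_notMem (fun hh => h (h4.1 hh))]
    rw [← integral_indicator measurableSet_Ioo]
    simp_rw [h3]
    rw [integral_comp_abs, setIntegral_indicator measurableSet_Iio, Set.Ioi_inter_Iio,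
      ← integral_Ioc_eq_integral_Ioo, ← intervalIntegral.integral_of_le (by positivity)]
    have h5 := intervalIntegral.integral_comp_sub_left (a := 0) (b := Real.pi / 2)
      (fun θ => Real.exp (-(c / Real.sin θ) ^ 2)) (Real.pi / 2)
    simp only [Real.sin_pi_div_two_sub, sub_self, sub_zero] at h5
    rw [h5]
  rw [gaussianTail, ← h1, complexGaussian_real_of_rays hm
    (measurableSet_Ioo (a := -(Real.pi / 2)) (b := Real.pi / 2))
    (fun θ hθ => ⟨by linarith [hθ.1, Real.pi_pos], by linarith [hθ.2, Real.pi_pos]⟩)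
    (ρ := fun θ => c / Real.cos θ) (by fun_prop) ?_ ?_, h2]
  · field_simp
  · intro θ hθ
    have := Real.cos_pos_of_mem_Ioo hθ
    positivity
  · intro r hr θ hθ
    have hre : ((r : ℂ) * (Real.cos θ + Real.sin θ * Complex.I)).re = r * Real.cos θ := by
      rw [Complex.re_ofReal_mul, Complex.add_re, Complex.mul_I_re, Complex.ofReal_im,
        Complex.ofReal_re, neg_zero, add_zero]
    simp only [Set.mem_ofPred_eq, Set.mem_univ, and_true, hre, Set.mem_Ioi]
    constructor
    · intro h
      have hcos : 0 < Real.cos θ := by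
        by_contra! hh
        have := mul_nonpos_of_nonneg_of_nonpos hr.le hh
        linarith
      refine ⟨?_, by rwa [div_lt_iff₀ hcos]⟩
      by_contra hout
      rw [Set.mem_Ioo, not_and_or, not_lt, not_lt] at hout
      rcases hout with hout | hout
      · have := Real.cos_nonpos_of_pi_div_two_le_of_le (x := -θ) (by linarith)
          (by linarith [hθ.1, Real.pi_pos])
        rw [Real.cos_neg] at this
        linarith
      · have := Real.cos_nonpos_of_pi_div_two_le_of_le hout (by linarith [hθ.2, Real.pi_pos])
        linarith
    · rintro ⟨h, h'⟩
      rwa [div_lt_iff₀ (Real.cos_pos_of_mem_Ioo h)] at h'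

/-- The square is the mass of the quadrant with corner `(c, c)`, which a ray enters at `c/min(cos θ,
sin θ)`; reflection in the diagonal reduces the range to `π/4`. -/
lemma gaussianTail_sq_eq {c : ℝ} (hc : 0 < c) : gaussianTail c ^ 2 =
    1 / Real.pi * ∫ θ in (0 : ℝ)..(Real.pi / 4), Real.exp (-(c / Real.sin θ) ^ 2) := by
  have hpi := Real.pi_pos
  have hm : MeasurableSet {z : ℂ | z.re ∈ Set.Ioi c ∧ z.im ∈ Set.Ioi c} :=
    (Complex.measurable_re measurableSet_Ioi).inter (Complex.measurable_im measurableSet_Ioi)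
  have h1 := complexGaussian_real_re_im (measurableSet_Ioi (a := c)) (measurableSet_Ioi (a := c))
  have hmeas : Measurable fun θ : ℝ =>
      Real.exp (-(c / min (Real.cos θ) (Real.sin θ)) ^ 2) := by fun_prop
  have hint : ∀ a b : ℝ, IntervalIntegrable (fun θ : ℝ =>
      Real.exp (-(c / min (Real.cos θ) (Real.sin θ)) ^ 2)) volume a b := fun a b => by
    refine (intervalIntegrable_const (c := (1 : ℝ))).mono_fun hmeas.aestronglyMeasurable
      (ae_of_all _ fun y => ?_)
    simp only
    rw [norm_one, Real.norm_eq_abs, Real.abs_exp, Real.exp_le_one_iff]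
    simp only [Left.neg_nonpos_iff]
    positivity
  have h2 : ∫ θ in Set.Ioo 0 (Real.pi / 2),
      Real.exp (-(c / min (Real.cos θ) (Real.sin θ)) ^ 2) =
      2 * ∫ θ in (0 : ℝ)..(Real.pi / 4), Real.exp (-(c / Real.sin θ) ^ 2) := by
    rw [← integral_Ioc_eq_integral_Ioo, ← intervalIntegral.integral_of_le (by positivity),
      ← intervalIntegral.integral_add_adjacent_intervals (hint 0 (Real.pi / 4))
        (hint (Real.pi / 4) (Real.pi / 2))]
    have h3 := intervalIntegral.integral_comp_sub_left (a := Real.pi / 4) (b := Real.pi / 2)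
      (fun θ => Real.exp (-(c / min (Real.cos θ) (Real.sin θ)) ^ 2)) (Real.pi / 2)
    simp only [Real.sin_pi_div_two_sub, Real.cos_pi_div_two_sub, sub_self,
      show Real.pi / 2 - Real.pi / 4 = Real.pi / 4 by ring] at h3
    simp_rw [min_comm (Real.sin _)] at h3
    rw [h3, ← two_mul]
    congr 1
    refine intervalIntegral.integral_congr fun θ hθ => ?_
    rw [Set.uIcc_of_le (by positivity)] at hθ
    have h4 : Real.sin θ ≤ Real.cos θ := by
      rw [← Real.sin_pi_div_two_sub]
      exact Real.sin_le_sin_of_le_of_le_pi_div_two (by linarith [hθ.1]) (by linarith [hθ.1])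
        (by linarith [hθ.2])
    simp only [min_eq_right h4]
  have hsub : Set.Ioo 0 (Real.pi / 2) ⊆ Set.Ioo (-Real.pi) Real.pi := fun θ hθ =>
    ⟨by linarith [hθ.1], by linarith [hθ.2]⟩
  have hpos : ∀ θ ∈ Set.Ioo 0 (Real.pi / 2), 0 < min (Real.cos θ) (Real.sin θ) := fun θ hθ =>
    lt_min (Real.cos_pos_of_mem_Ioo ⟨by linarith [hθ.1], hθ.2⟩)
      (Real.sin_pos_of_pos_of_lt_pi hθ.1 (by linarith [hθ.2]))
  rw [sq, gaussianTail, ← h1, complexGaussian_real_of_rays hm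
    (measurableSet_Ioo (a := 0) (b := Real.pi / 2)) hsub
    (ρ := fun θ => c / min (Real.cos θ) (Real.sin θ)) (by fun_prop) ?_ ?_, h2]
  · field_simp
  · intro θ hθ
    have := hpos θ hθ
    positivity
  · intro r hr θ hθ
    have hre : ((r : ℂ) * (Real.cos θ + Real.sin θ * Complex.I)).re = r * Real.cos θ := by
      rw [Complex.re_ofReal_mul, Complex.add_re, Complex.mul_I_re, Complex.ofReal_im,
        Complex.ofReal_re, neg_zero, add_zero]
    have him : ((r : ℂ) * (Real.cos θ + Real.sin θ * Complex.I)).im = r * Real.sin θ := by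
      rw [Complex.im_ofReal_mul, Complex.add_im, Complex.mul_I_im, Complex.ofReal_im,
        Complex.ofReal_re, zero_add]
    simp only [Set.mem_ofPred_eq, hre, him, Set.mem_Ioi]
    rw [← lt_min_iff, ← mul_min_of_nonneg _ _ hr.le]
    constructor
    · intro h
      have hmin : 0 < min (Real.cos θ) (Real.sin θ) := by
        by_contra! hh
        have := mul_nonpos_of_nonneg_of_nonpos hr.le hh
        linarith
      refine ⟨?_, by rwa [div_lt_iff₀ hmin]⟩
      have hcos := (lt_min_iff.1 hmin).1
      have hsin := (lt_min_iff.1 hmin).2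
      constructor
      · by_contra! hh
        have := Real.sin_nonpos_of_nonpos_of_neg_pi_le hh hθ.1.le
        linarith
      · by_contra! hh
        have := Real.cos_nonpos_of_pi_div_two_le_of_le hh (by linarith [hθ.2])
        linarith
    · rintro ⟨h, h'⟩
      rwa [div_lt_iff₀ (hpos θ h)] at h'

/-- Noise values that leave the `u`-th point of a row of `m` points nearest. -/
def rowCell (m u : ℕ) (c : ℝ) : Set ℝ := {x | (0 < u → -c ≤ x) ∧ (u + 1 < m → x ≤ c)}

lemma rowCell_eq_inter (m u : ℕ) (c : ℝ) : rowCell m u c =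
    (if 0 < u then Set.Iio (-c) else ∅)ᶜ ∩ (if u + 1 < m then Set.Ioi c else ∅)ᶜ := by
  ext x
  simp only [rowCell, Set.mem_ofPred_eq, Set.mem_inter_iff]
  split_ifs <;> simp [*]

lemma measurableSet_rowCell (m u : ℕ) (c : ℝ) : MeasurableSet (rowCell m u c) := by
  rw [rowCell_eq_inter]
  refine MeasurableSet.inter (MeasurableSet.compl ?_) (MeasurableSet.compl ?_) <;>
    split_ifs <;> measurability

lemma gaussianReal_real_Iio_neg (c : ℝ) :
    (gaussianReal 0 ((1 : ℝ) / 2).toNNReal).real (Set.Iio (-c)) = gaussianTail c := by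
  have h := gaussianReal_map_neg (μ := 0) (v := ((1 : ℝ) / 2).toNNReal)
  rw [neg_zero] at h
  rw [gaussianTail, ← h, map_measureReal_apply measurable_neg measurableSet_Iio, h]
  congr 1
  ext x
  simp

lemma real_rowCell {m u : ℕ} {c : ℝ} (hc : 0 < c) :
    (gaussianReal 0 ((1 : ℝ) / 2).toNNReal).real (rowCell m u c) =
      1 - ((if 0 < u then gaussianTail c else 0) + if u + 1 < m then gaussianTail c else 0) := by
  rw [rowCell_eq_inter, ← Set.compl_union, probReal_compl_eq_one_sub (by
    refine MeasurableSet.union ?_ ?_ <;> split_ifs <;> measurability), measureReal_union]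
  · congr 2
    · split_ifs
      · exact gaussianReal_real_Iio_neg c
      · simp
    · split_ifs
      · rfl
      · simp
  · split_ifs <;> simp
    exact hc.le
  · split_ifs <;> measurability

/-- Each of the `m - 1` boundaries between adjacent cells costs one tail on either side. -/
lemma sum_real_rowCell {m : ℕ} (hm : 0 < m) {c : ℝ} (hc : 0 < c) :
    ∑ u ∈ Finset.range m, (gaussianReal 0 ((1 : ℝ) / 2).toNNReal).real (rowCell m u c) =
      m - 2 * (m - 1) * gaussianTail c := by
  obtain ⟨n, rfl⟩ := Nat.exists_eq_succ_of_ne_zero hm.ne'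
  simp_rw [real_rowCell hc]
  rw [Finset.sum_sub_distrib, Finset.sum_add_distrib, Finset.sum_range_succ' (fun u =>
    if 0 < u then gaussianTail c else 0), Finset.sum_range_succ (fun u =>
    if u + 1 < n.succ then gaussianTail c else 0)]
  rw [Finset.sum_congr rfl (g := fun _ => gaussianTail c) fun u _ => if_pos (Nat.succ_pos u),
    Finset.sum_congr rfl (g := fun _ => gaussianTail c) fun u hu =>
      if_pos (Nat.succ_lt_succ (Finset.mem_range.1 hu))]
  simp
  ring

/-- Nearest point in a row of points of spacing `2 d`. -/
lemma forall_abs_le_abs_sub_iff {m u : ℕ} (hu : u < m) {d : ℝ} (hd : 0 < d) {t : ℝ} (ht : 0 < t)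
    (x : ℝ) : (∀ u' < m, (t * x) ^ 2 ≤ (t * x - 2 * d * ((u' : ℝ) - u)) ^ 2) ↔
      x ∈ rowCell m u (d / t) := by
  -- After expansion the condition on `n = u' - u` reads `t x n ≤ d n²`, so the adjacent points `n =
  -- ±1` decide.
  have hiff : ∀ n : ℝ, (t * x) ^ 2 ≤ (t * x - 2 * d * n) ^ 2 ↔ t * x * n ≤ d * n ^ 2 := fun n => by
    have : (t * x - 2 * d * n) ^ 2 = (t * x) ^ 2 + 4 * d * (d * n ^ 2 - t * x * n) := by ring
    rw [this, le_add_iff_nonneg_right, mul_nonneg_iff_of_pos_left (by positivity), sub_nonneg]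
  simp only [hiff, rowCell, Set.mem_ofPred_eq, le_div_iff₀ ht, neg_le_iff_add_nonneg]
  constructor
  · intro h
    refine ⟨fun h0 => ?_, fun h1 => ?_⟩
    · have := h (u - 1) (by omega)
      rw [Nat.cast_sub (by omega : 1 ≤ u)] at this
      have h2 : 0 ≤ t * x + d := by push_cast at this; linarith
      have h3 : x + d / t = (t * x + d) / t := by field_simp
      rw [h3]
      positivity
    · have := h (u + 1) h1
      push_cast at this
      linarith
  · rintro ⟨h0, h1⟩ u' hu'
    rcases lt_trichotomy u' u with h | rfl | h
    · have h2 := h0 (by omega)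
      have h3 : x + d / t = (t * x + d) / t := by field_simp
      rw [h3] at h2
      have h4 : 0 ≤ t * x + d := by
        have := mul_nonneg h2 ht.le
        rwa [div_mul_cancel₀ _ ht.ne'] at this
      have h5 : (u' : ℝ) + 1 ≤ u := by exact_mod_cast h
      nlinarith [mul_nonneg h4 (by linarith : (0 : ℝ) ≤ u - u'),
        mul_nonneg hd.le (mul_nonneg (by linarith : (0 : ℝ) ≤ u - u')
          (by linarith : (0 : ℝ) ≤ u - u' - 1))]
    · simp
    · have h2 := h1 (by omega)
      have h5 : (u : ℝ) + 1 ≤ u' := by exact_mod_cast h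
      nlinarith [mul_nonneg (by linarith : (0 : ℝ) ≤ d - x * t) (by linarith : (0 : ℝ) ≤ u' - u),
        mul_nonneg hd.le (mul_nonneg (by linarith : (0 : ℝ) ≤ u' - u)
          (by linarith : (0 : ℝ) ≤ u' - u - 1))]

/-- Point in column `u` and row `v` of a square grid of `m²` points of spacing `2 d`. -/
noncomputable def gridPoint (m : ℕ) (d : ℝ) (u v : ℕ) : ℂ :=
  (d * (2 * u - (m - 1)) : ℝ) + (d * (2 * v - (m - 1)) : ℝ) * Complex.I

variable {M m : ℕ} {s : Fin M → ℂ} {d : ℝ}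

lemma gridPoint_injective (hd : 0 < d) :
    Function.Injective fun p : ℕ × ℕ => gridPoint m d p.1 p.2 := by
  rintro ⟨u, v⟩ ⟨u', v'⟩ h
  have hre := congrArg Complex.re h
  have him := congrArg Complex.im h
  simp only [gridPoint, Complex.add_re, Complex.mul_I_re, Complex.add_im, Complex.mul_I_im,
    Complex.ofReal_re, Complex.ofReal_im, neg_zero, add_zero, zero_add] at hre him
  have h1 := mul_left_cancel₀ hd.ne' hre
  have h2 := mul_left_cancel₀ hd.ne' him
  have h3 : (u : ℝ) = u' := by linarith
  have h4 : (v : ℝ) = v' := by linarith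
  exact Prod.ext (by exact_mod_cast h3) (by exact_mod_cast h4)

lemma sum_eq_sum_gridPoint (hs : Function.Injective s) (hd : 0 < d)
    (hrange : Set.range s = {z | ∃ u < m, ∃ v < m, z = gridPoint m d u v}) (F : ℂ → ℝ) :
    ∑ k, F (s k) = ∑ u ∈ Finset.range m, ∑ v ∈ Finset.range m, F (gridPoint m d u v) := by
  classical
  have h : Finset.univ.image s = (Finset.range m ×ˢ Finset.range m).image
      fun p : ℕ × ℕ => gridPoint m d p.1 p.2 := by
    rw [← Finset.coe_inj, Finset.coe_image, Finset.coe_univ, Set.image_univ, hrange]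
    ext z
    constructor
    · rintro ⟨u, hu, v, hv, rfl⟩
      exact Finset.mem_coe.2 (Finset.mem_image.2 ⟨(u, v), by simp [hu, hv], rfl⟩)
    · intro hz
      obtain ⟨⟨u, v⟩, huv, rfl⟩ := Finset.mem_image.1 (Finset.mem_coe.1 hz)
      simp only [Finset.mem_product, Finset.mem_range] at huv
      exact ⟨u, huv.1, v, huv.2, rfl⟩
  rw [← Finset.sum_image (f := F) (g := s) hs.injOn, h,
    Finset.sum_image (gridPoint_injective hd).injOn, Finset.sum_product]

/-- Symbol error probability of a point of a square constellation in Gaussian noise. -/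
lemma symbolError_qam (hd : 0 < d)
    (hrange : Set.range s = {z | ∃ u < m, ∃ v < m, z = gridPoint m d u v}) {k : Fin M} {u v : ℕ}
    (hu : u < m) (hv : v < m) (hk : s k = gridPoint m d u v) {t : ℝ} (ht : 0 < t) :
    symbolError s k t = 1 -
      (gaussianReal 0 ((1 : ℝ) / 2).toNNReal).real (rowCell m u (d / t)) *
      (gaussianReal 0 ((1 : ℝ) / 2).toNNReal).real (rowCell m v (d / t)) := by
  have hsq : ∀ (z : ℂ) (u' v' : ℕ), ‖s k + t * z - gridPoint m d u' v'‖ ^ 2 =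
      (t * z.re - 2 * d * ((u' : ℝ) - u)) ^ 2 + (t * z.im - 2 * d * ((v' : ℝ) - v)) ^ 2 := by
    intro z u' v'
    rw [Complex.sq_norm, Complex.normSq_apply, hk]
    simp only [gridPoint, Complex.sub_re, Complex.sub_im, Complex.add_re, Complex.mul_I_re,
      Complex.add_im, Complex.mul_I_im, Complex.ofReal_re, Complex.ofReal_im, neg_zero, add_zero,
      zero_add, Complex.re_ofReal_mul, Complex.im_ofReal_mul]
    ring
  have hset : {z : ℂ | s k + t * z ∉ decisionRegion s k} =
      {z | z.re ∈ rowCell m u (d / t) ∧ z.im ∈ rowCell m v (d / t)}ᶜ := by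
    ext z
    simp only [Set.mem_ofPred_eq, Set.mem_compl_iff, not_iff_not]
    rw [← forall_abs_le_abs_sub_iff hu hd ht, ← forall_abs_le_abs_sub_iff hv hd ht]
    have hmem : s k + t * z ∈ decisionRegion s k ↔ ∀ u' < m, ∀ v' < m,
        ‖s k + t * z - gridPoint m d u v‖ ^ 2 ≤ ‖s k + t * z - gridPoint m d u' v'‖ ^ 2 := by
      constructor
      · intro h u' hu' v' hv'
        obtain ⟨j, hj⟩ : gridPoint m d u' v' ∈ Set.range s := hrange ▸ ⟨u', hu', v', hv', rfl⟩
        rw [sq_le_sq₀ (norm_nonneg _) (norm_nonneg _), ← hj, ← hk]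
        exact h j
      · intro h j
        have h1 : s j ∈ Set.range s := ⟨j, rfl⟩
        rw [hrange] at h1
        obtain ⟨u', hu', v', hv', hj⟩ := h1
        have := h u' hu' v' hv'
        rwa [sq_le_sq₀ (norm_nonneg _) (norm_nonneg _), ← hj, ← hk] at this
    rw [hmem]
    simp only [hsq, sub_self, mul_zero, sub_zero]
    constructor
    · intro h
      refine ⟨fun u' hu' => ?_, fun v' hv' => ?_⟩
      · simpa using h u' hu' v hv
      · simpa using h u hu v' hv'
    · rintro ⟨h1, h2⟩ u' hu' v' hv'
      exact add_le_add (h1 u' hu') (h2 v' hv')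
  have hm1 := measurableSet_rowCell m u (d / t)
  have hm2 := measurableSet_rowCell m v (d / t)
  have hm : MeasurableSet {z : ℂ | z.re ∈ rowCell m u (d / t) ∧ z.im ∈ rowCell m v (d / t)} :=
    (Complex.measurable_re hm1).inter (Complex.measurable_im hm2)
  rw [symbolError, hset, probReal_compl_eq_one_sub hm,
    complexGaussian_real_re_im hm1 hm2]

/-- Sum of the symbol error probabilities of a square constellation in Gaussian noise. -/
lemma sum_symbolError_qam (hm : 0 < m) (hs : Function.Injective s) (hd : 0 < d)
    (hrange : Set.range s = {z | ∃ u < m, ∃ v < m, z = gridPoint m d u v}) {t : ℝ} (ht : 0 < t) :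
    ∑ k, symbolError s k t = (m : ℝ) ^ 2 - (m - 2 * (m - 1) * gaussianTail (d / t)) ^ 2 := by
  -- The error probability as a function of the symbol's position, not of its index, so that the sum
  -- can be taken over the grid.
  set F : ℂ → ℝ := fun w =>
    (complexGaussian 1).real {z | ¬ ∀ y ∈ Set.range s, ‖w + t * z - w‖ ≤ ‖w + t * z - y‖} with hF
  have hFs : ∀ k, symbolError s k t = F (s k) := fun k => by
    simp only [hF, symbolError, decisionRegion, Set.mem_ofPred_eq, Set.forall_mem_range]
  have hgrid : ∀ u < m, ∀ v < m, F (gridPoint m d u v) = 1 -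
      (gaussianReal 0 ((1 : ℝ) / 2).toNNReal).real (rowCell m u (d / t)) *
      (gaussianReal 0 ((1 : ℝ) / 2).toNNReal).real (rowCell m v (d / t)) := by
    intro u hu v hv
    obtain ⟨k, hk⟩ : gridPoint m d u v ∈ Set.range s := hrange ▸ ⟨u, hu, v, hv, rfl⟩
    rw [← hk, ← hFs, symbolError_qam hd hrange hu hv hk ht]
  simp_rw [hFs]
  rw [sum_eq_sum_gridPoint hs hd hrange]
  rw [Finset.sum_congr rfl fun u hu => Finset.sum_congr rfl fun v hv =>
    hgrid u (Finset.mem_range.1 hu) v (Finset.mem_range.1 hv)]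
  simp only [Finset.sum_sub_distrib, ← Finset.mul_sum, ← Finset.sum_mul,
    sum_real_rowCell hm (div_pos hd ht)]
  simp
  ring

lemma sum_sq_two_mul_sub (m : ℕ) :
    ∑ u ∈ Finset.range m, (2 * (u : ℝ) - (m - 1)) ^ 2 = (m : ℝ) * ((m : ℝ) ^ 2 - 1) / 3 := by
  have h1 : ∀ n : ℕ, ∑ u ∈ Finset.range n, (u : ℝ) = n * (n - 1) / 2 := fun n => by
    induction n with
    | zero => simp
    | succ n ih => rw [Finset.sum_range_succ, ih]; push_cast; ring
  have h2 : ∀ n : ℕ, ∑ u ∈ Finset.range n, (u : ℝ) ^ 2 = n * (n - 1) * (2 * n - 1) / 6 :=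
    fun n => by
      induction n with
      | zero => simp
      | succ n ih => rw [Finset.sum_range_succ, ih]; push_cast; ring
  have h3 : ∀ u : ℕ, (2 * (u : ℝ) - (m - 1)) ^ 2 =
      4 * (u : ℝ) ^ 2 - 4 * (m - 1) * u + (m - 1) ^ 2 := fun u => by ring
  simp_rw [h3]
  rw [Finset.sum_add_distrib, Finset.sum_sub_distrib, ← Finset.mul_sum, ← Finset.mul_sum, h1, h2]
  simp
  ring

/-- Equiprobable symbols thus have mean energy `2d²(M-1)/3`, the origin of the constant
`3/(2(M-1))`. -/
lemma sum_sq_norm_qam (hs : Function.Injective s) (hd : 0 < d)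
    (hrange : Set.range s = {z | ∃ u < m, ∃ v < m, z = gridPoint m d u v}) :
    ∑ k, ‖s k‖ ^ 2 = 2 * d ^ 2 * m ^ 2 * (m ^ 2 - 1) / 3 := by
  rw [sum_eq_sum_gridPoint hs hd hrange fun z => ‖z‖ ^ 2]
  have h : ∀ u v : ℕ, ‖gridPoint m d u v‖ ^ 2 =
      d ^ 2 * (2 * (u : ℝ) - (m - 1)) ^ 2 + d ^ 2 * (2 * (v : ℝ) - (m - 1)) ^ 2 := fun u v => by
    rw [gridPoint, Complex.sq_norm, Complex.normSq_add_mul_I]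
    ring
  simp_rw [h, Finset.sum_add_distrib, ← Finset.mul_sum, sum_sq_two_mul_sub]
  simp only [Finset.sum_const, Finset.card_range, nsmul_eq_mul, ← Finset.mul_sum,
    sum_sq_two_mul_sub]
  ring

variable {Ω : Type*} {L : ℕ} {P : Params M L} {X : Signals Ω M L} {det : ℝ → ℂ → Fin M}
  [MeasurableSpace Ω] {μ : Measure Ω} [IsProbabilityMeasure μ]

/-- The conditional error probability of equiprobable square `M`-QAM. -/
lemma IsNetwork.condExp_errorEvent_qam (hX : IsNetwork μ P X)
    (hdet : IsMinDistDetector P.s det) (hqam : IsSquareQAM P.s) (hp : ∀ k, P.p k = 1 / M) :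
    μ⟦errorEvent P X det | MeasurableSpace.comap X.shadow0 inferInstance⟧ =ᵐ[μ]
      fun ω => 4 * (1 - 1 / Real.sqrt M) * craigIntegral P (stableLaw P X μ) (VG P X μ)
          (X.shadow0 ω) (Real.pi / 2) (3 / (2 * (M - 1))) -
        4 * (1 - 1 / Real.sqrt M) ^ 2 * craigIntegral P (stableLaw P X μ) (VG P X μ)
          (X.shadow0 ω) (Real.pi / 4) (3 / (2 * (M - 1))) := by
  obtain ⟨m, hm, hMm, d, hd, hrange⟩ := hqam
  have hm0 : (0 : ℝ) < m := by exact_mod_cast (by omega : 0 < m)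
  have hm2 : (2 : ℝ) ≤ m := by exact_mod_cast hm
  have hM : (M : ℝ) = (m : ℝ) ^ 2 := by exact_mod_cast hMm
  have hsqrt : Real.sqrt M = m := by rw [hM, Real.sqrt_sq hm0.le]
  have hM1 : (0 : ℝ) < M - 1 := by rw [hM]; nlinarith
  have hE : avgEnergy P.s P.p = 2 * d ^ 2 * (M - 1) / 3 := by
    simp only [avgEnergy, hp, ← Finset.mul_sum]
    rw [sum_sq_norm_qam P.s_injective hd hrange, hM]
    field_simp
  have hd2 : d ^ 2 = 3 / (2 * (M - 1)) * avgEnergy P.s P.p := by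
    rw [hE]
    field_simp
  have h := hX.condExp_errorEvent_of_sum_eq hdet (I := Finset.univ)
    -- With `q` the tail, the error probability is `1 - (1 - 2(1-1/m)q)²`. Its terms in `q` and `q²`
    -- are the two summands, with the ranges `π/2` and `π/4`.
    (c := fun i : Bool => if i then 4 * (1 - 1 / (m : ℝ)) * (1 / Real.pi) else
      -(4 * (1 - 1 / (m : ℝ)) ^ 2 * (1 / Real.pi)))
    (φ := fun i => if i then Real.pi / 2 else Real.pi / 4) (a := fun _ => d)
    (w := fun _ => 3 / (2 * (M - 1))) (f := fun _ => Real.sin)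
    (fun i => by split_ifs <;> positivity)
    (fun _ => by fun_prop) (fun _ => hd2)
    (fun t ht => by
      have h1 := gaussianTail_eq (div_pos hd ht)
      have h2 := gaussianTail_sq_eq (div_pos hd ht)
      simp_rw [div_div] at h1 h2
      simp only [hp, ← Finset.mul_sum, Fintype.sum_bool, if_true, Bool.false_eq_true, if_false]
      rw [sum_symbolError_qam (by omega) P.s_injective hd hrange ht, hM, mul_assoc (4 * _), ← h1,
        neg_mul, mul_assoc (4 * _), ← h2]
      field_simp
      ring)
  refine h.trans (ae_of_all _ fun ω => ?_)
  simp only [Fintype.sum_bool, if_true, Bool.false_eq_true, if_false, craigIntegral, hsqrt]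
  ring

end QAM
end PoissonInterference

theorem mainTheorem3 {Ω : Type*} [MeasurableSpace Ω] (μ : MeasureTheory.Measure Ω)
    [MeasureTheory.IsProbabilityMeasure μ] {M L : ℕ}
    (P : PoissonInterference.Params M L) (X : PoissonInterference.Signals Ω M L)
    (hX : PoissonInterference.IsNetwork μ P X)
    (det : ℝ → ℂ → Fin M) (hdet : PoissonInterference.IsMinDistDetector P.s det) :
    -- the series that defines the aggregate interference converges almost surely
    (∀ᵐ ω ∂μ, Tendsto (fun n => PoissonInterference.partialInterference P X n ω) atTop
      (𝓝 (PoissonInterference.interference P X ω))) ∧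
    -- `ν` is the law of `B`
    ∃ ν : MeasureTheory.Measure ℝ, MeasureTheory.IsProbabilityMeasure ν ∧
      PoissonInterference.IsStableLaw ν (1 / P.b) 1 (Real.cos (Real.pi / (2 * P.b))) ∧
      (∀ᵐ x ∂ν, 0 < x) ∧
      -- `Y = √B G` in law, with independent `B` and `G`
      μ.map (PoissonInterference.interference P X) =
        (ν.prod (PoissonInterference.complexGaussian
          (2 * PoissonInterference.VG P X μ))).map (fun y : ℝ × ℂ => (Real.sqrt y.1 : ℂ) * y.2) ∧
      -- error probability, conditional on the probe shadowing, for an arbitrary constellation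
      (μ⟦PoissonInterference.errorEvent P X det |
          MeasurableSpace.comap X.shadow0 inferInstance⟧ =ᵐ[μ]
        fun ω => PoissonInterference.errorFormula P ν
          (PoissonInterference.VG P X μ) (X.shadow0 ω)) ∧
      -- equiprobable `M`-PSK
      (PoissonInterference.IsPSK P.s → (∀ k, P.p k = 1 / M) →
        μ⟦PoissonInterference.errorEvent P X det |
            MeasurableSpace.comap X.shadow0 inferInstance⟧ =ᵐ[μ]
          fun ω => PoissonInterference.craigIntegral P ν
            (PoissonInterference.VG P X μ) (X.shadow0 ω)
            ((M - 1) / M * Real.pi) (Real.sin (Real.pi / M) ^ 2)) ∧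
      -- equiprobable square `M`-QAM
      (PoissonInterference.IsSquareQAM P.s → (∀ k, P.p k = 1 / M) →
        μ⟦PoissonInterference.errorEvent P X det |
            MeasurableSpace.comap X.shadow0 inferInstance⟧ =ᵐ[μ]
          fun ω =>
            4 * (1 - 1 / Real.sqrt M) * PoissonInterference.craigIntegral P ν
              (PoissonInterference.VG P X μ) (X.shadow0 ω)
              (Real.pi / 2) (3 / (2 * (M - 1))) -
            4 * (1 - 1 / Real.sqrt M) ^ 2 * PoissonInterference.craigIntegral P ν
              (PoissonInterference.VG P X μ) (X.shadow0 ω)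
              (Real.pi / 4) (3 / (2 * (M - 1)))) := by
  have hν := hX.isProbabilityMeasure_stableLaw
  exact ⟨hX.ae_tendsto_partialInterference, PoissonInterference.stableLaw P X μ, hν,
    hX.isStableLaw_stableLaw, hX.ae_stableLaw_pos, hX.map_interference,
    hX.condExp_errorEvent_eq_errorFormula hdet, hX.condExp_errorEvent_psk hdet,
    hX.condExp_errorEvent_qam hdet⟩
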